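/- Setting. Let $d\ge 2$, let $\theta^\star\in\mathbb S^{d-1}$ be unknown, and let $f:[-1,1]\to[-1,1]$ be a known link function. In each round $t=1,2,\dots$ the learner plays $a_t\in\mathbb S^{d-1}$ and observes $r_t=f(\langle\theta^\star,a_t\rangle)+\xi_t$, where, conditionally on the past and on $a_t$, the noise $\xi_t$ is centered and $1$-sub-Gaussian ($\mathbb E[e^{\lambda\xi_t}\mid \text{past},a_t]\le e^{\lambda^2/2}$ for all $\lambda\in\mathbb R$). Assumption 1. $f$ is non-decreasing with $|f|\le 1$ on $[-1,1]$, and $f$ is differentiable on $[1-\gamma_0,1]$ with $\gamma_1\le f'(x)\le\gamma_2$ there, where $0<\gamma_0\le 0.1$ and $\gamma_1,\gamma_2>0$. Assumption 2. $f$ is differentiable on $[0,1]$ and $f'\ge c_0$ there, where $c_0>0$. Assumption 3. $f$ is convex on $[0,1]$. (Derivatives are relative to $[-1,1]$, i.e. one-sided at the end points.) Procedure. Initialization (hypothesis testing): given integers $M,n$ and a threshold $\tau$, draw $M$ directions independently and uniformly from $\mathbb S^{d-1}$, play each of them $n$ times, and accept the first one whose mean reward is at least $\tau$ (the first direction if none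 is accepted); during these $Mn$ rounds $\theta_t=a_t$ is the direction being played. SGD: starting in round $Mn+1$ with $\theta_{Mn+1}$ equal to the accepted direction, and given deterministic sequences $\eta_t>0$ and $\sigma_t\in[0,1]$, for $t\ge Mn+1$, $$a_t=\sqrt{1-\sigma_t^2}\,\theta_t+\sigma_tZ_t,\qquad Z_t\mid\text{past}\ \sim\ \mathrm{Unif}\{z\in\mathbb S^{d-1}:\langle z,\theta_t\rangle=0\},$$ $$\theta_{t+1/2}=\theta_t-\eta_t\bigl(f(\langle\theta_t,a_t\rangle)-r_t\bigr)f'(\langle\theta_t,a_t\rangle)(I-\theta_t\theta_t^\top)a_t,\qquad \theta_{t+1}=\frac{\theta_{t+1/2}}{\|\theta_{t+1/2}\|}.$$ Write $m_t=\langle\theta^\star,\theta_t\rangle$, and let $I(b)=\int_{1/(2\sqrt d)}^{b}\frac{m}{f'(m)^2}\,dm\in[0,\infty]$, where the integrand is $+\infty$ where $f'(m)=0$. Statement. For all $\gamma_0,\gamma_1,\gamma_2,c_0$ as above there are $C>0$ and $k\in\mathbb N$, depending only on these, such that the following holds for every $d\ge2$, every $f$ satisfying Assumption 1 together with Assumption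 2 or Assumption 3, and every $\delta>0$. 1. (Pure exploration) For every $\varepsilon>0$ there are $M,n,\tau,(\eta_t),(\sigma_t)$ and a number of rounds $T$ (initialization included), all depending only on $d,f,\varepsilon,\delta$ and $\gamma_0,\gamma_1,\gamma_2,c_0$, with $$T\le C\log^k\!\Bigl(3+d+\tfrac1\varepsilon+\tfrac1\delta\Bigr)\Bigl(d^2\,I(1-\gamma_0/4)+\frac{d^2}{\varepsilon}\Bigr),$$ such that for every $\theta^\star$ and every noise as above, the estimate obtained after $T$ rounds has correlation at least $1-\varepsilon$ with $\theta^\star$ with probability at least $1-\delta T$. 2. (Regret minimization) There are $M,n,\tau,(\eta_t),(\sigma_t)$, depending only on $d,f,\delta$ and $\gamma_0,\gamma_1,\gamma_2,c_0$, such that for every $T$, every $\theta^\star$ and every noise as above, with probability at least $1-\delta T$, $$\sum_{t=1}^T\bigl(f(1)-f(m_t)\bigr)\le C\log^k\!\Bigl(3+d+\tfrac1\delta\Bigr)\min\Bigl\{T,\ d^2\,I(1-\gamma_0/2)+d\sqrt T\Bigr\}.$$ -/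

import Mathlib

open MeasureTheory ProbabilityTheory
open scoped ENNReal RealInnerProductSpace

noncomputable section

namespace RidgeSGD

/-- The ambient space `ℝ^d` with its Euclidean norm. -/
abbrev Vec (d : ℕ) : Type := EuclideanSpace ℝ (Fin d)

/-- The uniform distribution on the unit sphere `{z ∈ V : ‖z‖ = 1}` of a linear subspace `V` of
`ℝ^d`: the normalized surface measure of that sphere, regarded as a measure on `ℝ^d`.
(The Lebesgue measure of `V` is taken in an orthonormal basis of `V`.) -/
def unifSphere {d : ℕ} (V : Submodule ℝ (Vec d)) : Measure (Vec d) :=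
  let S : Measure (Metric.sphere (0 : V) 1) :=
    ((stdOrthonormalBasis ℝ V).toBasis.addHaar).toSphere
  (S Set.univ)⁻¹ • S.map (fun z : Metric.sphere (0 : V) 1 => ((z : V) : Vec d))

/-! ### Link functions -/

/-- The derivative of a link function `f : [-1,1] → ℝ` (one-sided at the end points). -/
def linkDeriv (f : ℝ → ℝ) (x : ℝ) : ℝ := derivWithin f (Set.Icc (-1) 1) x

/-- Monotone link function, bounded by one, which is locally linear near `x = 1`.
Only the values of `f` on `[-1,1]` matter. -/
structure IsLink (f : ℝ → ℝ) (γ₀ γ₁ γ₂ : ℝ) : Prop where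
  monotone : MonotoneOn f (Set.Icc (-1) 1)
  bounded : ∀ x ∈ Set.Icc (-1 : ℝ) 1, |f x| ≤ 1
  differentiable : ∀ x ∈ Set.Icc (1 - γ₀) 1, DifferentiableWithinAt ℝ f (Set.Icc (-1) 1) x
  deriv_mem : ∀ x ∈ Set.Icc (1 - γ₀) 1, γ₁ ≤ linkDeriv f x ∧ linkDeriv f x ≤ γ₂

/-- The generalized linear bandit condition: `f' ≥ c₀` on `[0,1]`. -/
def HasDerivLowerBound (f : ℝ → ℝ) (c₀ : ℝ) : Prop :=
  ∀ x ∈ Set.Icc (0 : ℝ) 1, DifferentiableWithinAt ℝ f (Set.Icc (-1) 1) x ∧ c₀ ≤ linkDeriv f x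

/-- The integral `∫_{1/(2√d)}^{b} m / f'(m)² dm`, as an element of `[0,∞]`; the integrand is `∞`
where `f'(m) = 0`. -/
def burnInIntegral (f : ℝ → ℝ) (d : ℕ) (b : ℝ) : ℝ≥0∞ :=
  ∫⁻ m in Set.Icc (1 / (2 * √(d : ℝ))) b, ENNReal.ofReal m / ENNReal.ofReal (linkDeriv f m) ^ 2

/-! ### The SGD evolution -/

/-- The exploration rule `a = √(1-σ²) θ + σ z`. -/
def action {d : ℕ} (σ : ℝ) (θ z : Vec d) : Vec d := √(1 - σ ^ 2) • θ + σ • z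

/-- `θ_{t+1/2} = θ - η (f(⟨θ,a⟩) - r) f'(⟨θ,a⟩) (I - θθᵀ) a`. -/
def sgdHalfStep {d : ℕ} (f : ℝ → ℝ) (η : ℝ) (θ a : Vec d) (r : ℝ) : Vec d :=
  θ - (η * (f ⟪θ, a⟫ - r) * linkDeriv f ⟪θ, a⟫) • (a - ⟪θ, a⟫ • θ)

/-- `θ_{t+1} = θ_{t+1/2} / ‖θ_{t+1/2}‖`. -/
def sgdStep {d : ℕ} (f : ℝ → ℝ) (η : ℝ) (θ a : Vec d) (r : ℝ) : Vec d :=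
  ‖sgdHalfStep f η θ a r‖⁻¹ • sgdHalfStep f η θ a r

/-- The parameters of the procedure. Initialization: each of `numCandidates` random directions is
played `numPlays` times, and the first one whose mean reward reaches `threshold` is accepted.
Then SGD is run, with learning rate `η s` and exploration parameter `σ s` in its `s`-th step. -/
structure Procedure where
  numCandidates : ℕ
  numPlays : ℕ
  threshold : ℝ
  η : ℕ → ℝ
  σ : ℕ → ℝ
  η_pos : ∀ s, 0 < η s
  σ_mem : ∀ s, σ s ∈ Set.Icc (0 : ℝ) 1

namespace Procedure

/-- The number of rounds spent on the initialization. -/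
def initLength (P : Procedure) : ℕ := P.numCandidates * P.numPlays

/-- The mean reward of candidate `j`, which is played in rounds
`j * numPlays, …, (j + 1) * numPlays - 1`. -/
def meanReward (P : Procedure) (r : ℕ → ℝ) (j : ℕ) : ℝ :=
  (∑ i ∈ Finset.range P.numPlays, r (j * P.numPlays + i)) / P.numPlays

/-- The index of the first candidate accepted by the test (candidate `0` if none is accepted:
`sInf ∅ = 0` in `ℕ`). -/
def selected (P : Procedure) (r : ℕ → ℝ) : ℕ :=
  sInf {j | j < P.numCandidates ∧ P.threshold ≤ P.meanReward r j}

end Procedure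

/-- `IsRun P f θs μ ℱ cand z θ a r`: on the probability space `(Ω, μ)` with history `ℱ`
(`ℱ t` is what is known before round `t`; rounds are numbered `0, 1, 2, …`), the estimates `θ`,
actions `a` and rewards `r` are produced by the procedure `P` interacting with the single-index
model with link `f` and parameter `θs`. The auxiliary randomness consists of the candidate
directions `cand` and the exploration directions `z`. -/
structure IsRun {d : ℕ} {Ω : Type*} [mΩ : MeasurableSpace Ω] [StandardBorelSpace Ω]
    (P : Procedure) (f : ℝ → ℝ) (θs : Vec d) (μ : Measure Ω) [IsProbabilityMeasure μ]
    (ℱ : Filtration ℕ mΩ) (cand z θ a : ℕ → Ω → Vec d) (r : ℕ → Ω → ℝ) : Prop where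
  cand_meas : ∀ j, Measurable[ℱ 0] (cand j)
  z_meas : ∀ t, Measurable[ℱ (t + 1)] (z t)
  θ_meas : ∀ t, Measurable[ℱ t] (θ t)
  a_meas : ∀ t, Measurable[ℱ (t + 1)] (a t)
  r_meas : ∀ t, Measurable[ℱ (t + 1)] (r t)
  /-- The candidates are i.i.d. uniform on the unit sphere of `ℝ^d`. -/
  cand_indep : iIndepFun cand μ
  cand_law : ∀ j, μ.map (cand j) = unifSphere ⊤
  /-- During the initialization the current candidate is the estimate and is played. -/
  init_θ : ∀ t < P.initLength, ∀ ω, θ t ω = cand (t / P.numPlays) ω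
  init_a : ∀ t < P.initLength, ∀ ω, a t ω = θ t ω
  /-- SGD is started at the direction selected by the test. -/
  start : ∀ ω, θ P.initLength ω = cand (P.selected (fun t => r t ω)) ω
  /-- Given the past, `z t` is uniform on the unit sphere of the orthogonal complement of
  `θ t`. -/
  z_law : ∀ t, P.initLength ≤ t →
    ∀ᵐ ω ∂μ, (condExpKernel μ (ℱ t) ω).map (z t) = unifSphere (ℝ ∙ θ t ω)ᗮ
  sgd_a : ∀ t, P.initLength ≤ t → ∀ ω, a t ω = action (P.σ (t - P.initLength)) (θ t ω) (z t ω)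
  sgd_θ : ∀ t, P.initLength ≤ t → ∀ ω,
    θ (t + 1) ω = sgdStep f (P.η (t - P.initLength)) (θ t ω) (a t ω) (r t ω)
  /-- The noise `r t - f(⟨θs, a t⟩)` is centered and `1`-sub-Gaussian given the past and the
  current action. -/
  noise : ∀ t, HasCondSubgaussianMGF (ℱ t ⊔ MeasurableSpace.comap (a t) inferInstance)
    (sup_le (ℱ.le t) (((a_meas t).mono (ℱ.le (t + 1)) le_rfl).comap_le))
    (fun ω => r t ω - f ⟪θs, a t ω⟫) 1 μ

end RidgeSGD

end

/-! Write m = ⟨θs, θ⟩, w = ⟨θs, z⟩ and lam = √(1 - σ²). A step moves θ along z only, so m becomes (m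
- α g w) / √(1 + (α g)²), where α = η f'(lam) σ and g = f(lam) - r is the prediction error. Averaged
over z, the part f(lam) - f(lam m) of g cancels by symmetry. The part f(lam m + σ w) - f(lam m)
pushes m upwards: for w > 0 at least with the slope S of f to the right of lam m, while for w < 0
monotonicity ensures that it does no harm. As w² has mean (1 - m²)/(d - 1), the drift is of order (α
σ S / d)(1 - m). Normalization and noise cost a multiple of α² m; the cost is proportional to m
because the mean of w² is at most of order m² once m ≥ 1/(2√d). `IsRun.lintegral_step_le` states
this for exponential moments: exp(-ℓ m') is dominated in mean by exp(-ℓ ((1 - a - b) m + a)) with a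
= `driftRate` and b = `shrinkRate`.

The rest of the SGD analysis concerns a real process with this property. In a phase with constant α,
iteration and Markov's inequality keep the process above a level minus a tolerance and lift it to
the next level, each failure having probability at most exp(-Lp) (`measure_not_above_le`). In the
burn-in, α proportional to S / (d B Lp) lifts the level B by a constant factor within about d² Lp²
B² / S² steps (`exists_burnIn_phase`). For convex f, S may be taken from a secant slope that
dominates f' on a window of length proportional to B on its left, so B² / S² is bounded by the
burn-in integral up to constants (`exists_slope`); otherwise S = min c₀ 1. The number of levels is
logarithmic. Afterwards, α proportional to the error E halves E within about d² Lp / E steps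
(`exists_late_phase`), which gives the error d² / t up to logarithms (`exists_schedule`). The
starting level comes from anti-concentration: a random direction has correlation 0.9/√d with
constant probability, and the test separates 0.9/√d from 0.7/√d (`IsRun.measure_init_lt_le`).

`exists_procedure` assembles these with Lp = 3 log(3 + d + 1/δ), on horizons T ≤ 1/δ; on longer ones
the probability bound is void. Pure exploration solves d² / t ≤ ε. For the regret, f is Lipschitz
near 1, d² / t ≤ d / √t for t ≥ d², and 1/√t is summed. The regret charges θ_t and not a_t, so a
constant σ costs nothing. -/

noncomputable section

namespace RidgeSGD

/-! ### The uniform distribution on a sphere -/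

section Sphere

variable {E : Type*} [NormedAddCommGroup E] [InnerProductSpace ℝ E] [FiniteDimensional ℝ E]
  [MeasurableSpace E] [BorelSpace E]

/-- The uniform distribution on the unit sphere of `E`, as a measure on `E`. -/
def uniformSphere (E : Type*) [NormedAddCommGroup E] [InnerProductSpace ℝ E]
    [FiniteDimensional ℝ E] [MeasurableSpace E] [BorelSpace E] : Measure E :=
  ((volume : Measure E).toSphere Set.univ)⁻¹ •
    (volume : Measure E).toSphere.map (fun z : Metric.sphere (0 : E) 1 => (z : E))

/-- Transfers all computations to the inner product space `V` itself, on which its isometries act.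
-/
theorem unifSphere_eq_map {d : ℕ} (V : Submodule ℝ (Vec d)) :
    unifSphere V = (uniformSphere V).map (fun z : V => (z : Vec d)) := by
  unfold unifSphere uniformSphere
  simp only [OrthonormalBasis.addHaar_eq_volume]
  rw [Measure.map_smul, Measure.map_map (by fun_prop) (by fun_prop)]
  rfl

instance isProbabilityMeasure_uniformSphere [Nontrivial E] :
    IsProbabilityMeasure (uniformSphere E) := by
  constructor
  unfold uniformSphere
  rw [Measure.smul_apply, Measure.map_apply (by fun_prop) MeasurableSet.univ, Set.preimage_univ,
    smul_eq_mul]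
  refine ENNReal.inv_mul_cancel ?_ (measure_ne_top _ _)
  rw [Measure.measure_univ_ne_zero]
  exact Measure.toSphere_ne_zero _

theorem ae_norm_uniformSphere : ∀ᵐ z ∂(uniformSphere E), ‖z‖ = 1 := by
  unfold uniformSphere
  refine Measure.ae_smul_measure ?_ _
  rw [ae_map_iff (by fun_prop) (measurableSet_eq_fun (by fun_prop) (by fun_prop))]
  exact Filter.Eventually.of_forall fun z => by simp

open scoped Pointwise in
-- The spherical measure of a set is proportional to the volume of the cone over it, and linear
-- isometries map cones to cones of equal volume.
theorem map_uniformSphere (φ : E ≃ₗᵢ[ℝ] E) : (uniformSphere E).map φ = uniformSphere E := by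
  unfold uniformSphere
  rw [Measure.map_smul]
  congr 1
  ext s hs
  have hφ : Measurable φ := φ.continuous.measurable
  have hval : Measurable (fun z : Metric.sphere (0 : E) 1 => (z : E)) := by fun_prop
  rw [Measure.map_apply hφ hs, Measure.map_apply hval (hφ hs), Measure.map_apply hval hs,
    Measure.toSphere_apply' _ (hval (hφ hs)), Measure.toSphere_apply' _ (hval hs)]
  congr 1
  have hmp := (LinearIsometryEquiv.measurePreserving φ)
  rw [← hmp.measure_preimage_emb φ.toHomeomorph.measurableEmbedding (Set.Ioo (0 : ℝ) 1 •
    (Subtype.val '' ((fun z : Metric.sphere (0 : E) 1 => (z : E)) ⁻¹' s)))]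
  congr 1
  ext x
  simp only [Set.mem_preimage, Set.mem_smul, Set.mem_image, Subtype.exists]
  constructor
  · rintro ⟨c, hc, y, ⟨y', hy', hy1, rfl⟩, rfl⟩
    exact ⟨c, hc, φ y', ⟨φ y', by simpa using hy', hy1, rfl⟩, by simp⟩
  · rintro ⟨c, hc, y, ⟨y', hy', hy1, rfl⟩, h⟩
    refine ⟨c, hc, φ.symm y', ⟨φ.symm y', by simpa using hy', by simpa using hy1, rfl⟩, ?_⟩
    apply φ.injective
    simpa using h

theorem integral_comp_uniformSphere (φ : E ≃ₗᵢ[ℝ] E) (h : E → ℝ) :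
    ∫ z, h (φ z) ∂(uniformSphere E) = ∫ z, h z ∂(uniformSphere E) := by
  conv_rhs => rw [← map_uniformSphere φ]
  exact (φ.toHomeomorph.measurableEmbedding.integral_map _).symm

theorem integrable_uniformSphere [Nontrivial E] {h : E → ℝ} (hh : Continuous h) :
    Integrable h (uniformSphere E) := by
  obtain ⟨C, hC⟩ := (isCompact_sphere (0 : E) 1).exists_bound_of_continuousOn hh.continuousOn
  refine Integrable.of_bound hh.aestronglyMeasurable C ?_
  filter_upwards [ae_norm_uniformSphere] with z hz
  exact hC z (by simpa using hz)

/-- Moments along unit vectors do not depend on the direction. -/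
theorem integral_inner_congr (h : ℝ → ℝ) {u v : E} (huv : ‖u‖ = ‖v‖) :
    ∫ z, h ⟪u, z⟫ ∂(uniformSphere E) = ∫ z, h ⟪v, z⟫ ∂(uniformSphere E) := by
  have := integral_comp_uniformSphere (E := E) ((ℝ ∙ (u - v))ᗮ.reflection)
    (fun z => h ⟪v, z⟫)
  rw [← this]
  refine integral_congr_ae (Filter.Eventually.of_forall fun z => ?_)
  show h ⟪u, z⟫ = h ⟪v, (ℝ ∙ (u - v))ᗮ.reflection z⟫
  rw [← LinearIsometryEquiv.inner_map_map ((ℝ ∙ (u - v))ᗮ.reflection) u z,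
    Submodule.reflection_sub huv]

theorem integral_neg_uniformSphere (h : ℝ → ℝ) (u : E) :
    ∫ z, h (-⟪u, z⟫) ∂(uniformSphere E) = ∫ z, h ⟪u, z⟫ ∂(uniformSphere E) := by
  have := integral_inner_congr h (u := -u) (v := u) (norm_neg u)
  simpa [inner_neg_left] using this

theorem integral_inner_uniformSphere (u : E) :
    ∫ z, ⟪u, z⟫ ∂(uniformSphere E) = 0 := by
  have := integral_neg_uniformSphere (fun x => x) u
  rw [integral_neg] at this
  linarith

/-- By invariance all coordinates have the same second moment, and on the sphere their squares add
up to one. -/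
theorem integral_inner_sq_uniformSphere [Nontrivial E] (u : E) :
    ∫ z, ⟪u, z⟫ ^ 2 ∂(uniformSphere E) = ‖u‖ ^ 2 / Module.finrank ℝ E := by
  have hn : 0 < Module.finrank ℝ E := Module.finrank_pos
  set b := stdOrthonormalBasis ℝ E
  have hsum : ∑ i, ∫ z, ⟪b i, z⟫ ^ 2 ∂(uniformSphere E) = 1 := by
    rw [← integral_finsetSum _ fun i _ => integrable_uniformSphere (by fun_prop)]
    have : ∀ᵐ z ∂(uniformSphere E), ∑ i, ⟪b i, z⟫ ^ 2 = 1 := by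
      filter_upwards [ae_norm_uniformSphere] with z hz
      have := b.sum_sq_norm_inner_right z
      simpa [hz] using this
    rw [integral_congr_ae this]
    simp
  have hall : ∀ i, ∫ z, ⟪u, z⟫ ^ 2 ∂(uniformSphere E)
      = ‖u‖ ^ 2 * ∫ z, ⟪b i, z⟫ ^ 2 ∂(uniformSphere E) := by
    intro i
    rw [integral_inner_congr (fun x => x ^ 2) (u := u) (v := ‖u‖ • b i)
      (by simp [norm_smul]), ← integral_const_mul]
    refine integral_congr_ae (Filter.Eventually.of_forall fun z => ?_)
    simp [inner_smul_left, mul_pow]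
  have h2 : ∑ i : Fin (Module.finrank ℝ E), ∫ z, ⟪u, z⟫ ^ 2 ∂(uniformSphere E) = ‖u‖ ^ 2 := by
    rw [Finset.sum_congr rfl fun i _ => hall i, ← Finset.mul_sum, hsum, mul_one]
  rw [Finset.sum_const, Finset.card_univ, Fintype.card_fin, nsmul_eq_mul] at h2
  rw [eq_div_iff (by positivity), mul_comm, h2]

/-- Comparing (x_i ± x_j)⁴ with (√2 x)⁴ by invariance gives x_i² x_j² the mean c / 3 for i ≠ j,
where c is the fourth moment. Since all products x_i² x_j² add up to one, this determines c. -/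
theorem integral_inner_pow_four_uniformSphere [Nontrivial E] (u : E) (hu : ‖u‖ = 1) :
    ∫ z, ⟪u, z⟫ ^ 4 ∂(uniformSphere E)
      = 3 / (Module.finrank ℝ E * (Module.finrank ℝ E + 2)) := by
  have hn : 0 < Module.finrank ℝ E := Module.finrank_pos
  set b := stdOrthonormalBasis ℝ E
  set c := ∫ z, ⟪u, z⟫ ^ 4 ∂(uniformSphere E) with hc
  have hi : ∀ {h : E → ℝ}, Continuous h → Integrable h (uniformSphere E) :=
    fun hh => integrable_uniformSphere hh
  have hdiag : ∀ i, ∫ z, ⟪b i, z⟫ ^ 4 ∂(uniformSphere E) = c := fun i =>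
    integral_inner_congr (fun x => x ^ 4) (by simp [hu])
  have hoff : ∀ i j, i ≠ j →
      ∫ z, ⟪b i, z⟫ ^ 2 * ⟪b j, z⟫ ^ 2 ∂(uniformSphere E) = c / 3 := by
    intro i j hij
    have hor : ⟪b i, b j⟫ = 0 := b.orthonormal.2 hij
    have hp : ‖b i + b j‖ = ‖(√2 : ℝ) • u‖ := by
      rw [norm_smul, hu, mul_one, Real.norm_of_nonneg (by positivity), ← Real.sqrt_sq (norm_nonneg _),
        norm_add_sq_real, hor]
      simp; norm_num
    have hm : ‖b i - b j‖ = ‖(√2 : ℝ) • u‖ := by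
      rw [norm_smul, hu, mul_one, Real.norm_of_nonneg (by positivity), ← Real.sqrt_sq (norm_nonneg _),
        norm_sub_sq_real, hor]
      simp; norm_num
    have h4 : ∫ z, ⟪(√2 : ℝ) • u, z⟫ ^ 4 ∂(uniformSphere E) = 4 * c := by
      rw [hc, ← integral_const_mul]
      refine integral_congr_ae (Filter.Eventually.of_forall fun z => ?_)
      simp only [inner_smul_left, mul_pow]
      have : (√2 : ℝ) ^ 4 = 4 := by
        rw [show (4 : ℕ) = 2 * 2 by norm_num, pow_mul, Real.sq_sqrt (by norm_num)]; norm_num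
      simp [this]
    have e1 := integral_inner_congr (fun x => x ^ 4) hp
    have e2 := integral_inner_congr (fun x => x ^ 4) hm
    rw [h4] at e1 e2
    have e3 : ∫ z, (⟪b i + b j, z⟫ ^ 4 + ⟪b i - b j, z⟫ ^ 4) ∂(uniformSphere E)
        = ∫ z, (2 * ⟪b i, z⟫ ^ 4 + 2 * ⟪b j, z⟫ ^ 4
          + 12 * (⟪b i, z⟫ ^ 2 * ⟪b j, z⟫ ^ 2)) ∂(uniformSphere E) := by
      refine integral_congr_ae (Filter.Eventually.of_forall fun z => ?_)
      simp only [inner_add_left, inner_sub_left]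
      ring
    rw [integral_add (hi (by fun_prop)) (hi (by fun_prop)),
      integral_add (hi (by fun_prop)) (hi (by fun_prop)),
      integral_add (hi (by fun_prop)) (hi (by fun_prop)),
      integral_const_mul, integral_const_mul, integral_const_mul, hdiag, hdiag, e1, e2] at e3
    linarith
  have hsum : ∑ i, ∑ j, ∫ z, ⟪b i, z⟫ ^ 2 * ⟪b j, z⟫ ^ 2 ∂(uniformSphere E) = 1 := by
    have : ∀ᵐ z ∂(uniformSphere E), ∑ i, ∑ j, ⟪b i, z⟫ ^ 2 * ⟪b j, z⟫ ^ 2 = 1 := by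
      filter_upwards [ae_norm_uniformSphere] with z hz
      have := b.sum_sq_norm_inner_right z
      simp only [hz, Real.norm_eq_abs, sq_abs, one_pow] at this
      rw [← Finset.sum_mul_sum, this, one_mul]
    have h1 := integral_congr_ae this
    rw [integral_finsetSum _ fun i _ => hi (by fun_prop)] at h1
    simp only [integral_const, probReal_univ, smul_eq_mul, mul_one] at h1
    rw [← h1]
    refine Finset.sum_congr rfl fun i _ => ?_
    rw [integral_finsetSum _ fun i _ => hi (by fun_prop)]
  have hval : ∀ i j, ∫ z, ⟪b i, z⟫ ^ 2 * ⟪b j, z⟫ ^ 2 ∂(uniformSphere E)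
      = c / 3 + if i = j then 2 * c / 3 else 0 := by
    intro i j
    split_ifs with h
    · subst h
      rw [← (by ring : c = c / 3 + 2 * c / 3), ← hdiag i]
      refine integral_congr_ae (Filter.Eventually.of_forall fun z => ?_)
      show _ = _
      ring
    · rw [hoff i j h, add_zero]
  simp only [hval, Finset.sum_add_distrib, Finset.sum_const, Finset.card_univ, Fintype.card_fin,
    Finset.sum_ite_eq, Finset.mem_univ, if_true, nsmul_eq_mul] at hsum
  have hn' : (0 : ℝ) < Module.finrank ℝ E := by exact_mod_cast hn
  rw [eq_div_iff (by positivity)]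
  nlinarith

/-- Only exploration directions with w > 0 contribute a guaranteed drift; by symmetry they carry
half of the second moment. -/
theorem integral_inner_posPart_sq_uniformSphere [Nontrivial E] (u : E) :
    ∫ z, (max ⟪u, z⟫ 0) ^ 2 ∂(uniformSphere E) = ‖u‖ ^ 2 / (2 * Module.finrank ℝ E) := by
  have h1 := integral_neg_uniformSphere (E := E) (fun x => (max x 0) ^ 2) u
  have h2 : ∫ z, ((max ⟪u, z⟫ 0) ^ 2 + (max (-⟪u, z⟫) 0) ^ 2) ∂(uniformSphere E)
      = ∫ z, ⟪u, z⟫ ^ 2 ∂(uniformSphere E) := by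
    refine integral_congr_ae (Filter.Eventually.of_forall fun z => ?_)
    show _ = _
    rcases le_total 0 ⟪u, z⟫ with h | h
    · simp [h]
    · simp [h]
  rw [integral_add (integrable_uniformSphere (by fun_prop))
    (integrable_uniformSphere (by fun_prop)), integral_inner_sq_uniformSphere] at h2
  rw [h1] at h2
  have : ‖u‖ ^ 2 / (2 * (Module.finrank ℝ E : ℝ)) = ‖u‖ ^ 2 / Module.finrank ℝ E / 2 := by
    rw [div_div, mul_comm]
  rw [this, ← h2]
  ring

/-- Anti-concentration of a coordinate of a uniform random unit vector. -/
theorem uniformSphere_real_inner_ge [Nontrivial E] (u : E) (hu : ‖u‖ = 1) :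
    1 / 200 ≤ (uniformSphere E).real {z | 9 / 10 / √(Module.finrank ℝ E : ℝ) ≤ ⟪u, z⟫} := by
  set n : ℝ := (Module.finrank ℝ E : ℝ) with hn_def
  have hn : 0 < n := by
    have : 0 < Module.finrank ℝ E := Module.finrank_pos
    rw [hn_def]; exact_mod_cast this
  set A : Set E := {z | 9 / 10 / √n ≤ ⟪u, z⟫}
  have hA : MeasurableSet A := measurableSet_le (by fun_prop) (by fun_prop)
  have hA' : MeasurableSet {z : E | 9 / 10 / √n ≤ -⟪u, z⟫} :=
    measurableSet_le (by fun_prop) (by fun_prop)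
  have hsymm : (uniformSphere E).real {z | 9 / 10 / √n ≤ -⟪u, z⟫} = (uniformSphere E).real A := by
    have := integral_neg_uniformSphere (E := E) (fun x => if 9 / 10 / √n ≤ x then 1 else 0) u
    have e1 : ∀ z : E, (if 9 / 10 / √n ≤ -⟪u, z⟫ then (1 : ℝ) else 0)
      = Set.indicator {z : E | 9 / 10 / √n ≤ -⟪u, z⟫} 1 z := fun z => by
        simp [Set.indicator_apply]
    have e2 : ∀ z : E, (if 9 / 10 / √n ≤ ⟪u, z⟫ then (1 : ℝ) else 0)
      = Set.indicator A 1 z := fun z => by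
        simp [Set.indicator_apply, A]
    simp only [e1, e2] at this
    rwa [integral_indicator_one hA', integral_indicator_one hA] at this
  -- A Paley–Zygmund argument: on the event |x| ≥ 0.9/√n, AM-GM gives x² ≤ y x⁴ / 2 + 1 / (2y). This
  -- y optimizes the resulting probability 0.19² / 6 > 1/200.
  set y : ℝ := 0.19 * n / 3 with hy
  have hypos : 0 < y := by positivity
  have hpt : ∀ z : E, ⟪u, z⟫ ^ 2 ≤ 0.81 / n + y / 2 * ⟪u, z⟫ ^ 4
      + 1 / (2 * y) * (A.indicator 1 z + Set.indicator {z : E | 9 / 10 / √n ≤ -⟪u, z⟫} 1 z) := by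
    intro z
    have hsq : (9 / 10 / √n) ^ 2 = 0.81 / n := by
      rw [div_pow, Real.sq_sqrt hn.le]; norm_num
    have hnn : 0 ≤ 1 / (2 * y) := by positivity
    have i1 : 0 ≤ A.indicator (1 : E → ℝ) z := Set.indicator_nonneg (fun _ _ => by simp) z
    have i2 : 0 ≤ Set.indicator {z : E | 9 / 10 / √n ≤ -⟪u, z⟫} (1 : E → ℝ) z :=
      Set.indicator_nonneg (fun _ _ => by simp) z
    have h81 : 0 ≤ 0.81 / n := by positivity
    by_cases hz : 9 / 10 / √n ≤ |⟪u, z⟫|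
    · have hone : 1 ≤ A.indicator (1 : E → ℝ) z
          + Set.indicator {z : E | 9 / 10 / √n ≤ -⟪u, z⟫} (1 : E → ℝ) z := by
        rcases abs_cases ⟪u, z⟫ with ⟨h, _⟩ | ⟨h, _⟩
        · have : z ∈ A := by simpa [A, h] using hz
          rw [Set.indicator_of_mem this]
          simp only [Pi.one_apply]; linarith
        · have : z ∈ {z : E | 9 / 10 / √n ≤ -⟪u, z⟫} := by simpa [h] using hz
          rw [Set.indicator_of_mem this]
          simp only [Pi.one_apply]; linarith
      have hamgm : ⟪u, z⟫ ^ 2 ≤ y / 2 * ⟪u, z⟫ ^ 4 + 1 / (2 * y) := by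
        have : y / 2 * ⟪u, z⟫ ^ 4 + 1 / (2 * y) - ⟪u, z⟫ ^ 2
          = (y * ⟪u, z⟫ ^ 2 - 1) ^ 2 / (2 * y) := by field_simp; ring
        have h0 : 0 ≤ (y * ⟪u, z⟫ ^ 2 - 1) ^ 2 / (2 * y) := by positivity
        linarith
      nlinarith
    · have : ⟪u, z⟫ ^ 2 ≤ 0.81 / n := by
        rw [← hsq, ← sq_abs]
        exact pow_le_pow_left₀ (abs_nonneg _) (not_le.1 hz).le 2
      have h4 : 0 ≤ y / 2 * ⟪u, z⟫ ^ 4 := by positivity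
      have := mul_nonneg hnn (add_nonneg i1 i2)
      linarith
  have iA : Integrable (A.indicator (1 : E → ℝ)) (uniformSphere E) :=
    (integrable_const (1 : ℝ)).indicator hA
  have iA' : Integrable (Set.indicator {z : E | 9 / 10 / √n ≤ -⟪u, z⟫} (1 : E → ℝ))
      (uniformSphere E) := (integrable_const (1 : ℝ)).indicator hA'
  have i4 : Integrable (fun z : E => y / 2 * ⟪u, z⟫ ^ 4) (uniformSphere E) :=
    integrable_uniformSphere (by fun_prop)
  have hint := integral_mono (integrable_uniformSphere (by fun_prop))
    ((((integrable_const (0.81 / n)).add i4)).add ((iA.add iA').const_mul (1 / (2 * y)))) hpt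
  rw [integral_add' ((integrable_const _).add i4) ((iA.add iA').const_mul _),
    integral_add' (integrable_const _) i4, integral_const_mul, integral_const_mul,
    integral_add' iA iA', integral_indicator_one hA, integral_indicator_one hA', hsymm,
    integral_inner_pow_four_uniformSphere u hu, integral_inner_sq_uniformSphere, hu,
    ← two_mul, integral_const, probReal_univ, one_smul, ← hn_def] at hint
  have hy2 : 1 / (2 * y) * (2 * (uniformSphere E).real A)
      = (3 / 0.19) * (uniformSphere E).real A / n := by
    rw [hy]; field_simp
  have hy3 : y / 2 * (3 / (n * (n + 2))) ≤ 0.095 / n := by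
    rw [hy, div_mul_div_comm, div_le_div_iff₀ (by positivity) hn]
    nlinarith [sq_nonneg n]
  rw [hy2, one_pow] at hint
  have hfin : 1 / n ≤ (0.81 + 0.095 + (3 / 0.19) * (uniformSphere E).real A) / n := by
    rw [add_div, add_div]; linarith
  rw [div_le_div_iff_of_pos_right hn] at hfin
  norm_num at hfin ⊢
  linarith

end Sphere

/-! ### Moments on the unit sphere of a subspace of ℝ^d -/

section UnifSphere

variable {d : ℕ}

theorem isProbabilityMeasure_unifSphere (V : Submodule ℝ (Vec d)) [Nontrivial V] :
    IsProbabilityMeasure (unifSphere V) := by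
  rw [unifSphere_eq_map]
  exact Measure.isProbabilityMeasure_map (by fun_prop)

theorem ae_unifSphere (V : Submodule ℝ (Vec d)) :
    ∀ᵐ z ∂(unifSphere V), z ∈ V ∧ ‖z‖ = 1 := by
  have hms : MeasurableSet {z : Vec d | z ∈ V ∧ ‖z‖ = 1} :=
    V.closed_of_finiteDimensional.measurableSet.inter
      (measurableSet_eq_fun (by fun_prop) (by fun_prop))
  rw [unifSphere_eq_map, ae_map_iff (by fun_prop) hms]
  filter_upwards [ae_norm_uniformSphere] with z hz
  exact ⟨z.2, by simpa using hz⟩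

theorem unifSphere_top_real_ge (hd : 2 ≤ d) (u : Vec d) (hu : ‖u‖ = 1) :
    1 / 200 ≤ (unifSphere (⊤ : Submodule ℝ (Vec d))).real {z | 9 / 10 / √(d : ℝ) ≤ ⟪u, z⟫} := by
  have hfr : Module.finrank ℝ (⊤ : Submodule ℝ (Vec d)) = d := by simp
  have : Nontrivial (⊤ : Submodule ℝ (Vec d)) :=
    Module.nontrivial_of_finrank_pos (R := ℝ) (by omega)
  have h := uniformSphere_real_inner_ge (E := (⊤ : Submodule ℝ (Vec d))) ⟨u, trivial⟩ (by simpa using hu)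
  rw [hfr] at h
  rw [unifSphere_eq_map, Measure.real, Measure.map_apply (by fun_prop)
    (measurableSet_le (by fun_prop) (by fun_prop))]
  exact h

theorem finrank_orthogonal_unit (hd : 2 ≤ d) {θ : Vec d} (hθ : ‖θ‖ = 1) :
    Module.finrank ℝ (ℝ ∙ θ)ᗮ = d - 1 := by
  have h := (ℝ ∙ θ).finrank_add_finrank_orthogonal
  rw [finrank_span_singleton (by intro h; simp [h] at hθ), finrank_euclideanSpace_fin] at h
  omega

theorem nontrivial_orthogonal (hd : 2 ≤ d) {θ : Vec d} (hθ : ‖θ‖ = 1) :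
    Nontrivial (ℝ ∙ θ)ᗮ :=
  Module.nontrivial_of_finrank_pos (R := ℝ) (by rw [finrank_orthogonal_unit hd hθ]; omega)

/-- On the complement of θ, the functional ⟨θs, ·⟩ sees only the component of θs orthogonal to θ, of
squared length 1 - m², in dimension d - 1. -/
theorem integral_unifSphere_orthogonal (hd : 2 ≤ d) {θ θs : Vec d} (hθ : ‖θ‖ = 1) (hθs : ‖θs‖ = 1)
    (c₀ c₁ c₂ c₃ : ℝ) :
    Integrable (fun z => c₀ + c₁ * ⟪θs, z⟫ + c₂ * (max ⟪θs, z⟫ 0) ^ 2 + c₃ * ⟪θs, z⟫ ^ 2)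
      (unifSphere (ℝ ∙ θ)ᗮ) ∧
    ∫ z, (c₀ + c₁ * ⟪θs, z⟫ + c₂ * (max ⟪θs, z⟫ 0) ^ 2 + c₃ * ⟪θs, z⟫ ^ 2)
      ∂(unifSphere (ℝ ∙ θ)ᗮ)
      = c₀ + (c₂ / 2 + c₃) * ((1 - ⟪θs, θ⟫ ^ 2) / (d - 1)) := by
  have := nontrivial_orthogonal hd hθ
  set m := ⟪θs, θ⟫ with hm
  have hmem : θs - m • θ ∈ (ℝ ∙ θ)ᗮ := by
    rw [Submodule.mem_orthogonal_singleton_iff_inner_right, inner_sub_right, inner_smul_right,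
      real_inner_self_eq_norm_sq, hθ, real_inner_comm, ← hm]
    ring
  set u : (ℝ ∙ θ)ᗮ := ⟨θs - m • θ, hmem⟩ with hu
  have hnorm : ‖u‖ ^ 2 = 1 - m ^ 2 := by
    rw [hu, Submodule.coe_norm, Subtype.coe_mk, norm_sub_sq_real, hθs, inner_smul_right, ← hm,
      norm_smul, hθ, mul_one, Real.norm_eq_abs, sq_abs]
    ring
  have hin : ∀ z : (ℝ ∙ θ)ᗮ, ⟪θs, (z : Vec d)⟫ = ⟪u, z⟫ := by
    intro z
    have hz := (Submodule.mem_orthogonal_singleton_iff_inner_right (𝕜 := ℝ)).1 z.2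
    rw [Submodule.coe_inner, hu, Subtype.coe_mk, inner_sub_left, inner_smul_left, hz]
    simp
  have hd1 : ((Module.finrank ℝ (ℝ ∙ θ)ᗮ : ℕ) : ℝ) = d - 1 := by
    rw [finrank_orthogonal_unit hd hθ, Nat.cast_sub (by omega), Nat.cast_one]
  have i0 : Integrable (fun _ : (ℝ ∙ θ)ᗮ => c₀) (uniformSphere (ℝ ∙ θ)ᗮ) := integrable_const _
  have i1 : Integrable (fun z : (ℝ ∙ θ)ᗮ => c₁ * ⟪u, z⟫) (uniformSphere (ℝ ∙ θ)ᗮ) :=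
    integrable_uniformSphere (by fun_prop)
  have i2 : Integrable (fun z : (ℝ ∙ θ)ᗮ => c₂ * (max ⟪u, z⟫ 0) ^ 2) (uniformSphere (ℝ ∙ θ)ᗮ) :=
    integrable_uniformSphere (by fun_prop)
  have i3 : Integrable (fun z : (ℝ ∙ θ)ᗮ => c₃ * ⟪u, z⟫ ^ 2) (uniformSphere (ℝ ∙ θ)ᗮ) :=
    integrable_uniformSphere (by fun_prop)
  rw [unifSphere_eq_map, integrable_map_measure (by fun_prop) (by fun_prop),
    integral_map (by fun_prop) (by fun_prop)]
  simp only [Function.comp_def, hin]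
  refine ⟨((i0.add i1).add i2).add i3, ?_⟩
  rw [integral_add (f := fun z => c₀ + c₁ * ⟪u, z⟫ + c₂ * (max ⟪u, z⟫ 0) ^ 2)
      ((i0.add i1).add i2) i3,
    integral_add (f := fun z => c₀ + c₁ * ⟪u, z⟫) (i0.add i1) i2, integral_add i0 i1,
    integral_const_mul, integral_const_mul, integral_const_mul, integral_inner_uniformSphere,
    integral_inner_posPart_sq_uniformSphere, integral_inner_sq_uniformSphere, hnorm, hd1]
  simp only [integral_const, probReal_univ, smul_eq_mul]
  have : (0 : ℝ) < d - 1 := by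
    have : (2 : ℝ) ≤ d := by exact_mod_cast hd
    linarith
  field_simp
  ring

end UnifSphere

/-! ### Centered sub-Gaussian noise -/

section Noise

variable {Ω : Type*} {mΩ : MeasurableSpace Ω} {κ : Measure Ω} {X : Ω → ℝ}

theorem integral_exp_two_abs_le_of_subgaussian (h : HasSubgaussianMGF X 1 κ) :
    Integrable (fun ω => Real.exp (2 * X ω) + Real.exp (-2 * X ω)) κ ∧
    ∫ ω, (Real.exp (2 * X ω) + Real.exp (-2 * X ω)) ∂κ ≤ 2 * Real.exp 2 := by
  refine ⟨(h.integrable_exp_mul 2).add (h.integrable_exp_mul (-2)), ?_⟩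
  rw [integral_add (h.integrable_exp_mul 2) (h.integrable_exp_mul (-2))]
  have h1 := h.mgf_le 2
  have h2 := h.mgf_le (-2)
  unfold mgf at h1 h2
  norm_num at h1 h2 ⊢
  linarith

variable [IsProbabilityMeasure κ]

/-- Centering follows from the exponential bound: 1 + s 𝔼X ≤ 𝔼 exp(s X) ≤ exp(s²/2) ≤ 1 + s² gives
𝔼X ≤ s for small s > 0. -/
theorem integral_le_zero_of_subgaussian (h : HasSubgaussianMGF X 1 κ) : ∫ ω, X ω ∂κ ≤ 0 := by
  refine le_of_forall_pos_le_add fun t ht => ?_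
  rw [zero_add]
  set s := min t 1
  have hs : 0 < s := lt_min ht one_pos
  have h1 : ∫ ω, (1 + s * X ω) ∂κ ≤ Real.exp (1 * s ^ 2 / 2) := by
    refine le_trans (integral_mono ((integrable_const 1).add (h.integrable.const_mul s))
      (h.integrable_exp_mul s) fun ω => ?_) ((h.mgf_le s).trans (by simp))
    simpa [add_comm] using Real.add_one_le_exp (s * X ω)
  rw [integral_add (integrable_const 1) (h.integrable.const_mul s), integral_const_mul] at h1
  have h2 : Real.exp (1 * s ^ 2 / 2) ≤ 1 + s ^ 2 := by
    have hs1 : s ≤ 1 := min_le_right _ _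
    have hh : |1 * s ^ 2 / 2| ≤ 1 := by rw [abs_of_nonneg (by positivity)]; nlinarith
    have := Real.abs_exp_sub_one_le hh
    rw [abs_of_nonneg (by positivity : (0 : ℝ) ≤ 1 * s ^ 2 / 2)] at this
    have := (abs_le.1 this).2
    linarith
  simp only [integral_const, probReal_univ, smul_eq_mul, mul_one] at h1
  have h3 : s * ∫ ω, X ω ∂κ ≤ s * s := by nlinarith
  exact (le_of_mul_le_mul_left h3 hs).trans (min_le_left _ _)

theorem integral_eq_zero_of_subgaussian (h : HasSubgaussianMGF X 1 κ) : ∫ ω, X ω ∂κ = 0 := by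
  refine le_antisymm (integral_le_zero_of_subgaussian h) ?_
  have := integral_le_zero_of_subgaussian h.neg
  simp only [Pi.neg_apply, integral_neg] at this
  linarith

/-- Bounds for the factor normalizing a gradient step of size `y`. -/
theorem one_sub_inv_sqrt_bounds (y : ℝ) :
    0 < 1 / √(1 + y ^ 2) ∧ 1 / √(1 + y ^ 2) ≤ 1 ∧ 1 - 1 / √(1 + y ^ 2) ≤ y ^ 2 / 2 ∧
      1 - 1 / √(1 + y ^ 2) ≤ |y| := by
  set c := 1 / √(1 + y ^ 2) with hc
  have hsq : 0 < 1 + y ^ 2 := by positivity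
  have hc0 : 0 < c := by positivity
  have hcc : c ^ 2 * (1 + y ^ 2) = 1 := by
    rw [hc, div_pow, Real.sq_sqrt hsq.le]; field_simp
  have hc1 : c ≤ 1 := by nlinarith [sq_nonneg y, mul_nonneg (sq_nonneg c) (sq_nonneg y)]
  have hy2 : y ^ 2 = |y| ^ 2 := (sq_abs y).symm
  refine ⟨hc0, hc1, ?_, ?_⟩
  · by_contra hcon
    push Not at hcon
    set p := y ^ 2
    have hp : 0 ≤ p := sq_nonneg y
    have h1 : c ^ 2 < (1 - p / 2) ^ 2 := pow_lt_pow_left₀ (by linarith) hc0.le two_ne_zero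
    have h2 : (1 - p / 2) ^ 2 * (1 + p) ≤ 1 := by
      have : 0 ≤ p ^ 2 * (3 - p) := mul_nonneg (sq_nonneg p) (by linarith)
      nlinarith
    have h3 := mul_lt_mul_of_pos_right h1 hsq
    linarith
  · by_contra hcon
    push Not at hcon
    set p := |y|
    have hp : 0 ≤ p := abs_nonneg y
    have h1 : c ^ 2 < (1 - p) ^ 2 := pow_lt_pow_left₀ (by linarith) hc0.le two_ne_zero
    have h2 : (1 - p) ^ 2 * (1 + p ^ 2) ≤ 1 := by
      have hp1 : p < 1 := by linarith
      have : (1 - p) ^ 2 * (1 + p ^ 2) ≤ (1 - p) ^ 2 * (1 + p) ^ 2 := by gcongr; nlinarith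
      have h5 : (1 - p) ^ 2 * (1 + p) ^ 2 = (1 - p ^ 2) ^ 2 := by ring
      have h6 : (1 - p ^ 2) ^ 2 ≤ 1 := pow_le_one₀ (by nlinarith) (by nlinarith)
      linarith
    have h3 := mul_lt_mul_of_pos_right h1 hsq
    rw [hy2] at hcc h3
    linarith

theorem exp_le_one_add_add_sq_mul_exp_abs (x : ℝ) :
    Real.exp x ≤ 1 + x + x ^ 2 * Real.exp |x| := by
  have h := Complex.norm_exp_sub_sum_le_norm_mul_exp (x : ℂ) 2
  simp only [Finset.sum_range_succ, Finset.sum_range_zero] at h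
  norm_num at h
  rw [← Complex.ofReal_exp] at h
  have e : ((Real.exp x : ℝ) : ℂ) - (1 + (x : ℂ)) = ((Real.exp x - (1 + x) : ℝ) : ℂ) := by
    push_cast; ring
  rw [e, Complex.norm_real, Real.norm_eq_abs] at h
  have := (abs_le.1 h).2
  linarith

/-- The basic inequality for one normalized gradient step of size `y = α g`. -/
theorem exp_step_le {ℓ α m w g : ℝ} (hℓ : 0 ≤ ℓ) (hα : 0 ≤ α) (hm : 0 < m) (hm1 : m ≤ 1)
    (hw : |w| ≤ 1) (hℓα : ℓ * α ≤ 1 / 2) :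
    Real.exp (ℓ * (m - (m - α * g * w) / √(1 + (α * g) ^ 2))) ≤
      1 + ℓ * α * g * w + (ℓ * α ^ 2 * (5 * m + w ^ 2 / m) + 4 * ℓ ^ 2 * α ^ 2 * w ^ 2)
        * Real.exp (2 * |g|) := by
  obtain ⟨hc0, hc1, hA, hB⟩ := one_sub_inv_sqrt_bounds (α * g)
  set y := α * g with hy
  have hdiv : (m - y * w) / √(1 + y ^ 2) = (1 / √(1 + y ^ 2)) * (m - y * w) := by ring
  rw [hdiv]
  set c := 1 / √(1 + y ^ 2)
  have hay : |y| = α * |g| := by rw [hy, abs_mul, abs_of_nonneg hα]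
  have hy2 : y ^ 2 = |y| ^ 2 := (sq_abs y).symm
  have hay0 := abs_nonneg y
  -- Q is the sum of the normalization loss ℓ m (1 - c) and the gradient term ℓ c y w. All
  -- second-order errors are kept proportional to m, w² / m or w², because w² will average to at
  -- most a multiple of m².
  set Q := ℓ * (m - c * (m - y * w)) with hQ
  have hg0 := abs_nonneg g
  have hw0 := abs_nonneg w
  have hlay : ℓ * |y| ≤ |g| / 2 := by
    rw [hay]
    calc ℓ * (α * |g|) = (ℓ * α) * |g| := by ring
      _ ≤ 1 / 2 * |g| := by gcongr
      _ = |g| / 2 := by ring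
  have hQdecomp : Q = ℓ * (m * (1 - c)) + ℓ * (c * (y * w)) := by rw [hQ]; ring
  have hyw : |y * w| = |y| * |w| := abs_mul _ _
  have hc' : 0 ≤ 1 - c := by linarith
  have hQabs : |Q| ≤ |g| := by
    have h1 : |Q| ≤ ℓ * (m * (1 - c)) + ℓ * (c * (|y| * |w|)) := by
      rw [hQdecomp]
      refine (abs_add_le _ _).trans ?_
      rw [abs_of_nonneg (by positivity), abs_mul, abs_mul, hyw,
        abs_of_nonneg hℓ, abs_of_pos hc0]
    have h2 : m * (1 - c) ≤ 1 * |y| := mul_le_mul hm1 hB hc' zero_le_one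
    have h3 : c * (|y| * |w|) ≤ 1 * (|y| * 1) := by gcongr
    have h4 := mul_le_mul_of_nonneg_left h2 hℓ
    have h5 := mul_le_mul_of_nonneg_left h3 hℓ
    linarith
  have hlin : Q ≤ ℓ * α * g * w + ℓ * α ^ 2 * (m / 2 + |w|) * g ^ 2 := by
    have h1 : m * (1 - c) ≤ m * (y ^ 2 / 2) := by gcongr
    have h2 : c * (y * w) ≤ y * w + y ^ 2 * |w| := by
      have h3 : -(y * w) ≤ |y| * |w| := by rw [← hyw]; exact neg_le_abs _
      have h4 : (1 - c) * -(y * w) ≤ (1 - c) * (|y| * |w|) := mul_le_mul_of_nonneg_left h3 hc'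
      have h5 : (1 - c) * (|y| * |w|) ≤ |y| * (|y| * |w|) :=
        mul_le_mul_of_nonneg_right hB (by positivity)
      rw [hy2]
      linarith
    have h4 : ℓ * (m * (1 - c)) + ℓ * (c * (y * w))
      ≤ ℓ * (m * (y ^ 2 / 2)) + ℓ * (y * w + y ^ 2 * |w|) := by gcongr
    rw [hQdecomp]
    refine h4.trans (le_of_eq ?_)
    rw [hy]; ring
  have hquad : Q ^ 2 ≤ 2 * (ℓ ^ 2 * α ^ 2 * w ^ 2 * g ^ 2) + ℓ * m * α ^ 2 * |g| ^ 3 / 2 := by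
    have h1 : Q ^ 2 ≤ 2 * (ℓ * (m * (1 - c))) ^ 2 + 2 * (ℓ * (c * (y * w))) ^ 2 := by
      rw [hQdecomp]
      linarith [sq_nonneg (ℓ * (m * (1 - c)) - ℓ * (c * (y * w))),
        add_sq (ℓ * (m * (1 - c))) (ℓ * (c * (y * w))),
        sub_sq (ℓ * (m * (1 - c))) (ℓ * (c * (y * w)))]
    have h2 : (ℓ * (c * (y * w))) ^ 2 ≤ ℓ ^ 2 * α ^ 2 * w ^ 2 * g ^ 2 := by
      have : (ℓ * (c * (y * w))) ^ 2 = c ^ 2 * (ℓ ^ 2 * α ^ 2 * w ^ 2 * g ^ 2) := by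
        rw [hy]; ring
      rw [this]
      exact mul_le_of_le_one_left (by positivity) (pow_le_one₀ hc0.le hc1)
    -- One factor 1 - c is bounded by |y| and the other by y² / 2. Then ℓ |y| ≤ |g| / 2 absorbs one
    -- factor ℓ, and the result is linear in ℓ.
    have h3 : (ℓ * (m * (1 - c))) ^ 2 ≤ ℓ * m * α ^ 2 * |g| ^ 3 / 4 := by
      have e1 : (1 - c) ^ 2 ≤ |y| * (y ^ 2 / 2) := by
        rw [sq]; exact mul_le_mul hB hA hc' hay0
      calc (ℓ * (m * (1 - c))) ^ 2 = ℓ ^ 2 * m ^ 2 * (1 - c) ^ 2 := by ring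
        _ ≤ ℓ ^ 2 * m ^ 2 * (|y| * (y ^ 2 / 2)) := by gcongr
        _ = (ℓ * |y|) * (ℓ * m * (m * y ^ 2 / 2)) := by ring
        _ ≤ (|g| / 2) * (ℓ * m * (1 * y ^ 2 / 2)) := by gcongr
        _ = ℓ * m * α ^ 2 * |g| ^ 3 / 4 := by
          rw [hy2, hay]; ring
    linarith
  have hexp := exp_le_one_add_add_sq_mul_exp_abs Q
  have hgsq : g ^ 2 ≤ 2 * Real.exp |g| := by
    have := Real.quadratic_le_exp_of_nonneg hg0
    rw [← sq_abs]; linarith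
  have hgcu : |g| ^ 3 ≤ 6 * Real.exp |g| := by
    have := Real.pow_div_factorial_le_exp |g| hg0 3
    norm_num [Nat.factorial] at this
    linarith
  have hexpg : Real.exp (2 * |g|) = Real.exp |g| * Real.exp |g| := by
    rw [← Real.exp_add]; ring_nf
  have he1 : 1 ≤ Real.exp |g| := Real.one_le_exp hg0
  have hQe : Real.exp |Q| ≤ Real.exp |g| := Real.exp_le_exp.2 hQabs
  rw [hexpg]
  generalize Real.exp |g| = e at *
  -- AM-GM turns the cross term |w|, whose mean would be too large, into terms of the size of m.
  have hw2 : 2 * |w| ≤ m + w ^ 2 / m := by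
    have : m + w ^ 2 / m - 2 * |w| = (m - |w|) ^ 2 / m := by
      field_simp; rw [← sq_abs w]; ring
    have h0 : 0 ≤ (m - |w|) ^ 2 / m := by positivity
    linarith
  have t1 : ℓ * α ^ 2 * (m / 2 + |w|) * g ^ 2 ≤ ℓ * α ^ 2 * (m + 2 * |w|) * (e * e) := by
    have : g ^ 2 ≤ 2 * (e * e) := by nlinarith
    calc ℓ * α ^ 2 * (m / 2 + |w|) * g ^ 2 ≤ ℓ * α ^ 2 * (m / 2 + |w|) * (2 * (e * e)) := by gcongr
      _ = _ := by ring
  have t2 : Q ^ 2 * Real.exp |Q| ≤ (4 * (ℓ ^ 2 * α ^ 2 * w ^ 2) + 3 * (ℓ * m * α ^ 2)) * (e * e) := by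
    calc Q ^ 2 * Real.exp |Q|
        ≤ (2 * (ℓ ^ 2 * α ^ 2 * w ^ 2 * g ^ 2) + ℓ * m * α ^ 2 * |g| ^ 3 / 2) * e := by gcongr
      _ ≤ (2 * (ℓ ^ 2 * α ^ 2 * w ^ 2 * (2 * e)) + ℓ * m * α ^ 2 * (6 * e) / 2) * e := by gcongr
      _ = _ := by ring
  have t3 : ℓ * α ^ 2 * (m + 2 * |w|) * (e * e) ≤ ℓ * α ^ 2 * (2 * m + w ^ 2 / m) * (e * e) := by
    gcongr ?_ * _
    gcongr ?_ * ?_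
    linarith
  have t4 : (ℓ * α ^ 2 * (5 * m + w ^ 2 / m) + 4 * ℓ ^ 2 * α ^ 2 * w ^ 2) * (e * e)
      = ℓ * α ^ 2 * (2 * m + w ^ 2 / m) * (e * e)
        + (4 * (ℓ ^ 2 * α ^ 2 * w ^ 2) + 3 * (ℓ * m * α ^ 2)) * (e * e) := by ring
  linarith

end Noise

/-! ### Averaging one normalized step over the noise and over the exploration direction -/

/-- A bound for `𝔼 exp (2|g|)`, where `g` is the error of a predicted reward. -/
def noiseConst : ℝ := 2 * Real.exp 6

theorem one_le_noiseConst : 1 ≤ noiseConst := by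
  unfold noiseConst
  have := Real.one_le_exp (show (0 : ℝ) ≤ 6 by norm_num)
  linarith

/-- The noise enters linearly with mean zero, apart from the factor exp(2|g|). As |g₀| ≤ 2, that
factor has mean at most exp 4 · 2 exp 2 = `noiseConst`. -/
theorem lintegral_exp_step_le {Ω : Type*} {mΩ : MeasurableSpace Ω} {κ : Measure Ω}
    [IsProbabilityMeasure κ] {X : Ω → ℝ} (h : HasSubgaussianMGF X 1 κ)
    {ℓ α m w g₀ : ℝ} (hℓ : 0 ≤ ℓ) (hα : 0 ≤ α) (hm : 0 < m) (hm1 : m ≤ 1)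
    (hw : |w| ≤ 1) (hℓα : ℓ * α ≤ 1 / 2) (hg : |g₀| ≤ 2) :
    ∫⁻ ω, ENNReal.ofReal (Real.exp (ℓ * (m - (m - α * (g₀ - X ω) * w)
      / √(1 + (α * (g₀ - X ω)) ^ 2)))) ∂κ ≤
    ENNReal.ofReal (1 + ℓ * α * g₀ * w
      + (ℓ * α ^ 2 * (5 * m + w ^ 2 / m) + 4 * ℓ ^ 2 * α ^ 2 * w ^ 2) * noiseConst) := by
  set A := ℓ * α ^ 2 * (5 * m + w ^ 2 / m) + 4 * ℓ ^ 2 * α ^ 2 * w ^ 2 with hA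
  have hA0 : 0 ≤ A := by positivity
  set H : Ω → ℝ := fun ω => 1 + ℓ * α * g₀ * w + (-(ℓ * α * w)) * X ω
    + (A * Real.exp 4) * (Real.exp (2 * X ω) + Real.exp (-2 * X ω)) with hH
  have hpt : ∀ ω, Real.exp (ℓ * (m - (m - α * (g₀ - X ω) * w)
      / √(1 + (α * (g₀ - X ω)) ^ 2))) ≤ H ω := by
    intro ω
    refine (exp_step_le hℓ hα hm hm1 hw hℓα).trans ?_
    have h1 : Real.exp (2 * |g₀ - X ω|)
        ≤ Real.exp 4 * (Real.exp (2 * X ω) + Real.exp (-2 * X ω)) := by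
      have h2 : 2 * |g₀ - X ω| ≤ 4 + 2 * |X ω| := by linarith [abs_sub g₀ (X ω)]
      refine (Real.exp_le_exp.2 h2).trans ?_
      rw [Real.exp_add]
      gcongr
      rcases abs_cases (X ω) with ⟨h, _⟩ | ⟨h, _⟩ <;> rw [h]
      · linarith [Real.exp_pos (-2 * X ω)]
      · rw [show 2 * -X ω = -2 * X ω by ring]; linarith [Real.exp_pos (2 * X ω)]
    have h2 := mul_le_mul_of_nonneg_left h1 hA0
    simp only [hH]
    linarith
  obtain ⟨hexp, hexp2⟩ := integral_exp_two_abs_le_of_subgaussian h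
  have i1 : Integrable (fun ω => 1 + ℓ * α * g₀ * w + (-(ℓ * α * w)) * X ω) κ :=
    (integrable_const _).add (h.integrable.const_mul _)
  have i2 := hexp.const_mul (A * Real.exp 4)
  have hHi : Integrable H κ := i1.add i2
  calc _ ≤ ∫⁻ ω, ENNReal.ofReal (H ω) ∂κ :=
        lintegral_mono fun ω => ENNReal.ofReal_le_ofReal (hpt ω)
    _ = ENNReal.ofReal (∫ ω, H ω ∂κ) :=
        (ofReal_integral_eq_lintegral_ofReal hHi (Filter.Eventually.of_forall fun ω =>
          (Real.exp_pos _).le.trans (hpt ω))).symm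
    _ ≤ _ := by
        apply ENNReal.ofReal_le_ofReal
        rw [hH, integral_add i1 i2, integral_add (integrable_const _) (h.integrable.const_mul _),
          integral_const_mul, integral_const_mul, integral_eq_zero_of_subgaussian h]
        simp only [integral_const, probReal_univ, smul_eq_mul, one_mul, mul_zero, add_zero]
        have h6 : Real.exp 4 * (2 * Real.exp 2) = noiseConst := by
          rw [noiseConst, show (6 : ℝ) = 4 + 2 by norm_num, Real.exp_add]; ring
        rw [← h6]
        have := mul_le_mul_of_nonneg_left hexp2 (mul_nonneg hA0 (Real.exp_pos 4).le)
        linarith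

/-- `f` grows at least with slope `S` to the right of every point of `[p, 1]`. -/
def SlopeFrom (f : ℝ → ℝ) (p S : ℝ) : Prop :=
  ∀ x y, p ≤ x → x ≤ y → y ≤ 1 → S * (y - x) ≤ f y - f x

theorem norm_le_one_combination {d : ℕ} {θs θ z : Vec d} {σ : ℝ} (hθs : ‖θs‖ = 1) (hθ : ‖θ‖ = 1)
    (hz : ‖z‖ = 1) (hθz : ⟪θ, z⟫ = 0) (hσ : σ ^ 2 ≤ 1) :
    |√(1 - σ ^ 2) * ⟪θs, θ⟫ + σ * ⟪θs, z⟫| ≤ 1 := by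
  have h : √(1 - σ ^ 2) * ⟪θs, θ⟫ + σ * ⟪θs, z⟫ = ⟪θs, action σ θ z⟫ := by
    rw [action, inner_add_right, inner_smul_right, inner_smul_right]
  have hn : ‖action σ θ z‖ = 1 := by
    rw [← sq_eq_sq₀ (norm_nonneg _) zero_le_one, action, norm_add_sq_real, norm_smul, norm_smul, hθ,
      hz, inner_smul_left, inner_smul_right, hθz]
    simp only [Real.norm_eq_abs, mul_one, sq_abs, mul_zero, add_zero]
    rw [Real.sq_sqrt (by linarith)]; ring
  rw [h]
  exact (abs_real_inner_le_norm _ _).trans (by rw [hθs, hn, one_mul])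

/-- The rate at which one step with rate `α` moves the correlation towards one. -/
def driftRate (d : ℕ) (σ S α : ℝ) : ℝ := α * σ * S / (4 * d)

/-- The rate at which the noise in one step with rate `α` shrinks the correlation. -/
def shrinkRate (α : ℝ) : ℝ := 13 * noiseConst * α ^ 2

set_option maxHeartbeats 800000 in
-- The condition `hℓα` makes the term quadratic in ℓ at most half of the drift, which is why the
-- drift rate has denominator 4 d while the positive part alone would give 2 d.
theorem lintegral_sphere_step_le {d : ℕ} (hd : 2 ≤ d) {f : ℝ → ℝ} {p S σ ℓ α : ℝ} {θs θ : Vec d}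
    (hf : MonotoneOn f (Set.Icc (-1) 1)) (hfb : ∀ x ∈ Set.Icc (-1 : ℝ) 1, |f x| ≤ 1)
    (hslope : SlopeFrom f p S) (hS : 0 < S) (hS1 : S ≤ 1) (hσ : 0 < σ) (hσ1 : σ ≤ 1)
    (hℓ : 0 ≤ ℓ) (hα : 0 ≤ α) (hℓα : 16 * noiseConst * (ℓ * α) ≤ σ * S)
    (hθs : ‖θs‖ = 1) (hθ : ‖θ‖ = 1) (hm : 1 / (2 * √(d : ℝ)) ≤ ⟪θs, θ⟫)
    (hp : p ≤ √(1 - σ ^ 2) * ⟪θs, θ⟫) :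
    ∫⁻ z, ENNReal.ofReal (1 + ℓ * α * (f √(1 - σ ^ 2) - f (√(1 - σ ^ 2) * ⟪θs, θ⟫ + σ * ⟪θs, z⟫))
        * ⟪θs, z⟫ + (ℓ * α ^ 2 * (5 * ⟪θs, θ⟫ + ⟪θs, z⟫ ^ 2 / ⟪θs, θ⟫)
          + 4 * ℓ ^ 2 * α ^ 2 * ⟪θs, z⟫ ^ 2) * noiseConst) ∂(unifSphere (ℝ ∙ θ)ᗮ) ≤
    ENNReal.ofReal (Real.exp (-ℓ * (driftRate d σ S α * (1 - ⟪θs, θ⟫)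
      - shrinkRate α * ⟪θs, θ⟫))) := by
  set m := ⟪θs, θ⟫ with hm_def
  set lam := √(1 - σ ^ 2) with hlam
  have hD := one_le_noiseConst
  set D := noiseConst
  have hd2 : (2 : ℝ) ≤ d := by exact_mod_cast hd
  have hd0 : (0 : ℝ) < d := by linarith
  have hm0 : 0 < m := lt_of_lt_of_le (by positivity) hm
  have hm1 : m ≤ 1 := (le_abs_self _).trans
    ((abs_real_inner_le_norm _ _).trans (by rw [hθs, hθ, one_mul]))
  have hlam0 : 0 ≤ lam := Real.sqrt_nonneg _
  have hlam1 : lam ≤ 1 := Real.sqrt_le_one.2 (by nlinarith)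
  set x := lam * m with hx
  have hx0 : 0 ≤ x := by positivity
  have hx1 : x ≤ 1 := by nlinarith
  have hlα : ℓ * α ≤ 1 / 16 := by
    have h1 : 0 ≤ ℓ * α := by positivity
    have : σ * S ≤ 1 := by nlinarith
    nlinarith
  have hlα0 : 0 ≤ ℓ * α := by positivity
  set c₀ := 1 + ℓ * α ^ 2 * (5 * m) * D
  set c₁ := ℓ * α * (f lam - f x)
  set c₂ := -(ℓ * α * (S * σ))
  set c₃ := (ℓ * α ^ 2 / m + 4 * ℓ ^ 2 * α ^ 2) * D with hc₃
  have hc₃0 : 0 ≤ c₃ := by positivity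
  have hae : ∀ᵐ z ∂(unifSphere (ℝ ∙ θ)ᗮ), |⟪θs, z⟫| ≤ 1 ∧ |x + σ * ⟪θs, z⟫| ≤ 1 := by
    filter_upwards [ae_unifSphere (ℝ ∙ θ)ᗮ] with z hz
    refine ⟨(abs_real_inner_le_norm _ _).trans (by rw [hθs, hz.2, one_mul]), ?_⟩
    exact norm_le_one_combination hθs hθ hz.2
      ((Submodule.mem_orthogonal_singleton_iff_inner_right (𝕜 := ℝ)).1 hz.1) (by nlinarith)
  obtain ⟨hint, hval⟩ := integral_unifSphere_orthogonal hd hθ hθs c₀ c₁ c₂ c₃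
  -- Nonnegativity is needed to exchange `ENNReal.ofReal` with the integral; since ℓ α ≤ 1/16, the
  -- constant term c₀ ≥ 1 dominates.
  have hnn : ∀ᵐ z ∂(unifSphere (ℝ ∙ θ)ᗮ),
      0 ≤ c₀ + c₁ * ⟪θs, z⟫ + c₂ * (max ⟪θs, z⟫ 0) ^ 2 + c₃ * ⟪θs, z⟫ ^ 2 := by
    filter_upwards [hae] with z hz
    set w := ⟪θs, z⟫
    have h1 : 1 ≤ c₀ := by simp only [c₀]; have : 0 ≤ ℓ * α ^ 2 * (5 * m) * D := by positivity
                           linarith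
    have hfl := abs_le.1 (hfb lam ⟨by linarith, hlam1⟩)
    have hfx := abs_le.1 (hfb x ⟨by linarith, hx1⟩)
    have h2 : |c₁ * w| ≤ 1 / 8 := by
      rw [abs_mul, abs_mul, abs_of_nonneg hlα0]
      have : |f lam - f x| ≤ 2 := abs_le.2 ⟨by linarith, by linarith⟩
      calc ℓ * α * |f lam - f x| * |w| ≤ 1 / 16 * 2 * 1 := by gcongr; exact hz.1
        _ = 1 / 8 := by norm_num
    have h3 : (max w 0) ^ 2 ≤ 1 := by
      refine pow_le_one₀ (le_max_right _ _) (max_le ((le_abs_self _).trans hz.1) zero_le_one)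
    have h4 : ℓ * α * (S * σ) * (max w 0) ^ 2 ≤ 1 / 16 * (1 * 1) * 1 := by gcongr
    have h5 : 0 ≤ c₃ * w ^ 2 := by positivity
    have h6 := (abs_le.1 h2).1
    simp only [c₂]
    linarith
  calc _ ≤ ∫⁻ z, ENNReal.ofReal (c₀ + c₁ * ⟪θs, z⟫ + c₂ * (max ⟪θs, z⟫ 0) ^ 2 + c₃ * ⟪θs, z⟫ ^ 2)
        ∂(unifSphere (ℝ ∙ θ)ᗮ) := by
        refine lintegral_mono_ae ?_
        filter_upwards [hae] with z hz
        apply ENNReal.ofReal_le_ofReal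
        set w := ⟪θs, z⟫
        have hb := abs_le.1 hz.2
        -- For w < 0 the point x + σ w may leave the range [p, 1] on which the slope is known, so
        -- only monotonicity is used there.
        have key : S * σ * (max w 0) ^ 2 ≤ w * (f (x + σ * w) - f x) := by
          rcases le_total 0 w with hw | hw
          · rw [max_eq_left hw]
            have := hslope x (x + σ * w) hp (by linarith [mul_nonneg hσ.le hw]) hb.2
            have h2 := mul_le_mul_of_nonneg_left this hw
            linarith
          · rw [max_eq_right hw]
            have h1 : f (x + σ * w) ≤ f x := hf ⟨hb.1, hb.2⟩ ⟨by linarith, hx1⟩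
              (by linarith [mul_nonpos_of_nonneg_of_nonpos hσ.le hw])
            have h2 := mul_nonneg_of_nonpos_of_nonpos hw (sub_nonpos.2 h1)
            linarith
        have := mul_le_mul_of_nonneg_left key hlα0
        have e : ℓ * α ^ 2 * (5 * m + w ^ 2 / m) = ℓ * α ^ 2 * (5 * m) + ℓ * α ^ 2 / m * w ^ 2 := by
          ring
        rw [e]
        simp only [c₀, c₁, c₂, c₃]
        linarith
    _ = ENNReal.ofReal (∫ z, (c₀ + c₁ * ⟪θs, z⟫ + c₂ * (max ⟪θs, z⟫ 0) ^ 2 + c₃ * ⟪θs, z⟫ ^ 2)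
        ∂(unifSphere (ℝ ∙ θ)ᗮ)) := (ofReal_integral_eq_lintegral_ofReal hint hnn).symm
    _ ≤ _ := by
        apply ENNReal.ofReal_le_ofReal
        rw [hval, ← hm_def]
        set v := (1 - m ^ 2) / ((d : ℝ) - 1) with hv
        have hd1 : (0 : ℝ) < d - 1 := by linarith
        have hv0 : 0 ≤ v := div_nonneg (by nlinarith) hd1.le
        have hv1 : (1 - m) / d ≤ v := by
          rw [hv, div_le_div_iff₀ hd0 hd1]
          have : 0 ≤ m * (1 - m) := mul_nonneg hm0.le (by linarith)
          nlinarith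
        have hmsq : 1 / (4 * d) ≤ m ^ 2 := by
          have h1 : (1 / (2 * √(d : ℝ))) ^ 2 ≤ m ^ 2 := pow_le_pow_left₀ (by positivity) hm 2
          rwa [div_pow, mul_pow, Real.sq_sqrt hd0.le, one_pow, show (2 : ℝ) ^ 2 = 4 by norm_num] at h1
        -- The lower bound on m enters here: 1/(d - 1) ≤ 2/d ≤ 8 m². Together with the term 5 m this
        -- gives the 13 in `shrinkRate`.
        have hv2 : v ≤ 8 * m ^ 2 := by
          have h1 : v ≤ 1 / (d - 1) := by
            rw [hv]; exact div_le_div_of_nonneg_right (by nlinarith) hd1.le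
          have h2 : 1 / ((d : ℝ) - 1) ≤ 8 * (1 / (4 * d)) := by
            rw [mul_one_div, div_le_div_iff₀ hd1 (by positivity)]; linarith
          linarith
        have hv3 : ℓ * α ^ 2 / m * D * v ≤ ℓ * α ^ 2 * (8 * m) * D := by
          calc ℓ * α ^ 2 / m * D * v ≤ ℓ * α ^ 2 / m * D * (8 * m ^ 2) := by gcongr
            _ = _ := by field_simp
        have hv4 : 4 * ℓ ^ 2 * α ^ 2 * D * v ≤ ℓ * α * (σ * S) / 4 * v := by
          have : 4 * ℓ ^ 2 * α ^ 2 * D ≤ ℓ * α * (σ * S) / 4 := by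
            have := mul_le_mul_of_nonneg_left hℓα hlα0
            nlinarith
          gcongr
        have hv5 : ℓ * α * (σ * S) / 4 * ((1 - m) / d) ≤ ℓ * α * (σ * S) / 4 * v := by gcongr
        have hexp := Real.add_one_le_exp (-ℓ * (driftRate d σ S α * (1 - m) - shrinkRate α * m))
        refine le_trans ?_ hexp
        have e1 : ℓ * (driftRate d σ S α * (1 - m)) = ℓ * α * (σ * S) / 4 * ((1 - m) / d) := by
          unfold driftRate; field_simp
        have e2 : ℓ * (shrinkRate α * m) = ℓ * α ^ 2 * (13 * m) * D := by
          unfold shrinkRate; ring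
        have e3 : -ℓ * (driftRate d σ S α * (1 - m) - shrinkRate α * m)
          = -(ℓ * (driftRate d σ S α * (1 - m))) + ℓ * (shrinkRate α * m) := by ring
        rw [e3, e1, e2]
        simp only [c₀, c₂, hc₃]
        linarith

/-! ### One step of the procedure -/

section Disintegration

variable {Ω : Type*} {m mΩ : MeasurableSpace Ω} [StandardBorelSpace Ω] {μ : Measure Ω}
  [IsFiniteMeasure μ]

/-- The law of (ω, ω), with the first component observed only through `m`, is the composition of the
trimmed measure with the conditional kernel. -/
theorem lintegral_diag_eq_lintegral_condExpKernel (hm : m ≤ mΩ) {G : Ω × Ω → ℝ≥0∞}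
    (hG : Measurable[m.prod mΩ] G) :
    ∫⁻ ω, G (ω, ω) ∂μ = ∫⁻ ω, ∫⁻ y, G (ω, y) ∂(condExpKernel μ m ω) ∂μ := by
  have h1 := @Measure.lintegral_compProd Ω Ω m mΩ (μ.trim hm) (condExpKernel μ m) _ _ G hG
  rw [compProd_trim_condExpKernel hm] at h1
  have hdiag : @Measurable Ω (Ω × Ω) mΩ (m.prod mΩ) Function.diag :=
    @Measurable.prodMk Ω mΩ Ω Ω m mΩ _ _ (measurable_id'' hm) measurable_id
  have h2 : ∫⁻ x, G x ∂(@Measure.map Ω (Ω × Ω) mΩ (m.prod mΩ) Function.diag μ)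
      = ∫⁻ ω, G (ω, ω) ∂μ := @lintegral_map Ω (Ω × Ω) mΩ (m.prod mΩ) μ G _ hG hdiag
  rw [← h2, h1, lintegral_trim hm]
  exact @Measurable.lintegral_kernel_prod_right' Ω Ω m mΩ (condExpKernel μ m) _ G hG

/-- The freezing principle: quantities known at `m` stay fixed while `X` is drawn from its
conditional law. -/
theorem setLIntegral_eq_setLIntegral_condExpKernel {α β : Type*} [MeasurableSpace α]
    [MeasurableSpace β] (hm : m ≤ mΩ) {A : Set Ω} (hA : MeasurableSet[m] A) {U : Ω → α}
    (hU : Measurable[m] U) {X : Ω → β} (hX : Measurable X) {K : α × β → ℝ≥0∞}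
    (hK : Measurable K) :
    ∫⁻ ω in A, K (U ω, X ω) ∂μ = ∫⁻ ω in A, ∫⁻ y, K (U ω, X y) ∂(condExpKernel μ m ω) ∂μ := by
  have hA2 : MeasurableSet[m.prod mΩ] (Prod.fst ⁻¹' A : Set (Ω × Ω)) :=
    @measurable_fst _ _ m mΩ _ hA
  have hc : Measurable[m.prod mΩ] (fun q : Ω × Ω => K (U q.1, X q.2)) :=
    hK.comp (@Measurable.prodMk _ (m.prod mΩ) _ _ _ _ _ _
        (hU.comp (@measurable_fst _ _ m mΩ)) (hX.comp (@measurable_snd _ _ m mΩ)))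
  have hG : Measurable[m.prod mΩ]
      ((Prod.fst ⁻¹' A).indicator fun q : Ω × Ω => K (U q.1, X q.2)) := hc.indicator hA2
  have h := lintegral_diag_eq_lintegral_condExpKernel (μ := μ) hm hG
  rw [← lintegral_indicator (hm _ hA), ← lintegral_indicator (hm _ hA)]
  refine Eq.trans (lintegral_congr fun ω => ?_) (h.trans (lintegral_congr fun ω => ?_))
  · by_cases hω : ω ∈ A <;> simp [hω]
  · by_cases hω : ω ∈ A <;> simp [hω]

theorem ae_hasSubgaussianMGF_condExpKernel {hm : m ≤ mΩ} {X : Ω → ℝ}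
    (h : HasCondSubgaussianMGF m hm X 1 μ) :
    ∀ᵐ ω ∂μ, HasSubgaussianMGF X 1 (condExpKernel μ m ω) := by
  have h1 := ae_of_ae_trim hm (Kernel.HasSubgaussianMGF.ae_forall_integrable_exp_mul h)
  have h2 := ae_of_ae_trim hm h.mgf_le
  filter_upwards [h1, h2] with ω h1 h2
  exact ⟨h1, h2⟩

theorem HasCondSubgaussianMGF_congr {hm : m ≤ mΩ} {X Y : Ω → ℝ}
    (h : HasCondSubgaussianMGF m hm X 1 μ) (hXY : X =ᵐ[μ] Y) :
    HasCondSubgaussianMGF m hm Y 1 μ :=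
  Kernel.HasSubgaussianMGF.congr h (by rwa [condExpKernel_comp_trim])

end Disintegration

/-! ### The link extended to ℝ, and almost sure properties of a run -/

/-- The extension of a link function from `[-1,1]` to `ℝ` that is constant on both sides. -/
def clampLink (f : ℝ → ℝ) (x : ℝ) : ℝ := f (max (-1) (min 1 x))

theorem clamp_mem (x : ℝ) : max (-1) (min 1 x) ∈ Set.Icc (-1 : ℝ) 1 :=
  ⟨le_max_left _ _, max_le (by norm_num) (min_le_left _ _)⟩

theorem clampLink_eq (f : ℝ → ℝ) {x : ℝ} (hx : |x| ≤ 1) : clampLink f x = f x := by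
  have := abs_le.1 hx
  rw [clampLink, min_eq_right this.2, max_eq_right this.1]

/-- A link is monotone only on [-1, 1] and need not be measurable outside; the clamped link is
monotone on ℝ and hence measurable. -/
theorem monotone_clampLink {f : ℝ → ℝ} (hf : MonotoneOn f (Set.Icc (-1) 1)) :
    Monotone (clampLink f) := fun x y hxy =>
  hf (clamp_mem x) (clamp_mem y) (max_le_max le_rfl (min_le_min le_rfl hxy))

theorem SlopeFrom.clampLink {f : ℝ → ℝ} {p S : ℝ} (h : SlopeFrom f p S) (hp : 0 ≤ p) :
    SlopeFrom (clampLink f) p S := by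
  intro x y hx hxy hy
  rw [clampLink_eq f (abs_le.2 ⟨by linarith, hy⟩),
    clampLink_eq f (abs_le.2 ⟨by linarith, hxy.trans hy⟩)]
  exact h x y hx hxy hy

theorem sgdStep_action {d : ℕ} (f : ℝ → ℝ) (η r : ℝ) {σ : ℝ} {θ z : Vec d} (hθ : ‖θ‖ = 1)
    (hz : ‖z‖ = 1) (hθz : ⟪θ, z⟫ = 0) :
    sgdStep f η θ (action σ θ z) r =
      (√(1 + (η * (f √(1 - σ ^ 2) - r) * linkDeriv f √(1 - σ ^ 2) * σ) ^ 2))⁻¹ •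
        (θ - (η * (f √(1 - σ ^ 2) - r) * linkDeriv f √(1 - σ ^ 2) * σ) • z) := by
  have hin : ⟪θ, action σ θ z⟫ = √(1 - σ ^ 2) := by
    rw [action, inner_add_right, inner_smul_right, inner_smul_right, hθz,
      real_inner_self_eq_norm_sq, hθ]
    ring
  have hhalf : sgdHalfStep f η θ (action σ θ z) r
      = θ - (η * (f √(1 - σ ^ 2) - r) * linkDeriv f √(1 - σ ^ 2) * σ) • z := by
    rw [sgdHalfStep, hin, action, add_sub_cancel_left, smul_smul]
  have hnorm : ∀ y : ℝ, ‖θ - y • z‖ = √(1 + y ^ 2) := by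
    intro y
    rw [← Real.sqrt_sq (norm_nonneg _), norm_sub_sq_real, hθ, norm_smul, hz, inner_smul_right, hθz,
      Real.norm_eq_abs, mul_one, sq_abs]
    congr 1; ring
  rw [sgdStep, hhalf, hnorm]

section Run

variable {d : ℕ} {Ω : Type*} [mΩ : MeasurableSpace Ω] [StandardBorelSpace Ω]
  {P : Procedure} {f : ℝ → ℝ} {θs : Vec d} {μ : Measure Ω} [IsProbabilityMeasure μ]
  {ℱ : Filtration ℕ mΩ} {cand z θ a : ℕ → Ω → Vec d} {r : ℕ → Ω → ℝ}

theorem IsRun.ae_norm_cand (h : IsRun P f θs μ ℱ cand z θ a r) :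
    ∀ᵐ ω ∂μ, ∀ j, ‖cand j ω‖ = 1 := by
  rw [ae_all_iff]
  intro j
  have h1 := ae_unifSphere (⊤ : Submodule ℝ (Vec d))
  rw [← h.cand_law j] at h1
  have h2 := ae_of_ae_map (((h.cand_meas j).mono (ℱ.le 0) le_rfl).aemeasurable) h1
  filter_upwards [h2] with ω hω
  exact hω.2

/-- The sphere carrying z depends on ω through θ, so the conditional law is applied to the indicator
of a set of pairs (θ, z). -/
theorem IsRun.ae_z (h : IsRun P f θs μ ℱ cand z θ a r) {t : ℕ} (ht : P.initLength ≤ t) :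
    ∀ᵐ ω ∂μ, ‖z t ω‖ = 1 ∧ ⟪θ t ω, z t ω⟫ = 0 := by
  set B : Set (Vec d × Vec d) := {q | ‖q.2‖ = 1 ∧ ⟪q.1, q.2⟫ = 0}ᶜ with hB
  have hBm : MeasurableSet B := by
    refine MeasurableSet.compl (MeasurableSet.inter ?_ ?_)
    · exact measurableSet_eq_fun (by fun_prop) (by fun_prop)
    · exact measurableSet_eq_fun (by fun_prop) (by fun_prop)
  have hzm : Measurable (z t) := (h.z_meas t).mono (ℱ.le _) le_rfl
  have hpair : @Measurable _ _ (@Prod.instMeasurableSpace _ _ (ℱ t) mΩ) _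
      (fun q : Ω × Ω => (θ t q.1, z t q.2)) :=
    @Measurable.prodMk _ (@Prod.instMeasurableSpace _ _ (ℱ t) mΩ) _ _ _ _ _ _
      ((h.θ_meas t).comp (@measurable_fst _ _ (ℱ t) mΩ))
      (hzm.comp (@measurable_snd _ _ (ℱ t) mΩ))
  have hG : @Measurable _ _ (@Prod.instMeasurableSpace _ _ (ℱ t) mΩ) _
      (fun q : Ω × Ω => B.indicator (1 : Vec d × Vec d → ℝ≥0∞) (θ t q.1, z t q.2)) :=
    (measurable_one.indicator hBm).comp hpair
  have h1 := lintegral_diag_eq_lintegral_condExpKernel (μ := μ) (ℱ.le t) hG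
  have h2 : ∫⁻ ω, ∫⁻ y, B.indicator (1 : Vec d × Vec d → ℝ≥0∞) (θ t ω, z t y) ∂(condExpKernel μ (ℱ t) ω) ∂μ
      = 0 := by
    rw [← lintegral_zero (μ := μ)]
    refine lintegral_congr_ae ?_
    filter_upwards [h.z_law t ht] with ω hω
    have h3 : ∫⁻ y, B.indicator (1 : Vec d × Vec d → ℝ≥0∞) (θ t ω, z t y) ∂(condExpKernel μ (ℱ t) ω)
        = ∫⁻ y, B.indicator (1 : Vec d × Vec d → ℝ≥0∞) (θ t ω, y) ∂(unifSphere (ℝ ∙ θ t ω)ᗮ) := by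
      rw [← hω, lintegral_map ?_ hzm]
      exact (measurable_one.indicator hBm).comp (by fun_prop)
    rw [h3, ← lintegral_zero (μ := unifSphere (ℝ ∙ θ t ω)ᗮ)]
    refine lintegral_congr_ae ?_
    filter_upwards [ae_unifSphere (ℝ ∙ θ t ω)ᗮ] with y hy
    rw [Set.indicator_of_notMem]
    rw [hB, Set.notMem_compl_iff]
    exact ⟨hy.2, (Submodule.mem_orthogonal_singleton_iff_inner_right (𝕜 := ℝ)).1 hy.1⟩
  rw [h2, lintegral_eq_zero_iff] at h1
  · filter_upwards [h1] with ω hω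
    by_contra hcon
    have : (θ t ω, z t ω) ∈ B := by rw [hB]; exact hcon
    simp [Set.indicator_of_mem this] at hω
  · exact hG.comp (@Measurable.prodMk _ mΩ _ _ (ℱ t) mΩ _ _ (measurable_id'' (ℱ.le t)) measurable_id)

theorem IsRun.ae_norm_θ (h : IsRun P f θs μ ℱ cand z θ a r) :
    ∀ᵐ ω ∂μ, ∀ t, ‖θ t ω‖ = 1 := by
  have hz : ∀ᵐ ω ∂μ, ∀ t, P.initLength ≤ t → ‖z t ω‖ = 1 ∧ ⟪θ t ω, z t ω⟫ = 0 := by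
    rw [ae_all_iff]
    intro t
    by_cases ht : P.initLength ≤ t
    · filter_upwards [h.ae_z ht] with ω hω _ using hω
    · exact Filter.Eventually.of_forall fun ω hcon => absurd hcon ht
  filter_upwards [h.ae_norm_cand, hz] with ω hc hz t
  rcases lt_or_ge t P.initLength with ht | ht
  · rw [h.init_θ t ht]; exact hc _
  · induction t, ht using Nat.le_induction with
    | base => rw [h.start]; exact hc _
    | succ t ht ih =>
      obtain ⟨hz1, hz2⟩ := hz t ht
      rw [h.sgd_θ t ht, h.sgd_a t ht, sgdStep_action f _ _ ih hz1 hz2]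
      set y := _ * P.σ (t - P.initLength)
      have hnorm : ‖θ t ω - y • z t ω‖ = √(1 + y ^ 2) := by
        rw [← Real.sqrt_sq (norm_nonneg _), norm_sub_sq_real, ih, norm_smul, hz1, inner_smul_right,
          hz2, Real.norm_eq_abs, mul_one, sq_abs]
        congr 1; ring
      rw [norm_smul, hnorm, norm_inv, Real.norm_of_nonneg (Real.sqrt_nonneg _)]
      exact inv_mul_cancel₀ (Real.sqrt_ne_zero'.2 (by positivity))

theorem IsRun.ae_norm_a_le (h : IsRun P f θs μ ℱ cand z θ a r) (t : ℕ) :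
    ∀ᵐ ω ∂μ, ‖a t ω‖ = 1 := by
  rcases lt_or_ge t P.initLength with ht | ht
  · filter_upwards [h.ae_norm_θ] with ω hω
    rw [h.init_a t ht]; exact hω t
  · filter_upwards [h.ae_norm_θ, h.ae_z ht] with ω hω hz
    rw [h.sgd_a t ht, action, ← sq_eq_sq₀ (norm_nonneg _) zero_le_one, norm_add_sq_real, norm_smul,
      norm_smul, hω t, hz.1, inner_smul_left, inner_smul_right, hz.2]
    have hσ := P.σ_mem (t - P.initLength)
    simp only [Real.norm_eq_abs, mul_one, sq_abs, mul_zero, add_zero]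
    rw [Real.sq_sqrt (by nlinarith [hσ.1, hσ.2])]; ring

/-- A measurable version of the noise. -/
def noiseOf (f : ℝ → ℝ) (θs : Vec d) (a : ℕ → Ω → Vec d) (r : ℕ → Ω → ℝ) (t : ℕ) (ω : Ω) : ℝ :=
  r t ω - clampLink f ⟪θs, a t ω⟫

theorem IsRun.measurable_noiseOf (h : IsRun P f θs μ ℱ cand z θ a r)
    (hf : MonotoneOn f (Set.Icc (-1) 1)) (t : ℕ) :
    Measurable[ℱ (t + 1)] (noiseOf f θs a r t) := by
  have h1 : Measurable (fun v : Vec d => clampLink f ⟪θs, v⟫) :=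
    (monotone_clampLink hf).measurable.comp (by fun_prop)
  exact @Measurable.sub _ _ _ _ (ℱ (t + 1)) _ _ _ (h.r_meas t) (h1.comp (h.a_meas t))

theorem IsRun.noiseOf_subgaussian (h : IsRun P f θs μ ℱ cand z θ a r) (hθs : ‖θs‖ = 1) (t : ℕ) :
    ∀ᵐ ω ∂μ, HasSubgaussianMGF (noiseOf f θs a r t) 1
      (condExpKernel μ (ℱ t ⊔ MeasurableSpace.comap (a t) inferInstance) ω) := by
  refine ae_hasSubgaussianMGF_condExpKernel (HasCondSubgaussianMGF_congr (h.noise t) ?_)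
  filter_upwards [h.ae_norm_a_le t] with ω hω
  rw [noiseOf, clampLink_eq]
  exact (abs_real_inner_le_norm _ _).trans (by rw [hθs, hω, one_mul])

end Run

/-! ### The drift inequality for a run -/

section OneStep

variable {d : ℕ} {Ω : Type*} [mΩ : MeasurableSpace Ω] [StandardBorelSpace Ω]
  {P : Procedure} {f : ℝ → ℝ} {θs : Vec d} {μ : Measure Ω} [IsProbabilityMeasure μ]
  {ℱ : Filtration ℕ mΩ} {cand z θ a : ℕ → Ω → Vec d} {r : ℕ → Ω → ℝ}

/-- The noise is controlled given the past and the action. Since σ > 0, these determine z, so z may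
be frozen while the noise is averaged. -/
theorem IsRun.measurable_z_sup (h : IsRun P f θs μ ℱ cand z θ a r) {t : ℕ}
    (ht : P.initLength ≤ t) (hσ : 0 < P.σ (t - P.initLength)) :
    Measurable[ℱ t ⊔ MeasurableSpace.comap (a t) inferInstance] (z t) := by
  have e : z t = fun ω => (P.σ (t - P.initLength))⁻¹ •
      (a t ω - √(1 - P.σ (t - P.initLength) ^ 2) • θ t ω) := by
    funext ω
    rw [h.sgd_a t ht, action, add_sub_cancel_left, smul_smul, inv_mul_cancel₀ hσ.ne', one_smul]
  have h1 : Measurable[ℱ t ⊔ MeasurableSpace.comap (a t) inferInstance] (θ t) :=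
    (h.θ_meas t).mono le_sup_left le_rfl
  have h2 : Measurable[ℱ t ⊔ MeasurableSpace.comap (a t) inferInstance] (a t) :=
    (comap_measurable (a t)).mono le_sup_right le_rfl
  rw [e]
  exact (show Measurable fun q : Vec d × Vec d => (P.σ (t - P.initLength))⁻¹ •
    (q.1 - √(1 - P.σ (t - P.initLength) ^ 2) • q.2) by fun_prop).comp (Measurable.prodMk h2 h1)

theorem IsRun.sup_comap_le (h : IsRun P f θs μ ℱ cand z θ a r) (t : ℕ) :
    ℱ t ⊔ MeasurableSpace.comap (a t) inferInstance ≤ mΩ :=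
  sup_le (ℱ.le t) (((h.a_meas t).mono (ℱ.le (t + 1)) le_rfl).comap_le)

theorem IsRun.ae_abs_le_one (h : IsRun P f θs μ ℱ cand z θ a r) (hθs : ‖θs‖ = 1) :
    ∀ᵐ ω ∂μ, ∀ t, |⟪θs, θ t ω⟫| ≤ 1 := by
  filter_upwards [h.ae_norm_θ] with ω hω t
  exact (abs_real_inner_le_norm _ _).trans (by rw [hθs, hω, one_mul])

/-- The effective learning rate of step `s`. -/
def Procedure.rate (P : Procedure) (f : ℝ → ℝ) (s : ℕ) : ℝ :=
  P.η s * linkDeriv f √(1 - P.σ s ^ 2) * P.σ s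

theorem IsRun.ae_inner_succ (h : IsRun P f θs μ ℱ cand z θ a r) {t : ℕ}
    (ht : P.initLength ≤ t) :
    ∀ᵐ ω ∂μ, ⟪θs, θ (t + 1) ω⟫ =
      (⟪θs, θ t ω⟫ - P.rate f (t - P.initLength) * ((f √(1 - P.σ (t - P.initLength) ^ 2)
        - clampLink f (√(1 - P.σ (t - P.initLength) ^ 2) * ⟪θs, θ t ω⟫
          + P.σ (t - P.initLength) * ⟪θs, z t ω⟫)) - noiseOf f θs a r t ω) * ⟪θs, z t ω⟫) /
      √(1 + (P.rate f (t - P.initLength) * ((f √(1 - P.σ (t - P.initLength) ^ 2)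
        - clampLink f (√(1 - P.σ (t - P.initLength) ^ 2) * ⟪θs, θ t ω⟫
          + P.σ (t - P.initLength) * ⟪θs, z t ω⟫)) - noiseOf f θs a r t ω)) ^ 2) := by
  filter_upwards [h.ae_norm_θ, h.ae_z ht] with ω hθ hz
  rw [h.sgd_θ t ht, h.sgd_a t ht, sgdStep_action f _ _ (hθ t) hz.1 hz.2, noiseOf, h.sgd_a t ht]
  have e : ⟪θs, action (P.σ (t - P.initLength)) (θ t ω) (z t ω)⟫
      = √(1 - P.σ (t - P.initLength) ^ 2) * ⟪θs, θ t ω⟫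
          + P.σ (t - P.initLength) * ⟪θs, z t ω⟫ := by
    rw [action, inner_add_right, inner_smul_right, inner_smul_right]
  rw [e, inner_smul_right, inner_sub_right, inner_smul_right, Procedure.rate, inv_mul_eq_div]
  congr 1
  · ring
  · congr 1; ring

theorem IsRun.lintegral_noise_le (h : IsRun P f θs μ ℱ cand z θ a r)
    (hf : MonotoneOn f (Set.Icc (-1) 1)) (hfb : ∀ x ∈ Set.Icc (-1 : ℝ) 1, |f x| ≤ 1)
    (hθs : ‖θs‖ = 1) {t : ℕ} (ht : P.initLength ≤ t) {ℓ σ α lam : ℝ}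
    (hσ_def : P.σ (t - P.initLength) = σ) (hα_def : P.rate f (t - P.initLength) = α)
    (hlam_def : √(1 - σ ^ 2) = lam) (hσ : 0 < σ) (hσ1 : σ ≤ 1) (hℓ : 0 ≤ ℓ) (hα : 0 ≤ α)
    (hℓα : ℓ * α ≤ 1 / 2) {A : Set Ω} (hA : MeasurableSet[ℱ t] A)
    (hm : ∀ ω ∈ A, 0 < ⟪θs, θ t ω⟫) :
    ∫⁻ ω in A, ENNReal.ofReal (Real.exp (-ℓ * ⟪θs, θ (t + 1) ω⟫)) ∂μ ≤
      ∫⁻ ω in A, ENNReal.ofReal (Real.exp (-ℓ * ⟪θs, θ t ω⟫)) *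
        ENNReal.ofReal (1 + ℓ * α * (f lam - clampLink f (lam * ⟪θs, θ t ω⟫ + σ * ⟪θs, z t ω⟫))
          * ⟪θs, z t ω⟫ + (ℓ * α ^ 2 * (5 * ⟪θs, θ t ω⟫ + ⟪θs, z t ω⟫ ^ 2 / ⟪θs, θ t ω⟫)
          + 4 * ℓ ^ 2 * α ^ 2 * ⟪θs, z t ω⟫ ^ 2) * noiseConst) ∂μ := by
  have hmeas := monotone_clampLink hf |>.measurable
  have hz := h.measurable_z_sup ht (by rw [hσ_def]; exact hσ)
  have hle := h.sup_comap_le t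
  have hsub := h.noiseOf_subgaussian hθs t
  have hXm : Measurable (noiseOf f θs a r t) :=
    (h.measurable_noiseOf hf t).mono (ℱ.le _) le_rfl
  have hsucc := h.ae_inner_succ ht
  rw [hσ_def, hα_def, hlam_def] at hsucc
  have hA' : MeasurableSet[ℱ t ⊔ MeasurableSpace.comap (a t) inferInstance] A :=
    (le_sup_left : ℱ t ≤ ℱ t ⊔ MeasurableSpace.comap (a t) inferInstance) _ hA
  have hθm : Measurable[ℱ t ⊔ MeasurableSpace.comap (a t) inferInstance] (θ t) :=
    (h.θ_meas t).mono le_sup_left le_rfl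
  set X := noiseOf f θs a r t
  set K : (ℝ × ℝ) × ℝ → ℝ≥0∞ := fun q =>
    ENNReal.ofReal (Real.exp (-ℓ * q.1.1)) * ENNReal.ofReal (Real.exp (ℓ * (q.1.1 -
      (q.1.1 - α * ((f lam - clampLink f (lam * q.1.1 + σ * q.1.2)) - q.2) * q.1.2)
      / √(1 + (α * ((f lam - clampLink f (lam * q.1.1 + σ * q.1.2)) - q.2)) ^ 2)))) with hK
  have hKm : Measurable K := by
    have h1 : Measurable fun q : (ℝ × ℝ) × ℝ => clampLink f (lam * q.1.1 + σ * q.1.2) :=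
      hmeas.comp (by fun_prop)
    rw [hK]
    fun_prop
  have hpair : Measurable[ℱ t ⊔ MeasurableSpace.comap (a t) inferInstance]
      (fun ω => (⟪θs, θ t ω⟫, ⟪θs, z t ω⟫)) :=
    (show Measurable fun q : Vec d × Vec d => (⟪θs, q.1⟫, ⟪θs, q.2⟫) by fun_prop).comp
      (Measurable.prodMk hθm hz)
  have hAm : MeasurableSet A := ℱ.le t _ hA
  have e1 : ∫⁻ ω in A, ENNReal.ofReal (Real.exp (-ℓ * ⟪θs, θ (t + 1) ω⟫)) ∂μ
      = ∫⁻ ω in A, K ((⟪θs, θ t ω⟫, ⟪θs, z t ω⟫), X ω) ∂μ := by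
    refine setLIntegral_congr_fun_ae hAm ?_
    filter_upwards [hsucc] with ω hω _
    simp only [hK]
    rw [hω, ← ENNReal.ofReal_mul (Real.exp_pos _).le, ← Real.exp_add]
    congr 2
    ring
  rw [e1, setLIntegral_eq_setLIntegral_condExpKernel hle hA' hpair hXm hKm]
  refine setLIntegral_mono_ae' hAm ?_
  filter_upwards [hsub, h.ae_norm_θ, h.ae_z ht] with ω hω hθ hz hωA
  simp only [hK]
  have hmem := hm ω hωA
  have hmle : |⟪θs, θ t ω⟫| ≤ 1 := (abs_real_inner_le_norm _ _).trans (by rw [hθs, hθ, one_mul])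
  have hwle : |⟪θs, z t ω⟫| ≤ 1 := (abs_real_inner_le_norm _ _).trans (by rw [hθs, hz.1, one_mul])
  rw [lintegral_const_mul' _ _ ENNReal.ofReal_ne_top]
  gcongr
  refine lintegral_exp_step_le hω hℓ hα hmem ((le_abs_self _).trans hmle) hwle hℓα ?_
  have b1 := abs_le.1 (hfb lam ⟨by rw [← hlam_def]; linarith [Real.sqrt_nonneg (1 - σ ^ 2)], by
    rw [← hlam_def]; exact Real.sqrt_le_one.2 (by nlinarith)⟩)
  have b2 := abs_le.1 (hfb _ (clamp_mem (lam * ⟪θs, θ t ω⟫ + σ * ⟪θs, z t ω⟫)))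
  rw [clampLink]
  exact abs_le.2 ⟨by linarith, by linarith⟩

/-- One step of SGD: exponential moments of the correlation, on an event known beforehand. -/
theorem IsRun.lintegral_step_le (h : IsRun P f θs μ ℱ cand z θ a r) (hd : 2 ≤ d)
    (hf : MonotoneOn f (Set.Icc (-1) 1)) (hfb : ∀ x ∈ Set.Icc (-1 : ℝ) 1, |f x| ≤ 1)
    (hθs : ‖θs‖ = 1) {t : ℕ} (ht : P.initLength ≤ t) {ℓ σ α lam p S : ℝ}
    (hσ_def : P.σ (t - P.initLength) = σ) (hα_def : P.rate f (t - P.initLength) = α)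
    (hlam_def : √(1 - σ ^ 2) = lam) (hσ : 0 < σ) (hσ1 : σ ≤ 1) (hℓ : 0 ≤ ℓ) (hα : 0 ≤ α)
    (hslope : SlopeFrom f p S) (hp0 : 0 ≤ p) (hS : 0 < S) (hS1 : S ≤ 1)
    (hℓα : 16 * noiseConst * (ℓ * α) ≤ σ * S) {A : Set Ω} (hA : MeasurableSet[ℱ t] A)
    (hm : ∀ ω ∈ A, 1 / (2 * √(d : ℝ)) ≤ ⟪θs, θ t ω⟫) (hp : ∀ ω ∈ A, p ≤ lam * ⟪θs, θ t ω⟫) :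
    ∫⁻ ω in A, ENNReal.ofReal (Real.exp (-ℓ * ⟪θs, θ (t + 1) ω⟫)) ∂μ ≤
      ∫⁻ ω in A, ENNReal.ofReal (Real.exp (-ℓ * ((1 - driftRate d σ S α - shrinkRate α)
        * ⟪θs, θ t ω⟫ + driftRate d σ S α))) ∂μ := by
  have hd0 : (0 : ℝ) < d := by exact_mod_cast (by omega : 0 < d)
  have hD := one_le_noiseConst
  have hlα0 : 0 ≤ ℓ * α := by positivity
  have hlα : ℓ * α ≤ 1 / 2 := by
    have : σ * S ≤ 1 := by nlinarith
    nlinarith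
  have hm' : ∀ ω ∈ A, 0 < ⟪θs, θ t ω⟫ := fun ω hω => lt_of_lt_of_le (by positivity) (hm ω hω)
  refine (h.lintegral_noise_le hf hfb hθs ht hσ_def hα_def hlam_def hσ hσ1 hℓ hα hlα hA hm').trans ?_
  have hmeas := monotone_clampLink hf |>.measurable
  have hAm : MeasurableSet A := ℱ.le t _ hA
  have hzm : Measurable (z t) := (h.z_meas t).mono (ℱ.le _) le_rfl
  set K : ℝ × Vec d → ℝ≥0∞ := fun q =>
    ENNReal.ofReal (Real.exp (-ℓ * q.1)) *
    ENNReal.ofReal (1 + ℓ * α * (f lam - clampLink f (lam * q.1 + σ * ⟪θs, q.2⟫))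
          * ⟪θs, q.2⟫ + (ℓ * α ^ 2 * (5 * q.1 + ⟪θs, q.2⟫ ^ 2 / q.1)
          + 4 * ℓ ^ 2 * α ^ 2 * ⟪θs, q.2⟫ ^ 2) * noiseConst) with hK
  have hKm : Measurable K := by
    have h1 : Measurable fun q : ℝ × Vec d => clampLink f (lam * q.1 + σ * ⟪θs, q.2⟫) :=
      hmeas.comp (by fun_prop)
    rw [hK]
    fun_prop
  have hθm : Measurable[ℱ t] (fun ω => ⟪θs, θ t ω⟫) :=
    (show Measurable fun v : Vec d => ⟪θs, v⟫ by fun_prop).comp (h.θ_meas t)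
  refine (setLIntegral_eq_setLIntegral_condExpKernel (ℱ.le t) hA hθm hzm hKm).trans_le ?_
  refine setLIntegral_mono_ae' hAm ?_
  filter_upwards [h.z_law t ht, h.ae_norm_θ] with ω hω hθ hωA
  have e2 : ∫⁻ y, K (⟪θs, θ t ω⟫, z t y) ∂(condExpKernel μ (ℱ t) ω)
      = ∫⁻ v, K (⟪θs, θ t ω⟫, v) ∂(unifSphere (ℝ ∙ θ t ω)ᗮ) := by
    rw [← hω, lintegral_map (f := fun v => K (⟪θs, θ t ω⟫, v)) (hKm.comp (by fun_prop)) hzm]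
  have hfl : clampLink f lam = f lam := clampLink_eq f (by
    rw [← hlam_def, abs_of_nonneg (Real.sqrt_nonneg _)]; exact Real.sqrt_le_one.2 (by nlinarith))
  have e3 := lintegral_sphere_step_le (f := clampLink f) hd ((monotone_clampLink hf).monotoneOn _)
    (fun x _ => hfb _ (clamp_mem x)) (hslope.clampLink hp0) hS hS1 hσ hσ1 hℓ hα hℓα hθs (hθ t)
    (hm ω hωA) (by rw [hlam_def]; exact hp ω hωA)
  rw [hlam_def, hfl] at e3
  rw [e2]
  simp only [hK]
  rw [lintegral_const_mul' _ _ ENNReal.ofReal_ne_top]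
  refine (mul_le_mul_right e3 _).trans (le_of_eq ?_)
  rw [← ENNReal.ofReal_mul (Real.exp_pos _).le, ← Real.exp_add]
  congr 2
  ring

end OneStep

/-! ### Processes with a linear drift in exponential moments -/

section Phases

variable {Ω : Type*} [mΩ : MeasurableSpace Ω] {μ : Measure Ω} [IsProbabilityMeasure μ]
  {ℱ : Filtration ℕ mΩ} {Y : ℕ → Ω → ℝ}

/-- The part of `G` on which `Y` stays above `c` at the times `τ, …, τ + n - 1`. -/
def staysAbove (Y : ℕ → Ω → ℝ) (G : Set Ω) (c : ℝ) (τ n : ℕ) : Set Ω :=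
  {ω | ω ∈ G ∧ ∀ k < n, c ≤ Y (τ + k) ω}

/-- The mean recursion `u ↦ (1 - a - b) u + a`. -/
def driftIter (a b B : ℝ) : ℕ → ℝ
  | 0 => B
  | n + 1 => (1 - a - b) * driftIter a b B n + a

/-- The recursion is monotone, and `hB` places B below its fixed point a / (a + b). -/
theorem le_driftIter {a b B : ℝ} (hq : a + b ≤ 1) (hB : B * (a + b) ≤ a) (n : ℕ) :
    B ≤ driftIter a b B n := by
  induction n with
  | zero => exact le_rfl
  | succ n ih =>
    have := mul_le_mul_of_nonneg_left ih (by linarith : 0 ≤ 1 - a - b)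
    rw [driftIter]; linarith

theorem driftIter_sub {a b B : ℝ} (hab : 0 < a + b) (n : ℕ) :
    driftIter a b B n = a / (a + b) - (1 - a - b) ^ n * (a / (a + b) - B) := by
  induction n with
  | zero => simp [driftIter]
  | succ n ih => rw [driftIter, ih, pow_succ]; field_simp; ring

theorem measurableSet_staysAbove (hY : ∀ t, Measurable[ℱ t] (Y t)) {G : Set Ω} {τ : ℕ}
    (hG : MeasurableSet[ℱ τ] G) (c : ℝ) {n t : ℕ} (ht : τ ≤ t) (hn : τ + n ≤ t + 1) :
    MeasurableSet[ℱ t] (staysAbove Y G c τ n) := by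
  have e : staysAbove Y G c τ n = G ∩ ⋂ k ∈ Set.Iio n, {ω | c ≤ Y (τ + k) ω} := by
    ext ω; simp [staysAbove]
  rw [e]
  refine @MeasurableSet.inter _ (ℱ t) _ _ (ℱ.mono ht _ hG) ?_
  refine @MeasurableSet.biInter _ _ (ℱ t) _ _ (Set.to_countable _) fun k hk => ?_
  have hk' : k < n := hk
  exact ℱ.mono (show τ + k ≤ t by omega) _
    (@measurableSet_le _ _ _ _ _ (ℱ (τ + k)) _ _ _ _ _ (@measurable_const _ _ _ (ℱ (τ + k)) c) (hY _))

theorem staysAbove_succ_subset (G : Set Ω) (c : ℝ) (τ n : ℕ) :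
    staysAbove Y G c τ (n + 1) ⊆ staysAbove Y G c τ n :=
  fun _ hω => ⟨hω.1, fun k hk => hω.2 k (by omega)⟩

/-- The hypothesis on one step, and consequences for one phase with constant rates. -/
theorem lintegral_staysAbove_le (hY : ∀ t, Measurable[ℱ t] (Y t)) {τ N : ℕ} {B c a b ℓm : ℝ}
    (ha : 0 ≤ a) (hb : 0 ≤ b) (hq : a + b ≤ 1)
    (hstep : ∀ n < N, ∀ ℓ, 0 ≤ ℓ → ℓ ≤ ℓm → ∀ A, MeasurableSet[ℱ (τ + n)] A →
      (∀ ω ∈ A, c ≤ Y (τ + n) ω) →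
      ∫⁻ ω in A, ENNReal.ofReal (Real.exp (-ℓ * Y (τ + n + 1) ω)) ∂μ ≤
      ∫⁻ ω in A, ENNReal.ofReal (Real.exp (-ℓ * ((1 - a - b) * Y (τ + n) ω + a))) ∂μ)
    {G : Set Ω} (hG : MeasurableSet[ℱ τ] G) (hGB : ∀ ω ∈ G, B ≤ Y τ ω)
    {n : ℕ} (hn : n ≤ N) {ℓ : ℝ} (hℓ : 0 ≤ ℓ) (hℓm : ℓ ≤ ℓm) :
    ∫⁻ ω in staysAbove Y G c τ n, ENNReal.ofReal (Real.exp (-ℓ * Y (τ + n) ω)) ∂μ ≤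
      ENNReal.ofReal (Real.exp (-ℓ * driftIter a b B n)) := by
  -- The factor 1 - a - b in front of Y is moved into ℓ, so the induction hypothesis is needed at
  -- the smaller value ℓ (1 - a - b); the event for n + 1 is enlarged to the one for n.
  induction n generalizing ℓ with
  | zero =>
    have hm : MeasurableSet (staysAbove Y G c τ 0) :=
      ℱ.le τ _ (measurableSet_staysAbove hY hG c le_rfl (by omega))
    calc _ ≤ ∫⁻ ω in staysAbove Y G c τ 0, ENNReal.ofReal (Real.exp (-ℓ * B)) ∂μ := by
          refine setLIntegral_mono' hm fun ω hω => ?_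
          apply ENNReal.ofReal_le_ofReal
          apply Real.exp_le_exp.2
          have := mul_le_mul_of_nonneg_left (hGB ω hω.1) hℓ
          simp only [add_zero]
          linarith
      _ = ENNReal.ofReal (Real.exp (-ℓ * B)) * μ (staysAbove Y G c τ 0) := setLIntegral_const _ _
      _ ≤ ENNReal.ofReal (Real.exp (-ℓ * B)) * 1 := by gcongr; exact prob_le_one
      _ = _ := by rw [mul_one, driftIter]
  | succ n ih =>
    have hq0 : 0 ≤ 1 - a - b := by linarith
    have hm := measurableSet_staysAbove hY hG c (n := n + 1) (t := τ + n) (by omega) (by omega)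
    have h1 := hstep n (by omega) ℓ hℓ hℓm _ hm (fun ω hω => hω.2 n (by omega))
    have h2 := ih (by omega) (mul_nonneg hℓ hq0) (by nlinarith)
    calc _ ≤ ∫⁻ ω in staysAbove Y G c τ (n + 1),
          ENNReal.ofReal (Real.exp (-ℓ * ((1 - a - b) * Y (τ + n) ω + a))) ∂μ := h1
      _ = ∫⁻ ω in staysAbove Y G c τ (n + 1), ENNReal.ofReal (Real.exp (-ℓ * a)) *
          ENNReal.ofReal (Real.exp (-(ℓ * (1 - a - b)) * Y (τ + n) ω)) ∂μ := by
        refine lintegral_congr fun ω => ?_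
        rw [← ENNReal.ofReal_mul (Real.exp_pos _).le, ← Real.exp_add]
        congr 2; ring
      _ ≤ ∫⁻ ω in staysAbove Y G c τ n, ENNReal.ofReal (Real.exp (-ℓ * a)) *
          ENNReal.ofReal (Real.exp (-(ℓ * (1 - a - b)) * Y (τ + n) ω)) ∂μ :=
        lintegral_mono_set (staysAbove_succ_subset G c τ n)
      _ = ENNReal.ofReal (Real.exp (-ℓ * a)) * ∫⁻ ω in staysAbove Y G c τ n,
          ENNReal.ofReal (Real.exp (-(ℓ * (1 - a - b)) * Y (τ + n) ω)) ∂μ :=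
        lintegral_const_mul' _ _ ENNReal.ofReal_ne_top
      _ ≤ ENNReal.ofReal (Real.exp (-ℓ * a)) *
          ENNReal.ofReal (Real.exp (-(ℓ * (1 - a - b)) * driftIter a b B n)) := by gcongr
      _ = _ := by
        rw [← ENNReal.ofReal_mul (Real.exp_pos _).le, ← Real.exp_add, driftIter]
        congr 2; ring

/-- Markov's inequality for exp(-ℓ Y) with ℓ = Lp / dev: falling short of the mean curve by dev has
probability at most exp(-Lp). -/
theorem measure_staysAbove_lt_le (hY : ∀ t, Measurable[ℱ t] (Y t)) {τ N : ℕ} {B c a b dev Lp : ℝ}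
    (ha : 0 ≤ a) (hb : 0 ≤ b) (hq : a + b ≤ 1) (hdev : 0 < dev) (hLp : 0 ≤ Lp)
    (hstep : ∀ n < N, ∀ ℓ, 0 ≤ ℓ → ℓ ≤ Lp / dev → ∀ A, MeasurableSet[ℱ (τ + n)] A →
      (∀ ω ∈ A, c ≤ Y (τ + n) ω) →
      ∫⁻ ω in A, ENNReal.ofReal (Real.exp (-ℓ * Y (τ + n + 1) ω)) ∂μ ≤
      ∫⁻ ω in A, ENNReal.ofReal (Real.exp (-ℓ * ((1 - a - b) * Y (τ + n) ω + a))) ∂μ)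
    {G : Set Ω} (hG : MeasurableSet[ℱ τ] G) (hGB : ∀ ω ∈ G, B ≤ Y τ ω)
    {n : ℕ} (hn : n ≤ N) {v : ℝ} (hv : v + dev ≤ driftIter a b B n) :
    μ (staysAbove Y G c τ n ∩ {ω | Y (τ + n) ω < v}) ≤ ENNReal.ofReal (Real.exp (-Lp)) := by
  set ℓ := Lp / dev with hℓ_def
  have hℓ : 0 ≤ ℓ := by positivity
  have hint := lintegral_staysAbove_le hY ha hb hq hstep hG hGB hn hℓ le_rfl
  have hm : MeasurableSet (staysAbove Y G c τ n) :=
    ℱ.le _ _ (measurableSet_staysAbove hY hG c (t := τ + n) (by omega) (by omega))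
  have hYm : Measurable (Y (τ + n)) := (hY _).mono (ℱ.le _) le_rfl
  have hset : MeasurableSet {ω | Y (τ + n) ω < v} := measurableSet_lt hYm measurable_const
  have h1 : ENNReal.ofReal (Real.exp (-ℓ * v)) * μ (staysAbove Y G c τ n ∩ {ω | Y (τ + n) ω < v})
      ≤ ENNReal.ofReal (Real.exp (-ℓ * driftIter a b B n)) := by
    calc _ = ∫⁻ ω in staysAbove Y G c τ n ∩ {ω | Y (τ + n) ω < v},
          ENNReal.ofReal (Real.exp (-ℓ * v)) ∂μ := (setLIntegral_const _ _).symm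
      _ ≤ ∫⁻ ω in staysAbove Y G c τ n ∩ {ω | Y (τ + n) ω < v},
          ENNReal.ofReal (Real.exp (-ℓ * Y (τ + n) ω)) ∂μ := by
        refine setLIntegral_mono' (hm.inter hset) fun ω hω => ?_
        apply ENNReal.ofReal_le_ofReal
        apply Real.exp_le_exp.2
        have : Y (τ + n) ω < v := hω.2
        have := mul_le_mul_of_nonneg_left this.le hℓ
        linarith
      _ ≤ _ := (lintegral_mono_set Set.inter_subset_left).trans hint
  have h2 : ENNReal.ofReal (Real.exp (-ℓ * driftIter a b B n))
      ≤ ENNReal.ofReal (Real.exp (-ℓ * v)) * ENNReal.ofReal (Real.exp (-Lp)) := by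
    rw [← ENNReal.ofReal_mul (Real.exp_pos _).le, ← Real.exp_add]
    apply ENNReal.ofReal_le_ofReal
    apply Real.exp_le_exp.2
    have h3 : ℓ * dev = Lp := div_mul_cancel₀ _ hdev.ne'
    have := mul_le_mul_of_nonneg_left hv hℓ
    linarith
  exact (ENNReal.mul_le_mul_iff_right (by simpa using Real.exp_pos _) ENNReal.ofReal_ne_top).1
    (h1.trans h2)

/-- A process with the drift of `driftIter` in each of the phases `[τ i, τ i + N i)` stays above
the curve that is `B i - dev i` in phase `i`, if each phase lifts it from `B i` to `B (i + 1)`. -/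
theorem measure_not_above_le (hY : ∀ t, Measurable[ℱ t] (Y t)) {τ N : ℕ → ℕ}
    (hτ : ∀ i, τ (i + 1) = τ i + N i) (hN : ∀ i, 1 ≤ N i) {B a b dev : ℕ → ℝ} {Lp : ℝ}
    (ha : ∀ i, 0 ≤ a i) (hb : ∀ i, 0 ≤ b i) (hq : ∀ i, a i + b i ≤ 1) (hdev : ∀ i, 0 < dev i)
    (hLp : 0 ≤ Lp) (hB : ∀ i, B i * (a i + b i) ≤ a i)
    (hend : ∀ i, B (i + 1) + dev i ≤ driftIter (a i) (b i) (B i) (N i))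
    (hstep : ∀ i, ∀ n < N i, ∀ ℓ, 0 ≤ ℓ → ℓ ≤ Lp / dev i → ∀ A, MeasurableSet[ℱ (τ i + n)] A →
      (∀ ω ∈ A, B i - dev i ≤ Y (τ i + n) ω) →
      ∫⁻ ω in A, ENNReal.ofReal (Real.exp (-ℓ * Y (τ i + n + 1) ω)) ∂μ ≤
      ∫⁻ ω in A, ENNReal.ofReal (Real.exp (-ℓ * ((1 - a i - b i) * Y (τ i + n) ω + a i))) ∂μ)
    {G : Set Ω} (hG : MeasurableSet[ℱ (τ 0)] G) (hGB : ∀ ω ∈ G, B 0 ≤ Y (τ 0) ω)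
    {H : ℕ} (hH : τ 0 ≤ H) :
    μ (G \ {ω | ∀ i k, k < N i → τ i + k < H → B i - dev i ≤ Y (τ i + k) ω}) ≤
      ((2 * (H - τ 0) : ℕ) : ℝ≥0∞) * ENNReal.ofReal (Real.exp (-Lp)) := by
  set e := ENNReal.ofReal (Real.exp (-Lp))
  have hmono : Monotone τ := monotone_nat_of_le_succ fun i => by rw [hτ]; omega
  -- one phase, partially completed
  have hphase : ∀ i (G' : Set Ω), MeasurableSet[ℱ (τ i)] G' → (∀ ω ∈ G', B i ≤ Y (τ i) ω) →
      ∀ n ≤ N i, μ (G' \ staysAbove Y G' (B i - dev i) (τ i) n) ≤ (n : ℝ≥0∞) * e := by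
    intro i G' hG' hGB' n
    induction n with
    | zero =>
      intro _
      have : G' \ staysAbove Y G' (B i - dev i) (τ i) 0 = ∅ := by
        ext ω; simp [staysAbove]
      simp [this]
    | succ n ih =>
      intro hn
      have h1 := measure_staysAbove_lt_le hY (ha i) (hb i) (hq i) (hdev i) hLp (hstep i) hG' hGB'
        (n := n) (by omega) (v := B i - dev i)
        (by rw [sub_add_cancel]; exact le_driftIter (hq i) (hB i) n)
      have hsub : G' \ staysAbove Y G' (B i - dev i) (τ i) (n + 1) ⊆
          (G' \ staysAbove Y G' (B i - dev i) (τ i) n) ∪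
          (staysAbove Y G' (B i - dev i) (τ i) n ∩ {ω | Y (τ i + n) ω < B i - dev i}) := by
        intro ω hω
        by_cases hs : ω ∈ staysAbove Y G' (B i - dev i) (τ i) n
        · refine Or.inr ⟨hs, ?_⟩
          by_contra hcon
          refine hω.2 ⟨hω.1, fun k hk => ?_⟩
          rcases Nat.lt_succ_iff_lt_or_eq.1 hk with hk | rfl
          · exact hs.2 k hk
          · exact not_lt.1 hcon
        · exact Or.inl ⟨hω.1, hs⟩
      calc _ ≤ _ := measure_mono hsub
        _ ≤ _ := measure_union_le _ _
        _ ≤ (n : ℝ≥0∞) * e + e := add_le_add (ih (by omega)) h1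
        _ = _ := by push_cast; ring
  -- completed phases
  have hcomp : ∀ i, ∃ G' : Set Ω, MeasurableSet[ℱ (τ i)] G' ∧ G' ⊆ G ∧
      (∀ ω ∈ G', B i ≤ Y (τ i) ω) ∧
      (∀ ω ∈ G', ∀ j < i, ∀ k < N j, B j - dev j ≤ Y (τ j + k) ω) ∧
      μ (G \ G') ≤ ((2 * (τ i - τ 0) : ℕ) : ℝ≥0∞) * e := by
    intro i
    induction i with
    | zero => exact ⟨G, hG, subset_rfl, hGB, by simp, by simp⟩
    | succ i ih =>
      obtain ⟨G', hG', hsub', hGB', hprev, hμ⟩ := ih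
      have hend' := measure_staysAbove_lt_le hY (ha i) (hb i) (hq i) (hdev i) hLp (hstep i) hG' hGB'
        (n := N i) le_rfl (hend i)
      have hfull := hphase i G' hG' hGB' (N i) le_rfl
      refine ⟨staysAbove Y G' (B i - dev i) (τ i) (N i) ∩ {ω | B (i + 1) ≤ Y (τ (i + 1)) ω},
        ?_, fun ω hω => hsub' hω.1.1, fun ω hω => hω.2, ?_, ?_⟩
      · refine @MeasurableSet.inter _ (ℱ _) _ _
          (measurableSet_staysAbove hY hG' _ (by rw [hτ]; omega) (by rw [hτ]; omega)) ?_
        exact @measurableSet_le _ _ _ _ _ (ℱ _) _ _ _ _ _ (@measurable_const _ _ _ (ℱ _) _) (hY _)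
      · intro ω hω j hj k hk
        rcases Nat.lt_succ_iff_lt_or_eq.1 hj with hj | rfl
        · exact hprev ω hω.1.1 j hj k hk
        · exact hω.1.2 k hk
      · have hsub : G \ (staysAbove Y G' (B i - dev i) (τ i) (N i) ∩
            {ω | B (i + 1) ≤ Y (τ (i + 1)) ω}) ⊆
            ((G \ G') ∪ (G' \ staysAbove Y G' (B i - dev i) (τ i) (N i))) ∪
            (staysAbove Y G' (B i - dev i) (τ i) (N i) ∩ {ω | Y (τ i + N i) ω < B (i + 1)}) := by
          intro ω hω
          by_cases h1 : ω ∈ G'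
          · by_cases h2 : ω ∈ staysAbove Y G' (B i - dev i) (τ i) (N i)
            · refine Or.inr ⟨h2, ?_⟩
              by_contra hcon
              refine hω.2 ⟨h2, ?_⟩
              rw [Set.mem_ofPred_eq, hτ]
              exact not_lt.1 hcon
            · exact Or.inl (Or.inr ⟨h1, h2⟩)
          · exact Or.inl (Or.inl ⟨hω.1, h1⟩)
        calc _ ≤ _ := measure_mono hsub
          _ ≤ _ := measure_union_le _ _
          _ ≤ _ := add_le_add (measure_union_le _ _) le_rfl
          _ ≤ (((2 * (τ i - τ 0) : ℕ) : ℝ≥0∞) * e + (N i : ℝ≥0∞) * e) + e :=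
            add_le_add (add_le_add hμ hfull) hend'
          _ = ((2 * (τ i - τ 0) + N i + 1 : ℕ) : ℝ≥0∞) * e := by push_cast; ring
          _ ≤ _ := by
            gcongr
            -- A phase has N i events of leaving the band and one of missing the next level; N i + 1
            -- ≤ 2 N i explains the factor 2.
            have := hN i
            have := hmono (Nat.zero_le i)
            rw [hτ]; omega
  -- the phase that contains the horizon
  have hex : ∃ i, τ i ≤ H ∧ H < τ (i + 1) := by
    have hgrow : ∀ i, i ≤ τ i := by
      intro i
      induction i with
      | zero => omega
      | succ i ih => rw [hτ]; have := hN i; omega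
    have hP : ∃ i, H < τ (i + 1) := ⟨H, by have := hgrow (H + 1); omega⟩
    classical
    refine ⟨Nat.find hP, ?_, Nat.find_spec hP⟩
    rcases Nat.eq_zero_or_pos (Nat.find hP) with h0 | hpos
    · rw [h0]; exact hH
    · have := Nat.find_min hP (m := Nat.find hP - 1) (by omega)
      rw [Nat.sub_add_cancel hpos] at this
      omega
  obtain ⟨i, hi1, hi2⟩ := hex
  obtain ⟨G', hG', hsub', hGB', hprev, hμ⟩ := hcomp i
  have hpart := hphase i G' hG' hGB' (H - τ i) (by rw [hτ] at hi2; omega)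
  have hsub : G \ {ω | ∀ i k, k < N i → τ i + k < H → B i - dev i ≤ Y (τ i + k) ω} ⊆
      (G \ G') ∪ (G' \ staysAbove Y G' (B i - dev i) (τ i) (H - τ i)) := by
    intro ω hω
    by_cases h1 : ω ∈ G'
    · refine Or.inr ⟨h1, fun h2 => hω.2 fun j k hk hjk => ?_⟩
      rcases lt_trichotomy j i with hj | rfl | hj
      · exact hprev ω h1 j hj k hk
      · exact h2.2 k (by omega)
      · have := hmono (show i + 1 ≤ j by omega)
        omega
    · exact Or.inl ⟨hω.1, h1⟩
  calc _ ≤ _ := measure_mono hsub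
    _ ≤ _ := measure_union_le _ _
    _ ≤ ((2 * (τ i - τ 0) : ℕ) : ℝ≥0∞) * e + ((H - τ i : ℕ) : ℝ≥0∞) * e := add_le_add hμ hpart
    _ = ((2 * (τ i - τ 0) + (H - τ i) : ℕ) : ℝ≥0∞) * e := by push_cast; ring
    _ ≤ _ := by
      gcongr
      have := hmono (Nat.zero_le i)
      omega

end Phases

/-! ### The initialization -/

section Init

variable {d : ℕ} {Ω : Type*} [mΩ : MeasurableSpace Ω] [StandardBorelSpace Ω]
  {P : Procedure} {f : ℝ → ℝ} {θs : Vec d} {μ : Measure Ω} [IsProbabilityMeasure μ]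
  {ℱ : Filtration ℕ mΩ} {cand z θ a : ℕ → Ω → Vec d} {r : ℕ → Ω → ℝ}

/-- The last noise term is averaged given the past and its action, while the earlier sum is frozen.
-/
theorem IsRun.lintegral_exp_sum_noiseOf_le (h : IsRun P f θs μ ℱ cand z θ a r)
    (hf : MonotoneOn f (Set.Icc (-1) 1)) (hθs : ‖θs‖ = 1) (t₀ k : ℕ) (u : ℝ) :
    ∫⁻ ω, ENNReal.ofReal (Real.exp (u * ∑ i ∈ Finset.range k, noiseOf f θs a r (t₀ + i) ω)) ∂μ ≤
      ENNReal.ofReal (Real.exp (k * (u ^ 2 / 2))) := by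
  induction k with
  | zero => simp
  | succ k ih =>
    set K : ℝ × ℝ → ℝ≥0∞ := fun q => ENNReal.ofReal (Real.exp (u * q.1)) *
      ENNReal.ofReal (Real.exp (u * q.2)) with hK
    have hKm : Measurable K := by rw [hK]; fun_prop
    have hU : Measurable[ℱ (t₀ + k) ⊔ MeasurableSpace.comap (a (t₀ + k)) inferInstance]
        (fun ω => ∑ i ∈ Finset.range k, noiseOf f θs a r (t₀ + i) ω) := by
      refine Measurable.mono ?_ (le_sup_left : ℱ (t₀ + k) ≤ _) le_rfl
      refine Finset.measurable_fun_sum _ fun i hi => ?_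
      have := Finset.mem_range.1 hi
      exact (h.measurable_noiseOf hf (t₀ + i)).mono (ℱ.mono (by omega)) le_rfl
    have hX : Measurable (noiseOf f θs a r (t₀ + k)) :=
      (h.measurable_noiseOf hf _).mono (ℱ.le _) le_rfl
    have e1 : ∀ ω, ENNReal.ofReal (Real.exp (u * ∑ i ∈ Finset.range (k + 1),
        noiseOf f θs a r (t₀ + i) ω)) = K (∑ i ∈ Finset.range k, noiseOf f θs a r (t₀ + i) ω,
          noiseOf f θs a r (t₀ + k) ω) := by
      intro ω
      simp only [hK]
      rw [← ENNReal.ofReal_mul (Real.exp_pos _).le, ← Real.exp_add, Finset.sum_range_succ, mul_add]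
    have e2 := setLIntegral_eq_setLIntegral_condExpKernel (μ := μ) (h.sup_comap_le (t₀ + k))
      MeasurableSet.univ hU hX hKm
    simp only [Measure.restrict_univ] at e2
    calc _ = _ := lintegral_congr e1
      _ = _ := e2
      _ ≤ ∫⁻ ω, ENNReal.ofReal (Real.exp (u * ∑ i ∈ Finset.range k, noiseOf f θs a r (t₀ + i) ω)) *
          ENNReal.ofReal (Real.exp (u ^ 2 / 2)) ∂μ := by
        refine lintegral_mono_ae ?_
        filter_upwards [h.noiseOf_subgaussian hθs (t₀ + k)] with ω hω
        simp only [hK]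
        rw [lintegral_const_mul' _ _ ENNReal.ofReal_ne_top]
        gcongr
        rw [← ofReal_integral_eq_lintegral_ofReal (hω.integrable_exp_mul u)
          (Filter.Eventually.of_forall fun _ => (Real.exp_pos _).le)]
        apply ENNReal.ofReal_le_ofReal
        simpa [mgf] using hω.mgf_le u
      _ ≤ _ := by
        rw [lintegral_mul_const' _ _ ENNReal.ofReal_ne_top]
        refine (mul_le_mul_left ih _).trans (le_of_eq ?_)
        rw [← ENNReal.ofReal_mul (Real.exp_pos _).le, ← Real.exp_add]
        congr 2
        push_cast; ring

theorem IsRun.measure_sum_noiseOf_ge_le (h : IsRun P f θs μ ℱ cand z θ a r)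
    (hf : MonotoneOn f (Set.Icc (-1) 1)) (hθs : ‖θs‖ = 1) (t₀ n : ℕ) {c : ℝ} {s : ℝ}
    (hs : s = 1 ∨ s = -1) (hc : 0 ≤ c) :
    μ {ω | n * c ≤ s * ∑ i ∈ Finset.range n, noiseOf f θs a r (t₀ + i) ω} ≤
      ENNReal.ofReal (Real.exp (-(n * c ^ 2 / 2))) := by
  have hs2 : s ^ 2 = 1 := by rcases hs with rfl | rfl <;> norm_num
  have h1 := h.lintegral_exp_sum_noiseOf_le hf hθs t₀ n (s * c)
  set Z : Ω → ℝ := fun ω => ∑ i ∈ Finset.range n, noiseOf f θs a r (t₀ + i) ω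
  have hZ : Measurable Z := Finset.measurable_fun_sum _ fun i _ =>
    (h.measurable_noiseOf hf _).mono (ℱ.le _) le_rfl
  have h2 := meas_ge_le_lintegral_div (μ := μ)
    (f := fun ω => ENNReal.ofReal (Real.exp (s * c * Z ω))) (by fun_prop)
    (ε := ENNReal.ofReal (Real.exp (n * c ^ 2))) (by simpa using Real.exp_pos _)
    ENNReal.ofReal_ne_top
  have hsub : {ω | n * c ≤ s * Z ω} ⊆
      {ω | ENNReal.ofReal (Real.exp (n * c ^ 2)) ≤ ENNReal.ofReal (Real.exp (s * c * Z ω))} := by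
    intro ω hω
    apply ENNReal.ofReal_le_ofReal
    apply Real.exp_le_exp.2
    have : n * c ≤ s * Z ω := hω
    nlinarith [mul_le_mul_of_nonneg_left this hc]
  calc _ ≤ _ := measure_mono hsub
    _ ≤ _ := h2
    _ ≤ ENNReal.ofReal (Real.exp (n * ((s * c) ^ 2 / 2))) / ENNReal.ofReal (Real.exp (n * c ^ 2)) := by
      gcongr
    _ = _ := by
      rw [← ENNReal.ofReal_div_of_pos (Real.exp_pos _), ← Real.exp_sub, mul_pow, hs2]
      congr 2; ring

/-- Each candidate fails with probability at most 1 - 1/200 ≤ exp(-1/200), and the candidates are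
independent. -/
theorem IsRun.measure_all_cand_lt_le (h : IsRun P f θs μ ℱ cand z θ a r) (hd : 2 ≤ d)
    (hθs : ‖θs‖ = 1) (M : ℕ) :
    μ {ω | ∀ j < M, ⟪θs, cand j ω⟫ < 9 / 10 / √(d : ℝ)} ≤
      ENNReal.ofReal (Real.exp (-(M / 200))) := by
  set S : Set (Vec d) := {v | ⟪θs, v⟫ < 9 / 10 / √(d : ℝ)} with hS
  have hSm : MeasurableSet S := measurableSet_lt (by fun_prop) (by fun_prop)
  have e : {ω | ∀ j < M, ⟪θs, cand j ω⟫ < 9 / 10 / √(d : ℝ)} =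
      ⋂ j ∈ Finset.range M, cand j ⁻¹' S := by
    ext ω; simp [hS]
  rw [e, h.cand_indep.measure_inter_preimage_eq_mul (Finset.range M) (sets := fun _ => S)
    fun _ _ => hSm]
  have hone : ∀ j, μ (cand j ⁻¹' S) ≤ ENNReal.ofReal (Real.exp (-(1 / 200))) := by
    intro j
    rw [← Measure.map_apply ((h.cand_meas j).mono (ℱ.le 0) le_rfl) hSm, h.cand_law j]
    have hfr : Module.finrank ℝ (⊤ : Submodule ℝ (Vec d)) = d := by simp
    have : Nontrivial (⊤ : Submodule ℝ (Vec d)) :=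
      Module.nontrivial_of_finrank_pos (R := ℝ) (by omega)
    have := isProbabilityMeasure_unifSphere (⊤ : Submodule ℝ (Vec d))
    have h1 := unifSphere_top_real_ge hd θs hθs
    have h2 : Sᶜ = {z | 9 / 10 / √(d : ℝ) ≤ ⟪θs, z⟫} := by ext v; simp [hS]
    rw [← h2, probReal_compl_eq_one_sub hSm] at h1
    rw [← ofReal_measureReal (measure_ne_top _ _)]
    apply ENNReal.ofReal_le_ofReal
    have := Real.add_one_le_exp (-(1 / 200 : ℝ))
    linarith
  calc _ ≤ ∏ _j ∈ Finset.range M, ENNReal.ofReal (Real.exp (-(1 / 200))) :=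
        Finset.prod_le_prod' fun j _ => hone j
    _ = _ := by
      rw [Finset.prod_const, Finset.card_range, ← ENNReal.ofReal_pow (Real.exp_pos _).le,
        ← Real.exp_nat_mul]
      congr 2; ring

/-- With high probability, the hypothesis test selects a direction of correlation at least
`x` with the parameter, where `x = 7 / (10 √d)`. -/
theorem IsRun.measure_init_lt_le (h : IsRun P f θs μ ℱ cand z θ a r) (hd : 2 ≤ d)
    (hf : MonotoneOn f (Set.Icc (-1) 1)) (hθs : ‖θs‖ = 1) {Δ Lp : ℝ}
    (hΔ : f (9 / 10 / √(d : ℝ)) - f (7 / 10 / √(d : ℝ)) = Δ) (hΔ0 : 0 < Δ)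
    (hthr : P.threshold = (f (9 / 10 / √(d : ℝ)) + f (7 / 10 / √(d : ℝ))) / 2)
    (hn0 : 0 < P.numPlays) (hn : 8 * Lp ≤ P.numPlays * Δ ^ 2) (hM : 200 * Lp ≤ P.numCandidates) :
    μ {ω | ⟪θs, θ P.initLength ω⟫ < 7 / 10 / √(d : ℝ)} ≤
      ((2 * P.numCandidates + 1 : ℕ) : ℝ≥0∞) * ENNReal.ofReal (Real.exp (-Lp)) := by
  set n := P.numPlays
  set M := P.numCandidates
  set e := ENNReal.ofReal (Real.exp (-Lp))
  have hn0' : (0 : ℝ) < n := by exact_mod_cast hn0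
  have hsd : 0 < √(d : ℝ) := Real.sqrt_pos.2 (by exact_mod_cast (by omega : 0 < d))
  have hsd1 : 1 ≤ √(d : ℝ) := Real.one_le_sqrt.2 (by exact_mod_cast (by omega : 1 ≤ d))
  have hhi : 9 / 10 / √(d : ℝ) ≤ 1 := by rw [div_le_one hsd]; linarith
  have hlo : 7 / 10 / √(d : ℝ) ≤ 9 / 10 / √(d : ℝ) := by gcongr; norm_num
  have hlo0 : 0 ≤ 7 / 10 / √(d : ℝ) := by positivity
  -- The sign s covers both tails. The threshold is the midpoint of the two values of f, so
  -- deviations below Δ / 2 cannot mislead the test; by `hn`, n (Δ/2)² / 2 ≥ Lp.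
  set B : ℝ → ℕ → Set Ω := fun s j =>
    {ω | n * (Δ / 2) ≤ s * ∑ i ∈ Finset.range n, noiseOf f θs a r (j * n + i) ω} with hB
  have hBle : ∀ s, (s = 1 ∨ s = -1) → ∀ j, μ (B s j) ≤ e := by
    intro s hs j
    refine (h.measure_sum_noiseOf_ge_le hf hθs (j * n) n hs (by positivity)).trans ?_
    apply ENNReal.ofReal_le_ofReal
    apply Real.exp_le_exp.2
    nlinarith
  have hC := h.measure_all_cand_lt_le hd hθs M
  have hC' : μ {ω | ∀ j < M, ⟪θs, cand j ω⟫ < 9 / 10 / √(d : ℝ)} ≤ e := by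
    refine hC.trans (ENNReal.ofReal_le_ofReal (Real.exp_le_exp.2 ?_))
    linarith
  have hsub : ∀ᵐ ω ∂μ, ω ∈ {ω | ⟪θs, θ P.initLength ω⟫ < 7 / 10 / √(d : ℝ)} →
      ω ∈ (⋃ j ∈ Finset.range M, (B 1 j ∪ B (-1) j)) ∪
        {ω | ∀ j < M, ⟪θs, cand j ω⟫ < 9 / 10 / √(d : ℝ)} := by
    filter_upwards [h.ae_norm_cand] with ω hω hbad
    by_contra hcon
    simp only [Set.mem_union, Set.mem_iUnion, not_or, not_exists, Finset.mem_range] at hcon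
    obtain ⟨hnoise, hgood⟩ := hcon
    have hgood' : ∃ j < M, 9 / 10 / √(d : ℝ) ≤ ⟪θs, cand j ω⟫ := by
      by_contra hc
      push Not at hc
      exact hgood hc
    have hw : ∀ j, |⟪θs, cand j ω⟫| ≤ 1 := fun j =>
      (abs_real_inner_le_norm _ _).trans (by rw [hθs, hω, one_mul])
    have hmean : ∀ j < M, P.meanReward (fun t => r t ω) j =
        f ⟪θs, cand j ω⟫ + (∑ i ∈ Finset.range n, noiseOf f θs a r (j * n + i) ω) / n := by
      intro j hj
      have h1 : ∀ i ∈ Finset.range n, r (j * n + i) ω =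
          f ⟪θs, cand j ω⟫ + noiseOf f θs a r (j * n + i) ω := by
        intro i hi
        have hi' := Finset.mem_range.1 hi
        have hlt : j * n + i < P.initLength := by
          have : (j + 1) * n ≤ M * n := Nat.mul_le_mul_right _ hj
          show _ < M * n
          linarith [add_mul j 1 n]
        have hdiv : (j * n + i) / n = j := by
          rw [mul_comm, Nat.mul_add_div hn0, Nat.div_eq_of_lt hi', add_zero]
        rw [noiseOf, h.init_a _ hlt, h.init_θ _ hlt]
        change _ = _ + (_ - clampLink f ⟪θs, cand ((j * n + i) / n) ω⟫)
        rw [hdiv, clampLink_eq f (hw j)]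
        ring
      rw [Procedure.meanReward]
      change (∑ i ∈ Finset.range n, r (j * n + i) ω) / (n : ℝ) = _
      rw [Finset.sum_congr rfl h1, Finset.sum_add_distrib, Finset.sum_const, Finset.card_range,
        nsmul_eq_mul, add_div, mul_div_cancel_left₀ _ hn0'.ne']
    have hdev : ∀ j < M, -(Δ / 2) < (∑ i ∈ Finset.range n, noiseOf f θs a r (j * n + i) ω) / n ∧
        (∑ i ∈ Finset.range n, noiseOf f θs a r (j * n + i) ω) / n < Δ / 2 := by
      intro j hj
      have h1 : ¬ n * (Δ / 2) ≤ 1 * _ := (hnoise j hj).1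
      have h2 : ¬ n * (Δ / 2) ≤ -1 * _ := (hnoise j hj).2
      rw [not_le] at h1 h2
      rw [lt_div_iff₀ hn0', div_lt_iff₀ hn0']
      constructor <;> linarith
    have hne : {j | j < M ∧ P.threshold ≤ P.meanReward (fun t => r t ω) j}.Nonempty := by
      obtain ⟨j, hj, hge⟩ := hgood'
      refine ⟨j, hj, ?_⟩
      rw [hmean j hj, hthr]
      have h1 := hf ⟨by linarith, hhi⟩ ⟨(abs_le.1 (hw j)).1, (abs_le.1 (hw j)).2⟩ hge
      have := (hdev j hj).1
      linarith
    have hsel : P.selected (fun t => r t ω) ∈ {j | j < M ∧ P.threshold ≤ P.meanReward (fun t => r t ω) j} :=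
      Nat.sInf_mem hne
    obtain ⟨hs1, hs2⟩ := hsel
    rw [hmean _ hs1, hthr] at hs2
    have hbad' : ⟪θs, cand (P.selected (fun t => r t ω)) ω⟫ < 7 / 10 / √(d : ℝ) := by
      have : ⟪θs, θ P.initLength ω⟫ < 7 / 10 / √(d : ℝ) := hbad
      rwa [h.start] at this
    have h1 := hf ⟨(abs_le.1 (hw _)).1, (abs_le.1 (hw _)).2⟩ ⟨by linarith, by linarith⟩ hbad'.le
    have := (hdev _ hs1).2
    linarith
  calc _ ≤ _ := measure_mono_ae hsub
    _ ≤ _ := measure_union_le _ _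
    _ ≤ (∑ j ∈ Finset.range M, (e + e)) + e := by
      refine add_le_add ((measure_biUnion_finset_le _ _).trans (Finset.sum_le_sum fun j _ => ?_)) hC'
      exact (measure_union_le _ _).trans
        (add_le_add (hBle 1 (Or.inl rfl) j) (hBle (-1) (Or.inr rfl) j))
    _ = _ := by
      rw [Finset.sum_const, Finset.card_range, nsmul_eq_mul]
      push_cast; ring

end Init

/-! ### Slopes of link functions and the burn-in integral -/

theorem linkDeriv_eq_deriv (f : ℝ → ℝ) {x : ℝ} (h0 : -1 < x) (h1 : x < 1) :
    linkDeriv f x = deriv f x :=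
  derivWithin_of_mem_nhds (Icc_mem_nhds h0 h1)

theorem SlopeFrom.mono {f : ℝ → ℝ} {p q S S' : ℝ} (h : SlopeFrom f p S) (hpq : p ≤ q)
    (hS : S' ≤ S) : SlopeFrom f q S' := fun x y hx hxy hy =>
  (mul_le_mul_of_nonneg_right hS (by linarith)).trans (h x y (hpq.trans hx) hxy hy)

theorem slopeFrom_of_linkDeriv {f : ℝ → ℝ} {p S : ℝ} (hp : -1 < p)
    (hd : ∀ x ∈ Set.Icc p 1, DifferentiableWithinAt ℝ f (Set.Icc (-1) 1) x)
    (hS : ∀ x ∈ Set.Icc p 1, S ≤ linkDeriv f x) : SlopeFrom f p S := by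
  intro x y hx hxy hy
  have hcont : ContinuousOn f (Set.Icc p 1) := fun x hx =>
    (hd x hx).continuousWithinAt.mono (Set.Icc_subset_Icc_left hp.le)
  refine (convex_Icc p 1).mul_sub_le_image_sub_of_le_deriv hcont ?_ ?_ x ⟨hx, hxy.trans hy⟩ y
    ⟨hx.trans hxy, hy⟩ hxy
  · rw [interior_Icc]
    intro x hx
    exact ((hd x ⟨hx.1.le, hx.2.le⟩).differentiableAt
      (Icc_mem_nhds (hp.trans hx.1) hx.2)).differentiableWithinAt
  · rw [interior_Icc]
    intro x hx
    rw [← linkDeriv_eq_deriv f (hp.trans hx.1) hx.2]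
    exact hS x ⟨hx.1.le, hx.2.le⟩

theorem IsLink.sub_le {f : ℝ → ℝ} {γ₀ γ₁ γ₂ : ℝ} (h : IsLink f γ₀ γ₁ γ₂) (hγ : γ₀ < 2) {x : ℝ}
    (hx : 1 - γ₀ ≤ x) (hx1 : x ≤ 1) : f 1 - f x ≤ γ₂ * (1 - x) := by
  have hp : -1 < 1 - γ₀ := by linarith
  have hcont : ContinuousOn f (Set.Icc (1 - γ₀) 1) := fun x hx =>
    (h.differentiable x hx).continuousWithinAt.mono (Set.Icc_subset_Icc_left hp.le)
  refine (convex_Icc (1 - γ₀) 1).image_sub_le_mul_sub_of_deriv_le hcont ?_ ?_ x ⟨hx, hx1⟩ 1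
    ⟨hx.trans hx1, le_rfl⟩ hx1
  · rw [interior_Icc]
    intro x hx
    exact ((h.differentiable x ⟨hx.1.le, hx.2.le⟩).differentiableAt
      (Icc_mem_nhds (hp.trans hx.1) hx.2)).differentiableWithinAt
  · rw [interior_Icc]
    intro x hx
    rw [← linkDeriv_eq_deriv f (hp.trans hx.1) hx.2]
    exact (h.deriv_mem x ⟨hx.1.le, hx.2.le⟩).2

theorem linkDeriv_le_of_convexOn {f : ℝ → ℝ} (hc : ConvexOn ℝ (Set.Icc 0 1) f)
    (hf : MonotoneOn f (Set.Icc (-1) 1)) {m x y : ℝ} (hm : 0 < m) (hmx : m < x) (hxy : x < y)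
    (hy : y ≤ 1) : linkDeriv f m ≤ (f y - f x) / (y - x) := by
  have hm' : m ∈ Set.Icc (0 : ℝ) 1 := ⟨hm.le, by linarith⟩
  have hx' : x ∈ Set.Icc (0 : ℝ) 1 := ⟨by linarith, by linarith⟩
  have hy' : y ∈ Set.Icc (0 : ℝ) 1 := ⟨by linarith, hy⟩
  rw [linkDeriv_eq_deriv f (by linarith) (by linarith)]
  by_cases hdiff : DifferentiableAt ℝ f m
  · have h1 := hc.deriv_le_slope hm' hx' hmx hdiff
    rw [slope_def_field] at h1
    exact h1.trans (hc.slope_mono_adjacent hm' hy' hmx hxy)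
  -- At a kink the derivative has the default value 0, and monotonicity of f suffices.
  · rw [deriv_zero_of_not_differentiableAt hdiff]
    have := hf ⟨by linarith, by linarith⟩ ⟨by linarith, hy⟩ hxy.le
    exact div_nonneg (by linarith) (by linarith)

/-- Secant slopes of a convex function increase, so a single secant ending at p bounds all slopes to
the right of p. -/
theorem slopeFrom_of_convexOn {f : ℝ → ℝ} (hc : ConvexOn ℝ (Set.Icc 0 1) f) {q p : ℝ}
    (hq : 0 ≤ q) (hqp : q < p) : SlopeFrom f p ((f p - f q) / (p - q)) := by
  intro x y hx hxy hy
  rcases hxy.eq_or_lt with rfl | hxy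
  · simp
  have hq' : q ∈ Set.Icc (0 : ℝ) 1 := ⟨hq, by linarith⟩
  have hp' : p ∈ Set.Icc (0 : ℝ) 1 := ⟨by linarith, by linarith⟩
  have hx' : x ∈ Set.Icc (0 : ℝ) 1 := ⟨by linarith, by linarith⟩
  have hy' : y ∈ Set.Icc (0 : ℝ) 1 := ⟨by linarith, hy⟩
  rw [← le_div_iff₀ (by linarith)]
  rcases hx.eq_or_lt with rfl | hx
  · exact hc.slope_mono_adjacent hq' hy' hqp hxy
  · exact (hc.slope_mono_adjacent hq' hx' hqp hx).trans (hc.slope_mono_adjacent hp' hy' hx hxy)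

/-- An upper bound for the derivative on a window gives a lower bound for the integral. -/
theorem pos_and_le_burnInIntegral {f : ℝ → ℝ} {d : ℕ} {b u v s : ℝ} (hI : burnInIntegral f d b ≠ ∞)
    (hu0 : 0 < u) (hu : 1 / (2 * √(d : ℝ)) ≤ u) (huv : u < v) (hv : v ≤ b)
    (hs : ∀ m ∈ Set.Icc u v, linkDeriv f m ≤ s) :
    0 < s ∧ u * (v - u) / s ^ 2 ≤ (burnInIntegral f d b).toReal := by
  have h1 : ENNReal.ofReal u / ENNReal.ofReal s ^ 2 * ENNReal.ofReal (v - u)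
      ≤ burnInIntegral f d b := by
    calc _ = ∫⁻ _m in Set.Icc u v, ENNReal.ofReal u / ENNReal.ofReal s ^ 2 := by
          rw [setLIntegral_const, Real.volume_Icc]
      _ ≤ ∫⁻ m in Set.Icc u v, ENNReal.ofReal m / ENNReal.ofReal (linkDeriv f m) ^ 2 := by
          refine setLIntegral_mono' measurableSet_Icc fun m hm => ?_
          gcongr
          · exact hm.1
          · exact hs m hm
      _ ≤ _ := lintegral_mono_set (Set.Icc_subset_Icc hu hv)
  have hs0 : 0 < s := by
    -- If s ≤ 0, the integrand is infinite on a window of positive length.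
    by_contra hcon
    rw [ENNReal.ofReal_of_nonpos (not_lt.1 hcon)] at h1
    have : ENNReal.ofReal u ≠ 0 := by simpa using hu0
    simp only [ne_eq, OfNat.ofNat_ne_zero, not_false_eq_true, zero_pow] at h1
    rw [ENNReal.div_zero this, ENNReal.top_mul (by simpa using huv)] at h1
    exact hI (top_le_iff.1 h1)
  refine ⟨hs0, ?_⟩
  rw [← ENNReal.ofReal_pow hs0.le, ← ENNReal.ofReal_div_of_pos (by positivity),
    ← ENNReal.ofReal_mul (by positivity)] at h1
  have h2 := (ENNReal.ofReal_le_iff_le_toReal hI).1 h1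
  calc _ = u / s ^ 2 * (v - u) := by ring
    _ ≤ _ := h2

/-- Slopes for the burn-in phase, and their relation to the burn-in integral. -/
theorem exists_slope {γ₀ γ₁ γ₂ c₀ : ℝ} (hγ₀' : γ₀ ≤ 1 / 10) (hγ₀ : 0 < γ₀) (hc₀ : 0 < c₀) {d : ℕ}
    (hd : 2 ≤ d) {f : ℝ → ℝ} (hf : IsLink f γ₀ γ₁ γ₂)
    (hA : HasDerivLowerBound f c₀ ∨ ConvexOn ℝ (Set.Icc 0 1) f)
    (hI : burnInIntegral f d (1 - γ₀ / 2) ≠ ∞) {B : ℝ} (hB : 7 / 10 / √(d : ℝ) ≤ B) (hB1 : B ≤ 1) :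
    ∃ S, 0 < S ∧ S ≤ 1 ∧ SlopeFrom f (9 / 10 * B) S ∧
      B ^ 2 / S ^ 2 ≤ 25 * (burnInIntegral f d (1 - γ₀ / 2)).toReal + 1 / c₀ ^ 2 + 1 := by
  have hI0 : 0 ≤ (burnInIntegral f d (1 - γ₀ / 2)).toReal := ENNReal.toReal_nonneg
  have hsd : 0 < √(d : ℝ) := Real.sqrt_pos.2 (by exact_mod_cast (by omega : 0 < d))
  have hB0 : 0 < B := lt_of_lt_of_le (by positivity) hB
  have key : ∀ s, 0 < s → B ^ 2 / (min s 1) ^ 2 ≤ B ^ 2 / s ^ 2 + 1 := by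
    intro s hs
    have hBsq : B ^ 2 ≤ 1 := pow_le_one₀ hB0.le hB1
    rcases le_total s 1 with h | h
    · rw [min_eq_left h]; linarith
    · rw [min_eq_right h]
      have : 0 ≤ B ^ 2 / s ^ 2 := by positivity
      simpa using by linarith
  rcases hA with hA | hA
  · refine ⟨min c₀ 1, lt_min hc₀ one_pos, min_le_right _ _, ?_, ?_⟩
    · exact (slopeFrom_of_linkDeriv (by norm_num) (fun x hx => (hA x hx).1)
        (fun x hx => (hA x hx).2)).mono (by positivity : (0 : ℝ) ≤ _) (min_le_left _ _)
    · refine (key c₀ hc₀).trans ?_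
      have : B ^ 2 / c₀ ^ 2 ≤ 1 / c₀ ^ 2 := by
        gcongr; exact pow_le_one₀ hB0.le hB1
      linarith
  -- The secant over [0.855 B, 0.9 B] bounds the slopes to its right from below and f' on [0.8 B,
  -- 0.85 B] from above. The window lies in the domain of integration as 0.8 · 0.7 ≥ 1/2, and 0.8 ·
  -- 0.05 = 1/25 gives the constant 25.
  · set s := (f (9 / 10 * B) - f (855 / 1000 * B)) / (9 / 10 * B - 855 / 1000 * B) with hs
    have hlow : 1 / (2 * √(d : ℝ)) ≤ 8 / 10 * B := by
      have : 1 / (2 * √(d : ℝ)) = 5 / 7 * (7 / 10 / √(d : ℝ)) := by field_simp; norm_num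
      linarith
    obtain ⟨hs0, hs1⟩ := pos_and_le_burnInIntegral hI (u := 8 / 10 * B) (v := 85 / 100 * B) (s := s)
      (by positivity) hlow (by linarith) (by linarith) (fun m hm =>
        linkDeriv_le_of_convexOn hA hf.monotone (by linarith [hm.1]) (by linarith [hm.2])
          (by linarith) (by linarith))
    refine ⟨min s 1, lt_min hs0 one_pos, min_le_right _ _, ?_, ?_⟩
    · exact (slopeFrom_of_convexOn hA (by positivity) (by linarith)).mono le_rfl (min_le_left _ _)
    · refine (key s hs0).trans ?_
      have h2 : B ^ 2 / s ^ 2 = 25 * (8 / 10 * B * (85 / 100 * B - 8 / 10 * B) / s ^ 2) := by ring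
      have : 0 ≤ 1 / c₀ ^ 2 := by positivity
      linarith

/-- The gap that the hypothesis test has to detect. -/
theorem exists_gap {γ₀ γ₁ γ₂ c₀ : ℝ} (hγ₀' : γ₀ ≤ 1 / 10) (hγ₀ : 0 < γ₀) (hc₀ : 0 < c₀) {d : ℕ}
    (hd : 2 ≤ d) {f : ℝ → ℝ} (hf : IsLink f γ₀ γ₁ γ₂)
    (hA : HasDerivLowerBound f c₀ ∨ ConvexOn ℝ (Set.Icc 0 1) f)
    (hI : burnInIntegral f d (1 - γ₀ / 2) ≠ ∞) :
    0 < f (9 / 10 / √(d : ℝ)) - f (7 / 10 / √(d : ℝ)) ∧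
    1 / (f (9 / 10 / √(d : ℝ)) - f (7 / 10 / √(d : ℝ))) ^ 2 ≤
      (d : ℝ) ^ 2 * (1600 * (burnInIntegral f d (1 - γ₀ / 2)).toReal + 25 / c₀ ^ 2) := by
  have hI0 : 0 ≤ (burnInIntegral f d (1 - γ₀ / 2)).toReal := ENNReal.toReal_nonneg
  have hd2 : (2 : ℝ) ≤ d := by exact_mod_cast hd
  set q := √(d : ℝ) with hq
  have hqq : q ^ 2 = d := Real.sq_sqrt (by linarith)
  have hq0 : 0 < q := Real.sqrt_pos.2 (by linarith)
  have hq1 : 1.4 ≤ q := by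
    rw [hq]; exact Real.le_sqrt_of_sq_le (by norm_num; linarith)
  have hinv : 1 / q ≤ 5 / 7 := by
    rw [div_le_div_iff₀ hq0 (by norm_num)]; linarith
  have hinv0 : 0 < 1 / q := by positivity
  have e9 : 9 / 10 / q = 9 / 10 * (1 / q) := by ring
  have e7 : 7 / 10 / q = 7 / 10 * (1 / q) := by ring
  have e5 : 1 / (2 * q) = 1 / 2 * (1 / q) := by field_simp
  have hdsq : 1 / q ^ 2 = (1 / q) ^ 2 := by rw [div_pow, one_pow]
  rw [e9, e7]
  set y := 1 / q with hy
  have hyd : y ^ 2 * d = 1 := by rw [hy, div_pow, hqq]; field_simp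
  set Δ := f (9 / 10 * y) - f (7 / 10 * y) with hΔ
  rcases hA with hA | hA
  · have hsl := slopeFrom_of_linkDeriv (p := 0) (by norm_num) (fun x hx => (hA x hx).1)
        (fun x hx => (hA x hx).2) (7 / 10 * y) (9 / 10 * y) (by positivity) (by linarith) (by linarith)
    have h1 : c₀ * y / 5 ≤ Δ := by rw [hΔ]; linarith
    have hpos : 0 < c₀ * y / 5 := by positivity
    refine ⟨hpos.trans_le h1, ?_⟩
    have h2 : 1 / Δ ^ 2 ≤ 1 / (c₀ * y / 5) ^ 2 := by gcongr
    have h3 : 1 / (c₀ * y / 5) ^ 2 = d * (25 / c₀ ^ 2) := by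
      have : y ^ 2 = 1 / d := by rw [eq_div_iff (by linarith)]; exact hyd
      rw [div_pow, mul_pow, this]; field_simp; norm_num
    have h4 : (d : ℝ) * (25 / c₀ ^ 2) ≤ d ^ 2 * (25 / c₀ ^ 2) := by gcongr; nlinarith
    have h5 : 0 ≤ (d : ℝ) ^ 2 * (1600 * (burnInIntegral f d (1 - γ₀ / 2)).toReal) := by positivity
    linarith [mul_add ((d : ℝ) ^ 2) (1600 * (burnInIntegral f d (1 - γ₀ / 2)).toReal) (25 / c₀ ^ 2)]
  · have hmono : f (7 / 10 * y) ≤ f (8 / 10 * y) :=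
      hf.monotone ⟨by linarith, by linarith⟩ ⟨by linarith, by linarith⟩ (by linarith)
    -- The same comparison at scale y = 1/√d: f' on [0.7 y, 0.79 y] is at most the secant slope over
    -- [0.8 y, 0.9 y], hence at most Δ / (y/10). The factor d² appears because d² y⁴ = 1.
    obtain ⟨hs0, hs1⟩ := pos_and_le_burnInIntegral hI (u := 7 / 10 * y) (v := 79 / 100 * y)
      (s := Δ / (y / 10)) (by positivity) (by rw [e5]; linarith) (by linarith) (by linarith)
      (fun m hm => (linkDeriv_le_of_convexOn hA hf.monotone (x := 8 / 10 * y) (y := 9 / 10 * y)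
          (by linarith [hm.1]) (by linarith [hm.2]) (by linarith) (by linarith)).trans (by
            rw [show 9 / 10 * y - 8 / 10 * y = y / 10 by ring]
            gcongr
            linarith))
    have hΔ0 : 0 < Δ := by
      rcases div_pos_iff.1 hs0 with h | h
      · exact h.1
      · linarith [h.2]
    refine ⟨hΔ0, ?_⟩
    have h2 : 7 / 10 * y * (79 / 100 * y - 7 / 10 * y) / (Δ / (y / 10)) ^ 2
        = 63 / 100000 * (y ^ 2) ^ 2 * (1 / Δ ^ 2) := by field_simp; ring
    have h3 : (d : ℝ) ^ 2 * (y ^ 2) ^ 2 = 1 := by rw [← mul_pow, mul_comm, hyd, one_pow]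
    have h4 : 1 / Δ ^ 2 = (d : ℝ) ^ 2 * (100000 / 63) *
        (63 / 100000 * (y ^ 2) ^ 2 * (1 / Δ ^ 2)) := by
      calc 1 / Δ ^ 2 = ((d : ℝ) ^ 2 * (y ^ 2) ^ 2) * (1 / Δ ^ 2) := by rw [h3, one_mul]
        _ = _ := by ring
    rw [h4, ← h2]
    have h5 : (0 : ℝ) ≤ 25 / c₀ ^ 2 := by positivity
    calc _ ≤ (d : ℝ) ^ 2 * (100000 / 63) * (burnInIntegral f d (1 - γ₀ / 2)).toReal := by gcongr
      _ ≤ (d : ℝ) ^ 2 * (1600 * (burnInIntegral f d (1 - γ₀ / 2)).toReal) := by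
        rw [mul_assoc]; gcongr; norm_num
      _ ≤ _ := by gcongr; linarith

/-! ### The schedule of learning rates -/

/-- A phase of `N` steps with constant learning rate `α`, during which the correlation is kept
above `B - dev` and lifted from `B` to `B'`. -/
structure Phase (f : ℝ → ℝ) (d : ℕ) (σ lam Lp B B' : ℝ) where
  N : ℕ
  dev : ℝ
  α : ℝ
  S : ℝ
  p : ℝ
  N_pos : 1 ≤ N
  dev_pos : 0 < dev
  α_pos : 0 < α
  S_pos : 0 < S
  S_le : S ≤ 1
  p_nonneg : 0 ≤ p
  slope : SlopeFrom f p S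
  rate_le : 16 * noiseConst * (Lp / dev * α) ≤ σ * S
  sum_le_one : driftRate d σ S α + shrinkRate α ≤ 1
  fixpoint : B * (driftRate d σ S α + shrinkRate α) ≤ driftRate d σ S α
  lift : B' + dev ≤ driftIter (driftRate d σ S α) (shrinkRate α) B N
  low : 1 / (2 * √(d : ℝ)) ≤ B - dev
  p_le : p ≤ lam * (B - dev)

/-- The first step of phase `i`. -/
def phaseStart (N : ℕ → ℕ) (i : ℕ) : ℕ := ∑ j ∈ Finset.range i, N j

/-- The phase that contains step `n`. -/
def phaseOf (N : ℕ → ℕ) (n : ℕ) : ℕ := sInf {i | n < phaseStart N (i + 1)}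

theorem phaseStart_succ (N : ℕ → ℕ) (i : ℕ) : phaseStart N (i + 1) = phaseStart N i + N i :=
  Finset.sum_range_succ _ _

theorem phaseStart_mono (N : ℕ → ℕ) : Monotone (phaseStart N) :=
  monotone_nat_of_le_succ fun i => by rw [phaseStart_succ]; omega

theorem phaseOf_add (N : ℕ → ℕ) {i k : ℕ} (hk : k < N i) : phaseOf N (phaseStart N i + k) = i := by
  have hmem : i ∈ {j | phaseStart N i + k < phaseStart N (j + 1)} := by
    show phaseStart N i + k < phaseStart N (i + 1)
    rw [phaseStart_succ]; omega
  refine le_antisymm (Nat.sInf_le hmem) (le_csInf ⟨i, hmem⟩ fun j hj => ?_)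
  by_contra hcon
  have h1 := phaseStart_mono N (show j + 1 ≤ i by omega)
  have h2 : phaseStart N i + k < phaseStart N (j + 1) := hj
  omega

theorem exists_phase {N : ℕ → ℕ} (hN : ∀ i, 1 ≤ N i) (n : ℕ) :
    ∃ i k, k < N i ∧ n = phaseStart N i + k := by
  induction n with
  | zero => exact ⟨0, 0, hN 0, by simp [phaseStart]⟩
  | succ n ih =>
    obtain ⟨i, k, hk, rfl⟩ := ih
    by_cases h : k + 1 < N i
    · exact ⟨i, k + 1, h, by omega⟩
    · exact ⟨i + 1, 0, hN _, by rw [phaseStart_succ]; omega⟩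

/-- The constant in the learning rates. -/
def rateConst (σ ρ : ℝ) : ℝ := σ * ρ / (400 * noiseConst)

theorem rateConst_pos {σ ρ : ℝ} (hσ : 0 < σ) (hρ : 0 < ρ) : 0 < rateConst σ ρ := by
  have := one_le_noiseConst
  unfold rateConst; positivity

/-- The learning rate for slope `S` and weight `w`. -/
def phaseRate (d : ℕ) (σ ρ Lp S w : ℝ) : ℝ := rateConst σ ρ * S * w / (d * Lp)

section Rates

variable {d : ℕ} {σ ρ Lp S w : ℝ}

theorem phaseRate_pos (hd : 2 ≤ d) (hσ : 0 < σ) (hρ : 0 < ρ) (hLp : 1 ≤ Lp) (hS : 0 < S)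
    (hw : 0 < w) : 0 < phaseRate d σ ρ Lp S w := by
  have := rateConst_pos hσ hρ
  have : (0 : ℝ) < d := by exact_mod_cast (by omega : 0 < d)
  unfold phaseRate; positivity

theorem phaseRate_le (hd : 2 ≤ d) (hσ : 0 < σ) (hρ : 0 < ρ) (hLp : 1 ≤ Lp) (hS : 0 < S)
    (hw : 0 < w) {dev : ℝ} (hdev : 0 < dev) (h : ρ * w ≤ 25 * d * dev) :
    16 * noiseConst * (Lp / dev * phaseRate d σ ρ Lp S w) ≤ σ * S := by
  have hD := one_le_noiseConst
  have hd0 : (0 : ℝ) < d := by exact_mod_cast (by omega : 0 < d)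
  have e : 16 * noiseConst * (Lp / dev * phaseRate d σ ρ Lp S w)
      = σ * S * (ρ * w / (25 * d * dev)) := by
    unfold phaseRate rateConst; field_simp; norm_num
  rw [e]
  exact mul_le_of_le_one_right (by positivity) (by rw [div_le_one (by positivity)]; exact h)

theorem driftRate_phaseRate (hd : 2 ≤ d) (hLp : 1 ≤ Lp) :
    driftRate d σ S (phaseRate d σ ρ Lp S w) = rateConst σ ρ * σ * S ^ 2 * w / (4 * d ^ 2 * Lp) := by
  have hd0 : (0 : ℝ) < d := by exact_mod_cast (by omega : 0 < d)
  unfold driftRate phaseRate; field_simp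

theorem shrinkRate_phaseRate (hd : 2 ≤ d) (hLp : 1 ≤ Lp) :
    shrinkRate (phaseRate d σ ρ Lp S w)
      = 13 * noiseConst * rateConst σ ρ ^ 2 * S ^ 2 * w ^ 2 / (d ^ 2 * Lp ^ 2) := by
  have hd0 : (0 : ℝ) < d := by exact_mod_cast (by omega : 0 < d)
  unfold shrinkRate phaseRate; field_simp

theorem driftRate_pos (hd : 2 ≤ d) (hσ : 0 < σ) (hρ : 0 < ρ) (hLp : 1 ≤ Lp) (hS : 0 < S)
    (hw : 0 < w) : 0 < driftRate d σ S (phaseRate d σ ρ Lp S w) := by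
  have hd0 : (0 : ℝ) < d := by exact_mod_cast (by omega : 0 < d)
  have := rateConst_pos hσ hρ
  rw [driftRate_phaseRate hd hLp]; positivity

theorem shrinkRate_pos (hd : 2 ≤ d) (hσ : 0 < σ) (hρ : 0 < ρ) (hLp : 1 ≤ Lp) (hS : 0 < S)
    (hw : 0 < w) : 0 < shrinkRate (phaseRate d σ ρ Lp S w) := by
  have hd0 : (0 : ℝ) < d := by exact_mod_cast (by omega : 0 < d)
  have := rateConst_pos hσ hρ
  have := one_le_noiseConst
  rw [shrinkRate_phaseRate hd hLp]; positivity

/-- Places the fixed point of the recursion above 1 / (1 + ρ w / 4). The weight w is 1 / B during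
the burn-in and the error E afterwards. -/
theorem shrinkRate_le (hd : 2 ≤ d) (hσ : 0 < σ) (hρ : 0 < ρ) (hLp : 1 ≤ Lp) (hS : 0 < S)
    (hw : 0 < w) : shrinkRate (phaseRate d σ ρ Lp S w)
      ≤ driftRate d σ S (phaseRate d σ ρ Lp S w) * (ρ / 4 * w) := by
  have hd0 : (0 : ℝ) < d := by exact_mod_cast (by omega : 0 < d)
  have hD := one_le_noiseConst
  rw [driftRate_phaseRate hd hLp, shrinkRate_phaseRate hd hLp]
  have e : 13 * noiseConst * rateConst σ ρ ^ 2 * S ^ 2 * w ^ 2 / (d ^ 2 * Lp ^ 2)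
      = (rateConst σ ρ * σ * S ^ 2 * w / (4 * d ^ 2 * Lp) * (ρ / 4 * w)) * (52 / (100 * Lp)) := by
    unfold rateConst; field_simp; norm_num
  have := rateConst_pos hσ hρ
  rw [e]
  refine mul_le_of_le_one_right (by positivity) ?_
  rw [div_le_one (by positivity)]; linarith

theorem driftRate_add_shrinkRate_le (hd : 2 ≤ d) (hσ : 0 < σ) (hσ1 : σ ≤ 1) (hρ : 0 < ρ)
    (hρ1 : ρ ≤ 1) (hLp : 1 ≤ Lp) (hS : 0 < S) (hS1 : S ≤ 1) (hw : 0 < w) (hwd : w ≤ 2 * d) :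
    driftRate d σ S (phaseRate d σ ρ Lp S w) + shrinkRate (phaseRate d σ ρ Lp S w) ≤ 1 := by
  have hd2 : (2 : ℝ) ≤ d := by exact_mod_cast hd
  have hd0 : (0 : ℝ) < d := by linarith
  have hD := one_le_noiseConst
  have hκ0 := rateConst_pos hσ hρ
  have hα0 := phaseRate_pos hd hσ hρ hLp hS hw
  have hκ : noiseConst * rateConst σ ρ ≤ 1 / 400 := by
    have : noiseConst * rateConst σ ρ = σ * ρ / 400 := by unfold rateConst; field_simp
    rw [this]; gcongr; nlinarith
  have hα : noiseConst * phaseRate d σ ρ Lp S w ≤ 1 / 200 := by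
    have e : noiseConst * phaseRate d σ ρ Lp S w
        = (noiseConst * rateConst σ ρ) * S * (w / d) / Lp := by unfold phaseRate; field_simp
    rw [e]
    have h1 : w / d ≤ 2 := by rw [div_le_iff₀ hd0]; exact hwd
    calc (noiseConst * rateConst σ ρ) * S * (w / d) / Lp ≤ 1 / 400 * 1 * 2 / 1 := by gcongr
      _ = _ := by norm_num
  generalize phaseRate d σ ρ Lp S w = α at *
  have hα1 : α ≤ 1 / 200 := by nlinarith
  have h1 : driftRate d σ S α ≤ 1 / 2 := by
    unfold driftRate
    rw [div_le_iff₀ (by positivity)]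
    have : α * σ * S ≤ 1 / 200 * 1 * 1 := by gcongr
    linarith
  have h2 : shrinkRate α ≤ 1 / 2 := by
    unfold shrinkRate
    have : noiseConst * α ^ 2 ≤ 1 / 200 * (1 / 200) := by
      rw [sq, ← mul_assoc]; gcongr
    linarith
  linarith

/-- After `2 / (a + b)` iterations three quarters of the distance to the fixed point are gone. -/
theorem le_driftIter_of_two_le {a b B : ℝ} (ha : 0 < a) (hb : 0 < b) (hab : a + b ≤ 1)
    (hB : B * (a + b) ≤ a) {n : ℕ} (hn : 2 ≤ n * (a + b)) {R : ℝ} (hR : 0 ≤ R) (hbR : b ≤ a * R) :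
    3 / 4 / (1 + R) + B / 4 ≤ driftIter a b B n := by
  have hs : 0 < a + b := by linarith
  rw [driftIter_sub hs]
  have hBm : B ≤ a / (a + b) := by rw [le_div_iff₀ hs]; exact hB
  have hq : (1 - a - b) ^ n ≤ 1 / 4 := by
    have h1 : 1 - a - b ≤ Real.exp (-(a + b)) := by
      have := Real.add_one_le_exp (-(a + b)); linarith
    have h2 : (1 - a - b) ^ n ≤ Real.exp (-(a + b)) ^ n :=
      pow_le_pow_left₀ (by linarith) h1 n
    rw [← Real.exp_nat_mul] at h2
    have h3 : Real.exp (n * -(a + b)) ≤ Real.exp (-2) := Real.exp_le_exp.2 (by linarith)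
    have h4 : Real.exp (-2) ≤ 1 / 4 := by
      rw [Real.exp_neg, ← one_div]
      apply one_div_le_one_div_of_le (by norm_num)
      have h5 : (2 : ℝ) ≤ Real.exp 1 := by linarith [Real.add_one_le_exp (1 : ℝ)]
      have h6 : Real.exp 2 = Real.exp 1 * Real.exp 1 := by rw [← Real.exp_add]; norm_num
      nlinarith
    linarith
  have hR1 : 1 / (1 + R) ≤ a / (a + b) := by
    rw [div_le_div_iff₀ (by linarith) hs]; linarith
  have h5 : (1 - a - b) ^ n * (a / (a + b) - B) ≤ 1 / 4 * (a / (a + b) - B) :=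
    mul_le_mul_of_nonneg_right hq (by linarith)
  have h6 : 3 / 4 / (1 + R) = 3 / 4 * (1 / (1 + R)) := by ring
  linarith

end Rates

theorem rateConst_le {σ ρ : ℝ} (hσ : 0 < σ) (hσ1 : σ ≤ 1) (hρ : 0 < ρ) (hρ1 : ρ ≤ 1) :
    rateConst σ ρ ≤ 1 / 400 := by
  have hD := one_le_noiseConst
  unfold rateConst
  rw [div_le_div_iff₀ (by positivity) (by norm_num)]
  nlinarith

/-- A phase that lifts the correlation by a constant factor. -/
theorem exists_burnIn_phase {f : ℝ → ℝ} {d : ℕ} (hd : 2 ≤ d) {σ γ Lp B B' S : ℝ} (hγ : 0 < γ)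
    (hγ1 : γ ≤ 1 / 10) (hσ : 0 < σ) (hσ1 : σ ≤ 1) (hLp : 1 ≤ Lp) (hB : 7 / 10 / √(d : ℝ) ≤ B)
    (hB1 : B ≤ 1 - γ / 2) (hB' : B' ≤ (1 + γ / 16) * B) (hS : 0 < S) (hS1 : S ≤ 1)
    (hsl : SlopeFrom f (9 / 10 * B) S) :
    ∃ φ : Phase f d σ (1 - γ / 4) Lp B B',
      (φ.N : ℝ) ≤ 2 / rateConst σ (γ / 16) ^ 2 * (d ^ 2 * Lp ^ 2 * (B ^ 2 / S ^ 2)) := by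
  set ρ := γ / 16 with hρ_def
  have hρ : 0 < ρ := by positivity
  have hρ1 : ρ ≤ 1 / 160 := by rw [hρ_def]; linarith
  have hγρ : γ = 16 * ρ := by rw [hρ_def]; ring
  have hd2 : (2 : ℝ) ≤ d := by exact_mod_cast hd
  have hq0 : 0 < √(d : ℝ) := Real.sqrt_pos.2 (by linarith)
  have hqq : √(d : ℝ) * √(d : ℝ) = d := Real.mul_self_sqrt (by linarith)
  have hq1 : 1.4 ≤ √(d : ℝ) := Real.le_sqrt_of_sq_le (by norm_num; linarith)
  have hB0 : 0 < B := lt_of_lt_of_le (by positivity) hB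
  have hqB : 7 / 10 ≤ √(d : ℝ) * B := by
    rw [div_le_iff₀ hq0] at hB; linarith
  have hdB : 98 / 100 ≤ d * B := by
    rw [← hqq, mul_assoc]; nlinarith
  have hdB2 : 49 / 100 ≤ d * (B * B) := by
    rw [← hqq, show √(d : ℝ) * √(d : ℝ) * (B * B) = (√(d : ℝ) * B) * (√(d : ℝ) * B) by ring]
    nlinarith
  have hw : 0 < 1 / B := by positivity
  have hκ := rateConst_pos hσ hρ
  have hκ1 := rateConst_le hσ hσ1 hρ (by linarith)
  have ha := driftRate_pos (d := d) (Lp := Lp) hd hσ hρ hLp hS hw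
  have hb := shrinkRate_pos (d := d) (Lp := Lp) hd hσ hρ hLp hS hw
  have hba := shrinkRate_le (d := d) (Lp := Lp) hd hσ hρ hLp hS hw
  have hab := driftRate_add_shrinkRate_le (d := d) (Lp := Lp) hd hσ hσ1 hρ (by linarith) hLp hS hS1
    hw (by rw [div_le_iff₀ hB0]; linarith)
  have hrate := phaseRate_le (d := d) (Lp := Lp) hd hσ hρ hLp hS hw (dev := ρ * B) (by positivity) (by
    rw [mul_one_div, div_le_iff₀ hB0]
    have : ρ * (49 / 100) ≤ ρ * (d * (B * B)) := by gcongr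
    linarith)
  have hbe := shrinkRate_phaseRate (d := d) (Lp := Lp) (σ := σ) (ρ := ρ) (S := S) (w := 1 / B) hd hLp
  have hα := phaseRate_pos (d := d) (Lp := Lp) hd hσ hρ hLp hS hw
  generalize phaseRate d σ ρ Lp S (1 / B) = α at *
  set a := driftRate d σ S α
  set b := shrinkRate α
  have hfix : B * (a + b) ≤ a := by
    have h1 : B * b ≤ B * (a * (ρ / 4 * (1 / B))) := by gcongr
    have h2 : B * (a * (ρ / 4 * (1 / B))) = a * (ρ / 4) := by field_simp
    have h3 : a * (B + ρ / 4) ≤ a * 1 := by gcongr; linarith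
    linarith
  have hN : 2 / (a + b) ≤ (⌈2 / (a + b)⌉₊ : ℝ) := Nat.le_ceil _
  have hN2 : 2 ≤ (⌈2 / (a + b)⌉₊ : ℝ) * (a + b) := by
    rwa [div_le_iff₀ (by positivity)] at hN
  have hlift := le_driftIter_of_two_le ha hb hab hfix hN2 (R := ρ / 4 * (1 / B)) (by positivity) hba
  refine ⟨{ N := ⌈2 / (a + b)⌉₊, dev := ρ * B, α := α, S := S, p := 9 / 10 * B,
            N_pos := Nat.ceil_pos.2 (by positivity), dev_pos := by positivity, α_pos := hα
            S_pos := hS, S_le := hS1, p_nonneg := by positivity, slope := hsl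
            rate_le := hrate, sum_le_one := hab, fixpoint := hfix
            lift := ?_, low := ?_, p_le := ?_ }, ?_⟩
  -- Since B ≤ 1 - 8 ρ, the mean curve ends above (1 + 2 ρ) B: one ρ B is the growth of the level,
  -- the other covers the deviation.
  · have h1 : (3 / 4 + 2 * ρ) * B ≤ 3 / 4 / (1 + ρ / 4 * (1 / B)) := by
      rw [le_div_iff₀ (by positivity)]
      have e : (3 / 4 + 2 * ρ) * B * (1 + ρ / 4 * (1 / B)) = (3 / 4 + 2 * ρ) * (B + ρ / 4) := by
        field_simp
      rw [e]
      have : (3 / 4 + 2 * ρ) * (B + ρ / 4) ≤ (3 / 4 + 2 * ρ) * (1 - 7 * ρ) := by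
        gcongr; linarith
      have h2 : (3 / 4 + 2 * ρ) * (1 - 7 * ρ) = 3 / 4 - ρ * (13 / 4 + 14 * ρ) := by ring
      have h3 : 0 ≤ ρ * (13 / 4 + 14 * ρ) := by positivity
      linarith
    linarith
  · have : 1 / (2 * √(d : ℝ)) = 5 / 7 * (7 / 10 / √(d : ℝ)) := by field_simp; norm_num
    have h2 : ρ * B ≤ 1 / 160 * B := by gcongr
    linarith
  · have e : (1 - γ / 4) * (B - ρ * B) = B * (1 - 5 * ρ + 4 * ρ ^ 2) := by rw [hγρ]; ring
    rw [e, mul_comm]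
    gcongr
    have := sq_nonneg ρ
    linarith
  · have hD := one_le_noiseConst
    have h1 : (⌈2 / (a + b)⌉₊ : ℝ) ≤ 2 / (a + b) + 1 := (Nat.ceil_lt_add_one (by positivity)).le
    -- Dividing by b rather than a yields the power B², which is what the burn-in integral controls;
    -- 2 / a would give only the first power of B.
    have h2 : 2 / (a + b) ≤ 2 / b := by gcongr; linarith
    have h3 : 2 / b ≤ 1 / rateConst σ ρ ^ 2 * (d ^ 2 * Lp ^ 2 * (B ^ 2 / S ^ 2)) := by
      have e : 2 / b = 2 / (13 * noiseConst) *
          (1 / rateConst σ ρ ^ 2 * (d ^ 2 * Lp ^ 2 * (B ^ 2 / S ^ 2))) := by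
        rw [hbe]; field_simp
      rw [e]
      refine mul_le_of_le_one_left (by positivity) ?_
      rw [div_le_one (by positivity)]; linarith
    have h4 : 1 ≤ 1 / rateConst σ ρ ^ 2 * (d ^ 2 * Lp ^ 2 * (B ^ 2 / S ^ 2)) := by
      have h5 : 2 ≤ 1 / rateConst σ ρ ^ 2 := by
        have : rateConst σ ρ ^ 2 ≤ (1 / 400) ^ 2 := by gcongr
        rw [le_div_iff₀ (by positivity)]; linarith
      have h6 : (98 / 100) ^ 2 ≤ (d * B) ^ 2 := by gcongr
      have h7 : 1 ≤ Lp ^ 2 / S ^ 2 := by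
        rw [one_le_div (by positivity)]; gcongr; linarith
      have e : (d : ℝ) ^ 2 * Lp ^ 2 * (B ^ 2 / S ^ 2) = (d * B) ^ 2 * (Lp ^ 2 / S ^ 2) := by
        field_simp
      rw [e]
      have h8 := mul_le_mul h5 (mul_le_mul h6 h7 zero_le_one (by positivity)) (by norm_num)
        (by positivity)
      linarith
    have e2 : 2 / rateConst σ ρ ^ 2 * (d ^ 2 * Lp ^ 2 * (B ^ 2 / S ^ 2))
        = 2 * (1 / rateConst σ ρ ^ 2 * (d ^ 2 * Lp ^ 2 * (B ^ 2 / S ^ 2))) := by ring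
    linarith

/-- A phase that halves the distance to the optimum. -/
theorem exists_late_phase {f : ℝ → ℝ} {d : ℕ} (hd : 2 ≤ d) {σ γ Lp E S : ℝ} (hγ : 0 < γ)
    (hγ1 : γ ≤ 1 / 10) (hσ : 0 < σ) (hσ1 : σ ≤ 1) (hLp : 1 ≤ Lp) (hE : 0 < E)
    (hE1 : E ≤ γ / 2) (hS : 0 < S) (hS1 : S ≤ 1) (hsl : SlopeFrom f (1 - γ) S) :
    ∃ φ : Phase f d σ (1 - γ / 4) Lp (1 - E) (1 - E / 2),
      φ.dev = E / 8 ∧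
      (φ.N : ℝ) ≤ 9 / (rateConst σ (γ / 16) * σ * S ^ 2) * (d ^ 2 * Lp) / E := by
  set ρ := γ / 16 with hρ_def
  have hρ : 0 < ρ := by positivity
  have hρ1 : ρ ≤ 1 / 160 := by rw [hρ_def]; linarith
  have hγρ : γ = 16 * ρ := by rw [hρ_def]; ring
  have hd2 : (2 : ℝ) ≤ d := by exact_mod_cast hd
  have hq0 : 0 < √(d : ℝ) := Real.sqrt_pos.2 (by linarith)
  have hq1 : 1.4 ≤ √(d : ℝ) := Real.le_sqrt_of_sq_le (by norm_num; linarith)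
  have hκ := rateConst_pos hσ hρ
  have hκ1 := rateConst_le hσ hσ1 hρ (by linarith)
  have ha := driftRate_pos (d := d) (Lp := Lp) hd hσ hρ hLp hS hE
  have hb := shrinkRate_pos (d := d) (Lp := Lp) hd hσ hρ hLp hS hE
  have hba := shrinkRate_le (d := d) (Lp := Lp) hd hσ hρ hLp hS hE
  have hab := driftRate_add_shrinkRate_le (d := d) (Lp := Lp) hd hσ hσ1 hρ (by linarith) hLp hS hS1
    hE (by linarith)
  have hrate := phaseRate_le (d := d) (Lp := Lp) hd hσ hρ hLp hS hE (dev := E / 8) (by positivity) (by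
    nlinarith)
  have hae := driftRate_phaseRate (d := d) (Lp := Lp) (σ := σ) (ρ := ρ) (S := S) (w := E) hd hLp
  have hα := phaseRate_pos (d := d) (Lp := Lp) hd hσ hρ hLp hS hE
  generalize phaseRate d σ ρ Lp S E = α at *
  set a := driftRate d σ S α
  set b := shrinkRate α
  have hfix : (1 - E) * (a + b) ≤ a := by
    have h1 : (1 - E) * (a + b) ≤ (1 - E) * (a + a * (ρ / 4 * E)) := by gcongr; linarith
    have h2 : (1 - E) * (a + a * (ρ / 4 * E)) = a - a * E * (1 - ρ / 4 + ρ / 4 * E) := by ring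
    have h3 : 0 ≤ a * E * (1 - ρ / 4 + ρ / 4 * E) :=
      mul_nonneg (by positivity) (by nlinarith [mul_pos hρ hE])
    linarith
  have hN : 2 / (a + b) ≤ (⌈2 / (a + b)⌉₊ : ℝ) := Nat.le_ceil _
  have hN2 : 2 ≤ (⌈2 / (a + b)⌉₊ : ℝ) * (a + b) := by
    rwa [div_le_iff₀ (by positivity)] at hN
  have hlift := le_driftIter_of_two_le ha hb hab hfix hN2 (R := ρ / 4 * E) (by positivity) hba
  refine ⟨{ N := ⌈2 / (a + b)⌉₊, dev := E / 8, α := α, S := S, p := 1 - γ,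
            N_pos := Nat.ceil_pos.2 (by positivity), dev_pos := by positivity, α_pos := hα
            S_pos := hS, S_le := hS1, p_nonneg := by linarith, slope := hsl
            rate_le := hrate, sum_le_one := hab, fixpoint := hfix
            lift := ?_, low := ?_, p_le := ?_ }, rfl, ?_⟩
  · have h1 : 3 / 4 * (1 - ρ / 4 * E) ≤ 3 / 4 / (1 + ρ / 4 * E) := by
      rw [le_div_iff₀ (by positivity)]
      nlinarith [sq_nonneg (ρ / 4 * E)]
    nlinarith [mul_pos hρ hE]
  · have : 1 / (2 * √(d : ℝ)) ≤ 1 / 2 := by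
      apply one_div_le_one_div_of_le <;> linarith
    linarith
  · nlinarith [mul_pos hγ hE]
  · have h1 : (⌈2 / (a + b)⌉₊ : ℝ) ≤ 2 / (a + b) + 1 := (Nat.ceil_lt_add_one (by positivity)).le
    -- With w = E small the drift is the larger of the two rates, and 2 / a is of order d² Lp / E.
    have h2 : 2 / (a + b) ≤ 2 / a := by gcongr; linarith
    have h3 : 2 / a = 8 * ((d : ℝ) ^ 2 * Lp / (rateConst σ ρ * σ * S ^ 2 * E)) := by
      rw [hae]; field_simp; norm_num
    have h4 : 1 ≤ (d : ℝ) ^ 2 * Lp / (rateConst σ ρ * σ * S ^ 2 * E) := by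
      rw [one_le_div (by positivity)]
      have h5 : rateConst σ ρ * σ * S ^ 2 * E ≤ 1 * 1 * 1 ^ 2 * 1 := by
        gcongr <;> linarith
      have h6 : (1 : ℝ) * 1 ≤ (d : ℝ) ^ 2 * Lp := by gcongr; nlinarith
      linarith
    have e2 : 9 / (rateConst σ ρ * σ * S ^ 2) * (d ^ 2 * Lp) / E
        = 9 * ((d : ℝ) ^ 2 * Lp / (rateConst σ ρ * σ * S ^ 2 * E)) := by field_simp
    linarith

/-- The number of steps after which the correlation has reached a constant. -/
def burnInLength (d : ℕ) (σ γ Lp W : ℝ) : ℝ :=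
  6 / (γ / 16 * rateConst σ (γ / 16) ^ 2) * (d ^ 2 * Lp ^ 3 * W)

/-- The constant in the convergence rate. -/
def lateConst (σ γ S : ℝ) : ℝ := 21 / (rateConst σ (γ / 16) * σ * S ^ 2)

/-- Levels grow geometrically up to 1 - γ/2, after which the error is halved repeatedly. The bounds
on the late phases double, so the time elapsed since the burn-in is at most a multiple of the bound
for the current phase, and error times time stays of order d² Lp. -/
theorem exists_schedule {f : ℝ → ℝ} {d : ℕ} (hd : 2 ≤ d) {σ γ Lp W S₁ : ℝ} (hγ : 0 < γ)
    (hγ1 : γ ≤ 1 / 10) (hσ : 0 < σ) (hσ1 : σ ≤ 1) (hLp : 1 ≤ Lp) (hLpd : (d : ℝ) + 1 ≤ Real.exp Lp)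
    (hW : ∀ B, 7 / 10 / √(d : ℝ) ≤ B → B ≤ 1 →
      ∃ S, 0 < S ∧ S ≤ 1 ∧ SlopeFrom f (9 / 10 * B) S ∧ B ^ 2 / S ^ 2 ≤ W)
    (hS₁ : 0 < S₁) (hS₁1 : S₁ ≤ 1) (hsl : SlopeFrom f (1 - γ) S₁) :
    ∃ (B : ℕ → ℝ) (φ : ∀ i, Phase f d σ (1 - γ / 4) Lp (B i) (B (i + 1))),
      B 0 ≤ 7 / 10 / √(d : ℝ) ∧ ∀ i k, k < (φ i).N →
        burnInLength d σ γ Lp W ≤ ((phaseStart (fun i => (φ i).N) i + k : ℕ) : ℝ) →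
        1 - γ ≤ B i - (φ i).dev ∧
        (1 - (B i - (φ i).dev)) *
          (((phaseStart (fun i => (φ i).N) i + k : ℕ) : ℝ) - burnInLength d σ γ Lp W)
          ≤ lateConst σ γ S₁ * (d ^ 2 * Lp) := by
  have hd2 : (2 : ℝ) ≤ d := by exact_mod_cast hd
  have hq0 : 0 < √(d : ℝ) := Real.sqrt_pos.2 (by linarith)
  have hqq : √(d : ℝ) * √(d : ℝ) = d := Real.mul_self_sqrt (by linarith)
  have hq1 : 1.4 ≤ √(d : ℝ) := Real.le_sqrt_of_sq_le (by norm_num; linarith)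
  set ρ := γ / 16 with hρ_def
  have hρ : 0 < ρ := by positivity
  have hκ := rateConst_pos hσ hρ
  set x := 7 / 10 / √(d : ℝ) with hx
  have hx0 : 0 < x := by positivity
  have hx1 : x ≤ 1 - γ / 2 := by
    rw [hx, div_le_iff₀ hq0]; nlinarith
  -- As exp(ρ/2) ≤ 1 + ρ, J phases multiply the level by at least exp Lp ≥ d + 1, enough to climb
  -- from x to 1 - γ/2.
  set J := ⌈2 * Lp / ρ⌉₊ with hJ
  have hJ0 : 0 < J := Nat.ceil_pos.2 (by positivity)
  have hJle : (J : ℝ) ≤ 3 * Lp / ρ := by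
    have h1 : (J : ℝ) ≤ 2 * Lp / ρ + 1 := (Nat.ceil_lt_add_one (by positivity)).le
    have h2 : 1 ≤ Lp / ρ := by
      rw [one_le_div hρ, hρ_def]; linarith
    have e : 3 * Lp / ρ = 2 * Lp / ρ + Lp / ρ := by ring
    linarith
  have hJpow : 1 - γ / 2 ≤ (1 + ρ) ^ J * x := by
    have h1 : Real.exp Lp ≤ (1 + ρ) ^ J := by
      have h2 : Real.exp (ρ / 2) ≤ 1 + ρ := by
        have := Real.exp_bound_div_one_sub_of_interval (x := ρ / 2) (by positivity)
          (by rw [hρ_def]; linarith)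
        refine this.trans ?_
        rw [div_le_iff₀ (by rw [hρ_def]; linarith)]
        nlinarith
      calc Real.exp Lp ≤ Real.exp (J * (ρ / 2)) := by
            apply Real.exp_le_exp.2
            have := Nat.le_ceil (2 * Lp / ρ)
            rw [div_le_iff₀ hρ] at this
            linarith
        _ = Real.exp (ρ / 2) ^ J := Real.exp_nat_mul _ _
        _ ≤ _ := pow_le_pow_left₀ (Real.exp_nonneg _) h2 J
    have h3 : (d + 1) * x ≤ (1 + ρ) ^ J * x := by gcongr; linarith
    have h4 : 1 ≤ (d + 1) * x := by
      rw [hx, mul_div_assoc', one_le_div hq0]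
      nlinarith [sq_nonneg (√(d : ℝ) - 1)]
    linarith
  set E : ℕ → ℝ := fun j => γ / 2 * (1 / 2) ^ j with hE
  have hE0 : ∀ j, 0 < E j := fun j => by positivity
  have hE1 : ∀ j, E j ≤ γ / 2 := fun j =>
    mul_le_of_le_one_right (by positivity) (pow_le_one₀ (by norm_num) (by norm_num))
  have hEs : ∀ j, E (j + 1) = E j / 2 := fun j => by simp only [hE, pow_succ]; ring
  set B : ℕ → ℝ := fun i => if i < J then min ((1 + ρ) ^ i * x) (1 - γ / 2) else 1 - E (i - J) with hB
  set K₁ := 2 / rateConst σ ρ ^ 2 * (d ^ 2 * Lp ^ 2 * W) with hK₁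
  set K₂ := 9 / (rateConst σ ρ * σ * S₁ ^ 2) * (d ^ 2 * Lp) with hK₂
  have hex : ∀ i, ∃ φ : Phase f d σ (1 - γ / 4) Lp (B i) (B (i + 1)),
      (i < J → (φ.N : ℝ) ≤ K₁) ∧
      (J ≤ i → B i = 1 - E (i - J) ∧ φ.dev = E (i - J) / 8 ∧ (φ.N : ℝ) ≤ K₂ / E (i - J)) := by
    intro i
    rcases lt_or_ge i J with hi | hi
    · have hBi : B i = min ((1 + ρ) ^ i * x) (1 - γ / 2) := if_pos hi
      have h1 : x ≤ B i := by
        rw [hBi]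
        exact le_min (le_mul_of_one_le_left hx0.le (one_le_pow₀ (by linarith))) hx1
      have h2 : B i ≤ 1 - γ / 2 := hBi ▸ min_le_right _ _
      have h3 : (1 + ρ) * B i = min ((1 + ρ) ^ (i + 1) * x) ((1 + ρ) * (1 - γ / 2)) := by
        rw [hBi, mul_min_of_nonneg _ _ (by positivity)]; ring_nf
      have h5 : 1 - γ / 2 ≤ (1 + ρ) * (1 - γ / 2) := le_mul_of_one_le_left (by linarith) (by linarith)
      have h4 : B (i + 1) ≤ (1 + ρ) * B i := by
        rw [h3]
        rcases lt_or_ge (i + 1) J with hi' | hi'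
        · rw [show B (i + 1) = min ((1 + ρ) ^ (i + 1) * x) (1 - γ / 2) from if_pos hi']
          exact min_le_min_left _ h5
        · have hJi : J = i + 1 := by omega
          rw [show B (i + 1) = 1 - E (i + 1 - J) from if_neg (by omega), ← hJi]
          have : E (J - J) = γ / 2 := by simp [hE]
          rw [this]
          exact le_min hJpow h5
      obtain ⟨S, hS, hS1, hslS, hSW⟩ := hW (B i) h1 (by linarith)
      obtain ⟨φ, hφ⟩ := exists_burnIn_phase hd hγ hγ1 hσ hσ1 hLp h1 h2 h4 hS hS1 hslS
      refine ⟨φ, fun _ => hφ.trans ?_, fun h => by omega⟩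
      rw [hK₁]; gcongr
    · have hBi : B i = 1 - E (i - J) := if_neg (by omega)
      have hBi' : B (i + 1) = 1 - E (i - J) / 2 := by
        rw [← hEs, show i - J + 1 = i + 1 - J by omega]
        exact if_neg (by omega)
      obtain ⟨φ, hφ1, hφ2⟩ := exists_late_phase hd hγ hγ1 hσ hσ1 hLp (hE0 (i - J)) (hE1 (i - J))
        hS₁ hS₁1 hsl
      rw [hBi, hBi']
      exact ⟨φ, fun h => by omega, fun _ => ⟨rfl, hφ1, hφ2⟩⟩
  choose φ hφ1 hφ2 using hex
  have hK₁0 : 0 ≤ K₁ := le_trans (Nat.cast_nonneg _) (hφ1 0 hJ0)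
  have hTb : J * K₁ ≤ burnInLength d σ γ Lp W := by
    have e : burnInLength d σ γ Lp W = 3 * Lp / ρ * K₁ := by
      rw [hK₁, burnInLength, ← hρ_def]; field_simp; ring
    rw [e]; gcongr
  set s := phaseStart (fun i => (φ i).N) with hs
  have hsum : ∀ i ≤ J, (s i : ℝ) ≤ i * K₁ := by
    intro i
    induction i with
    | zero => intro; simp [hs, phaseStart]
    | succ i ih =>
      intro hi
      have h1 := ih (by omega)
      have h2 := hφ1 i (by omega)
      rw [hs, phaseStart_succ]
      push_cast
      linarith
  -- A geometric sum: the length of late phase j is at most K₂ / E j, exactly the increase from K₂ /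
  -- E j to K₂ / E (j + 1).
  have hlate : ∀ j, (s (J + j) : ℝ) ≤ burnInLength d σ γ Lp W + K₂ / E j := by
    intro j
    induction j with
    | zero =>
      have : 0 ≤ K₂ / E 0 := by
        have := hE0 0
        positivity
      exact (hsum J le_rfl).trans (by linarith)
    | succ j ih =>
      have h2 := (hφ2 (J + j) (by omega)).2.2
      rw [Nat.add_sub_cancel_left] at h2
      rw [← add_assoc, hs, phaseStart_succ, hEs]
      push_cast
      have h3 : K₂ / (E j / 2) = K₂ / E j + K₂ / E j := by ring
      linarith
  refine ⟨B, φ, ?_, fun i k hk hn => ?_⟩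
  · rw [show B 0 = min ((1 + ρ) ^ 0 * x) (1 - γ / 2) from if_pos hJ0]
    simp
  · have hi : J ≤ i := by
      by_contra hcon
      have h1 : s i + k + 1 ≤ s J := by
        have h2 := phaseStart_mono (fun i => (φ i).N) (show i + 1 ≤ J by omega)
        rw [phaseStart_succ, ← hs] at h2
        omega
      have h3 : ((s i + k : ℕ) : ℝ) + 1 ≤ s J := by exact_mod_cast h1
      linarith [hsum J le_rfl]
    obtain ⟨j, rfl⟩ := Nat.exists_eq_add_of_le hi
    obtain ⟨h1, h2, h3⟩ := hφ2 (J + j) hi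
    rw [Nat.add_sub_cancel_left] at h1 h2 h3
    have hk' : (k : ℝ) ≤ K₂ / E j := le_trans (by exact_mod_cast hk.le) h3
    have hEj := hE0 j
    have h4 : B (J + j) - (φ (J + j)).dev = 1 - E j - E j / 8 := by linarith
    rw [h4]
    refine ⟨by linarith [hE1 j], ?_⟩
    calc (1 - (1 - E j - E j / 8)) * (((s (J + j) + k : ℕ) : ℝ) - burnInLength d σ γ Lp W)
        ≤ 9 / 8 * E j * (2 * (K₂ / E j)) := by
          have : 1 - (1 - E j - E j / 8) = 9 / 8 * E j := by ring
          rw [this]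
          gcongr
          push_cast
          linarith [hlate j]
      -- The constant is 9/8 · 2 · 9 = 81/4, which is below the 21 of `lateConst`.
      _ = 81 / 4 / (rateConst σ ρ * σ * S₁ ^ 2) * (d ^ 2 * Lp) := by
          rw [hK₂]; field_simp; norm_num
      _ ≤ _ := by unfold lateConst; gcongr; norm_num

/-! ### A run follows its schedule -/

section Run

variable {d : ℕ} {Ω : Type*} [mΩ : MeasurableSpace Ω] [StandardBorelSpace Ω]
  {P : Procedure} {f : ℝ → ℝ} {θs : Vec d} {μ : Measure Ω} [IsProbabilityMeasure μ]
  {ℱ : Filtration ℕ mΩ} {cand z θ a : ℕ → Ω → Vec d} {r : ℕ → Ω → ℝ}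

/-- With high probability, SGD with the learning rates of a schedule follows this schedule. -/
theorem IsRun.measure_not_follows_le (h : IsRun P f θs μ ℱ cand z θ a r) (hd : 2 ≤ d)
    (hf : MonotoneOn f (Set.Icc (-1) 1)) (hfb : ∀ x ∈ Set.Icc (-1 : ℝ) 1, |f x| ≤ 1)
    (hθs : ‖θs‖ = 1) {σ lam Lp : ℝ} {B : ℕ → ℝ} (φ : ∀ i, Phase f d σ lam Lp (B i) (B (i + 1)))
    (hσ : 0 < σ) (hσ1 : σ ≤ 1) (hlam : √(1 - σ ^ 2) = lam) (hLp : 0 ≤ Lp)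
    (hPσ : ∀ s, P.σ s = σ)
    (hPα : ∀ s, P.rate f s = (φ (phaseOf (fun i => (φ i).N) s)).α) {H : ℕ}
    (hH : P.initLength ≤ H) :
    μ ({ω | B 0 ≤ ⟪θs, θ P.initLength ω⟫} \ {ω | ∀ i k, k < (φ i).N →
        P.initLength + phaseStart (fun i => (φ i).N) i + k < H →
        B i - (φ i).dev ≤ ⟪θs, θ (P.initLength + phaseStart (fun i => (φ i).N) i + k) ω⟫}) ≤
      ((2 * (H - P.initLength) : ℕ) : ℝ≥0∞) * ENNReal.ofReal (Real.exp (-Lp)) := by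
  have hY : ∀ t, Measurable[ℱ t] fun ω => ⟪θs, θ t ω⟫ := fun t =>
    (measurable_const.inner measurable_id).comp (h.θ_meas t)
  have hd0 : (0 : ℝ) < d := by exact_mod_cast (by omega : 0 < d)
  set N := fun i => (φ i).N with hN
  have h0 : phaseStart N 0 = 0 := by simp [phaseStart]
  have key := measure_not_above_le (μ := μ) hY (τ := fun i => P.initLength + phaseStart N i) (N := N)
    (fun i => by rw [phaseStart_succ, add_assoc]) (fun i => (φ i).N_pos) (B := B)
    (a := fun i => driftRate d σ (φ i).S (φ i).α) (b := fun i => shrinkRate (φ i).α)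
    (dev := fun i => (φ i).dev) (Lp := Lp)
    (fun i => by
      have := (φ i).α_pos
      have := (φ i).S_pos
      unfold driftRate; positivity)
    (fun i => by
      have := one_le_noiseConst
      unfold shrinkRate; positivity)
    (fun i => (φ i).sum_le_one) (fun i => (φ i).dev_pos) hLp (fun i => (φ i).fixpoint)
    (fun i => (φ i).lift)
    (fun i n hn ℓ hℓ hℓ1 A hA hAB => by
      have hsub : P.initLength + phaseStart N i + n - P.initLength = phaseStart N i + n := by omega
      have hB0 : 0 ≤ B i - (φ i).dev := le_trans (by positivity) (φ i).low
      have hlam0 : 0 ≤ lam := hlam ▸ Real.sqrt_nonneg _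
      refine h.lintegral_step_le hd hf hfb hθs (by omega) (hPσ _) ?_ hlam hσ hσ1 hℓ (φ i).α_pos.le
        (φ i).slope (φ i).p_nonneg (φ i).S_pos (φ i).S_le ?_ hA
        (fun ω hω => (φ i).low.trans (hAB ω hω))
        (fun ω hω => (φ i).p_le.trans (mul_le_mul_of_nonneg_left (hAB ω hω) hlam0))
      · rw [hsub, hPα, phaseOf_add N hn]
      · refine le_trans ?_ (φ i).rate_le
        have := one_le_noiseConst
        have := (φ i).α_pos
        gcongr)
    (G := {ω | B 0 ≤ ⟪θs, θ P.initLength ω⟫})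
    (by
      rw [h0]
      exact measurableSet_le measurable_const (hY P.initLength))
    (fun ω hω => by
      rw [h0]
      exact hω) (H := H) (by simpa only [h0, add_zero] using hH)
  simpa only [h0, add_zero] using key

end Run

/-! ### Error probability, choice of the parameters and convergence rate -/

theorem Procedure.numCandidates_le_initLength (P : Procedure) (h : 0 < P.numPlays) :
    P.numCandidates ≤ P.initLength := Nat.le_mul_of_pos_right _ h

/-- The error probability of the whole run. -/
theorem failure_le {d : ℕ} {δ : ℝ} (hδ : 0 < δ) {T M n : ℕ} (hT : T * δ ≤ 1) (hMn : M ≤ n)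
    (hn : n ≤ T) :
    ((2 * M + 1 : ℕ) : ℝ≥0∞) * ENNReal.ofReal (Real.exp (-(3 * Real.log (3 + d + 1 / δ)))) +
      ((2 * (T + 1 - n) : ℕ) : ℝ≥0∞) *
        ENNReal.ofReal (Real.exp (-(3 * Real.log (3 + d + 1 / δ)))) ≤ ENNReal.ofReal δ := by
  set X := 3 + d + 1 / δ with hX
  have hδ' : 0 < 1 / δ := by positivity
  have hd : (0 : ℝ) ≤ d := Nat.cast_nonneg _
  have hX3 : 3 ≤ X := by linarith
  have e : Real.exp (-(3 * Real.log X)) = 1 / X ^ 3 := by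
    rw [Real.exp_neg, show 3 * Real.log X = ((3 : ℕ) : ℝ) * Real.log X by norm_num,
      Real.exp_nat_mul, Real.exp_log (by linarith), one_div]
  rw [← add_mul, e]
  have h1 : ((2 * M + 1 : ℕ) : ℝ≥0∞) + ((2 * (T + 1 - n) : ℕ) : ℝ≥0∞) ≤ ((2 * T + 3 : ℕ) : ℝ≥0∞) := by
    exact_mod_cast (by omega : 2 * M + 1 + 2 * (T + 1 - n) ≤ 2 * T + 3)
  -- At most 2 T + 3 ≤ 2 X events of probability X⁻³ each; X δ ≥ 1 then gives the bound δ.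
  have hT' : (T : ℝ) ≤ 1 / δ := by rwa [le_div_iff₀ hδ]
  have h2 : (1 : ℝ) ≤ X * δ := by
    have : 1 / δ * δ = 1 := by field_simp
    nlinarith
  calc _ ≤ ((2 * T + 3 : ℕ) : ℝ≥0∞) * ENNReal.ofReal (1 / X ^ 3) := by gcongr
    _ = ENNReal.ofReal ((2 * T + 3 : ℕ) * (1 / X ^ 3)) := by
      rw [ENNReal.ofReal_mul (Nat.cast_nonneg _), ENNReal.ofReal_natCast]
    _ ≤ ENNReal.ofReal δ := by
      apply ENNReal.ofReal_le_ofReal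
      rw [mul_one_div, div_le_iff₀ (by positivity)]
      push_cast
      calc 2 * (T : ℝ) + 3 ≤ 2 * X := by linarith
        _ ≤ X * X := by gcongr; linarith
        _ ≤ X * X * (X * δ) := le_mul_of_one_le_right (by positivity) h2
        _ = _ := by ring

theorem one_le_log_of_three_le {x : ℝ} (hx : 3 ≤ x) : 1 ≤ Real.log x := by
  rw [Real.le_log_iff_exp_le (by linarith)]
  linarith [Real.exp_one_lt_d9]

set_option maxHeartbeats 800000 in
/-- Convergence of SGD: on the horizon `1 / δ`, a procedure that knows only `δ` has, after a burn-in
time, error `d² / t` in round `t`. -/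
theorem exists_procedure {γ₀ γ₁ γ₂ c₀ : ℝ} (hγ₀ : 0 < γ₀) (hγ₀' : γ₀ ≤ 1 / 10) (hγ₁ : 0 < γ₁)
    (hc₀ : 0 < c₀) :
    ∃ K : ℝ, 1 ≤ K ∧ ∀ d : ℕ, 2 ≤ d → ∀ f : ℝ → ℝ, IsLink f γ₀ γ₁ γ₂ →
      (HasDerivLowerBound f c₀ ∨ ConvexOn ℝ (Set.Icc 0 1) f) →
      burnInIntegral f d (1 - γ₀ / 2) ≠ ∞ → ∀ δ : ℝ, 0 < δ → ∃ P : Procedure,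
        ∀ T : ℕ, T * δ ≤ 1 → ∀ θs : Vec d, ‖θs‖ = 1 →
        ∀ (Ω : Type*) [mΩ : MeasurableSpace Ω] [StandardBorelSpace Ω]
          (μ : Measure Ω) [IsProbabilityMeasure μ] (ℱ : Filtration ℕ mΩ)
          (cand z θ a : ℕ → Ω → Vec d) (r : ℕ → Ω → ℝ), IsRun P f θs μ ℱ cand z θ a r →
          1 - δ ≤ μ.real {ω | ∀ t ≤ T,
            K * Real.log (3 + d + 1 / δ) ^ 3 *
              (d ^ 2 * ((burnInIntegral f d (1 - γ₀ / 2)).toReal + 1)) ≤ t →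
            1 - γ₀ ≤ ⟪θs, θ t ω⟫ ∧
            (1 - ⟪θs, θ t ω⟫) * t ≤ K * Real.log (3 + d + 1 / δ) * d ^ 2} := by
  -- Constant exploration, with lam inside the range where f is locally linear. Also lam times a
  -- late level remains above 1 - γ₀.
  set lam := 1 - γ₀ / 4 with hlam
  set σ := √(1 - lam ^ 2) with hσ_def
  have hlam0 : 0 < lam := by rw [hlam]; linarith
  have hlam1 : lam < 1 := by rw [hlam]; linarith
  have hlamsq : 0 < 1 - lam ^ 2 := by nlinarith
  have hσ : 0 < σ := Real.sqrt_pos.2 hlamsq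
  have hσ1 : σ ≤ 1 := Real.sqrt_le_one.2 (by nlinarith)
  have hlamσ : √(1 - σ ^ 2) = lam := by
    rw [hσ_def, Real.sq_sqrt hlamsq.le, sub_sub_cancel, Real.sqrt_sq hlam0.le]
  set S₁ := min γ₁ 1 with hS₁_def
  have hS₁ : 0 < S₁ := lt_min hγ₁ one_pos
  have hκ := rateConst_pos hσ (by positivity : 0 < γ₀ / 16)
  set c := 1809 + 6 / (γ₀ / 16 * rateConst σ (γ₀ / 16) ^ 2) with hc_def
  have hc : 0 < c := by positivity
  set W₀ := 1601 + 25 / c₀ ^ 2 with hW₀_def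
  have hW₀ : 1601 ≤ W₀ := by
    have : 0 ≤ 25 / c₀ ^ 2 := by positivity
    linarith
  have hlate : 0 < lateConst σ γ₀ S₁ := by unfold lateConst; positivity
  refine ⟨54 * c * W₀ + 6 * lateConst σ γ₀ S₁, ?_, ?_⟩
  · have : 54 * 1809 * 1601 ≤ 54 * c * W₀ := by
      have : 1809 ≤ c := by
        have : 0 ≤ 6 / (γ₀ / 16 * rateConst σ (γ₀ / 16) ^ 2) := by positivity
        linarith
      gcongr
    linarith
  intro d hd f hf hA hI δ hδ
  set I := (burnInIntegral f d (1 - γ₀ / 2)).toReal with hI_def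
  have hI0 : 0 ≤ I := ENNReal.toReal_nonneg
  have hd2 : (2 : ℝ) ≤ d := by exact_mod_cast hd
  set X := 3 + d + 1 / δ with hX_def
  have hX : d + 3 ≤ X := by
    have : 0 < 1 / δ := by positivity
    linarith
  set L := Real.log X with hL_def
  have hL : 1 ≤ L := one_le_log_of_three_le (by linarith)
  set Lp := 3 * L with hLp_def
  have hLp : 1 ≤ Lp := by linarith
  set W := 1600 * I + 25 / c₀ ^ 2 + 1 with hW_def
  have hW1 : 1 ≤ W := by
    have : 0 ≤ 25 / c₀ ^ 2 := by positivity
    linarith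
  have hWle : W ≤ W₀ * (I + 1) := by
    have : 0 ≤ 25 / c₀ ^ 2 * I := by positivity
    have e : W₀ * (I + 1) = 1601 * I + 25 / c₀ ^ 2 * I + 1601 + 25 / c₀ ^ 2 := by
      rw [hW₀_def]; ring
    linarith
  have hLpd : (d : ℝ) + 1 ≤ Real.exp Lp := by
    calc (d : ℝ) + 1 ≤ X := by linarith
      _ = Real.exp L := (Real.exp_log (by linarith)).symm
      _ ≤ _ := Real.exp_le_exp.2 (by linarith)
  have hslopes : ∀ B, 7 / 10 / √(d : ℝ) ≤ B → B ≤ 1 →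
      ∃ S, 0 < S ∧ S ≤ 1 ∧ SlopeFrom f (9 / 10 * B) S ∧ B ^ 2 / S ^ 2 ≤ W := by
    intro B hB hB1
    obtain ⟨S, h1, h2, h3, h4⟩ := exists_slope hγ₀' hγ₀ hc₀ hd hf hA hI hB hB1
    refine ⟨S, h1, h2, h3, h4.trans ?_⟩
    have h5 : 1 / c₀ ^ 2 ≤ 25 / c₀ ^ 2 := by gcongr; norm_num
    linarith
  have hsl : SlopeFrom f (1 - γ₀) S₁ :=
    (slopeFrom_of_linkDeriv (by linarith) hf.differentiable
      (fun x hx => (hf.deriv_mem x hx).1)).mono le_rfl (min_le_left _ _)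
  obtain ⟨B, φ, hB0, hφ⟩ := exists_schedule hd hγ₀ hγ₀' hσ hσ1 hLp hLpd hslopes hS₁
    (min_le_right _ _) hsl
  obtain ⟨hΔ0, hΔ⟩ := exists_gap hγ₀' hγ₀ hc₀ hd hf hA hI
  set Δ := f (9 / 10 / √(d : ℝ)) - f (7 / 10 / √(d : ℝ)) with hΔ_def
  set N := fun i => (φ i).N with hN_def
  have hdlam : 0 < linkDeriv f lam :=
    hγ₁.trans_le (hf.deriv_mem lam ⟨by rw [hlam]; linarith, hlam1.le⟩).1
  set P : Procedure :=
    { numCandidates := ⌈200 * Lp⌉₊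
      numPlays := ⌈8 * Lp / Δ ^ 2⌉₊
      threshold := (f (9 / 10 / √(d : ℝ)) + f (7 / 10 / √(d : ℝ))) / 2
      -- Dividing by f'(lam) σ makes the effective rate equal to the rate of the phase; f'(lam) ≥ γ₁
      -- > 0.
      η := fun s => (φ (phaseOf N s)).α / (linkDeriv f lam * σ)
      σ := fun _ => σ
      η_pos := fun s => div_pos (φ _).α_pos (by positivity)
      σ_mem := fun _ => ⟨hσ.le, hσ1⟩ } with hP
  have hPα : ∀ s, P.rate f s = (φ (phaseOf N s)).α := by
    intro s
    show (φ (phaseOf N s)).α / (linkDeriv f lam * σ) * linkDeriv f √(1 - σ ^ 2) * σ = _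
    rw [hlamσ]
    field_simp
  have hplays : 0 < P.numPlays := Nat.ceil_pos.2 (by positivity)
  have hinit : (P.initLength : ℝ) ≤ 1809 * (d ^ 2 * Lp ^ 3 * W) := by
    have h1 : (P.numCandidates : ℝ) ≤ 201 * Lp :=
      (Nat.ceil_lt_add_one (by positivity)).le.trans (by linarith)
    have h2 : (P.numPlays : ℝ) ≤ 9 * (d ^ 2 * Lp * W) := by
      refine (Nat.ceil_lt_add_one (by positivity)).le.trans ?_
      have h3 : 8 * Lp / Δ ^ 2 ≤ 8 * Lp * (d ^ 2 * W) := by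
        rw [div_eq_mul_one_div]
        gcongr
        exact hΔ.trans (by gcongr; linarith)
      have h4 : (1 : ℝ) * 1 * 1 ≤ d ^ 2 * Lp * W := by gcongr; nlinarith
      linarith
    calc (P.initLength : ℝ) = P.numCandidates * P.numPlays := by
          exact_mod_cast (rfl : P.initLength = P.numCandidates * P.numPlays)
      _ ≤ 201 * Lp * (9 * (d ^ 2 * Lp * W)) := by gcongr
      _ = 1809 * (d ^ 2 * Lp ^ 2 * W) := by ring
      _ ≤ 1809 * (d ^ 2 * Lp ^ 3 * W) := by gcongr; norm_num
  have hburn : P.initLength + burnInLength d σ γ₀ Lp W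
      ≤ 27 * c * W₀ * L ^ 3 * (d ^ 2 * (I + 1)) := by
    calc P.initLength + burnInLength d σ γ₀ Lp W ≤ c * (d ^ 2 * Lp ^ 3 * W) := by
          rw [hc_def, add_mul, burnInLength]; gcongr
      _ ≤ c * (d ^ 2 * Lp ^ 3 * (W₀ * (I + 1))) := by gcongr
      _ = _ := by rw [hLp_def]; ring
  have hburn0 : 0 ≤ burnInLength d σ γ₀ Lp W := by unfold burnInLength; positivity
  refine ⟨P, fun T hT θs hθs Ω _ _ μ _ ℱ cand z θ a r h => ?_⟩
  set K := 54 * c * W₀ + 6 * lateConst σ γ₀ S₁ with hK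
  have hKlate : 6 * lateConst σ γ₀ S₁ ≤ K := by
    have : 0 ≤ 54 * c * W₀ := by positivity
    linarith
  have hT₀ : 2 * (P.initLength + burnInLength d σ γ₀ Lp W)
      ≤ K * L ^ 3 * (d ^ 2 * (I + 1)) := by
    have : 54 * c * W₀ * L ^ 3 * (d ^ 2 * (I + 1)) ≤ K * L ^ 3 * (d ^ 2 * (I + 1)) := by
      gcongr; linarith
    linarith
  rcases lt_or_ge T P.initLength with hTn | hTn
  -- Every t ≤ T lies below the burn-in time, so the event is the whole space.
  · refine le_trans (by linarith) (le_of_eq ((congrArg μ.real ?_).trans probReal_univ).symm)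
    refine Set.eq_univ_of_forall fun ω t ht htT => ?_
    have : (t : ℝ) < P.initLength := by exact_mod_cast lt_of_le_of_lt ht hTn
    have : (0 : ℝ) ≤ P.initLength := Nat.cast_nonneg _
    linarith
  have hfail1 := h.measure_init_lt_le hd hf.monotone hθs rfl hΔ0 rfl hplays (Lp := Lp)
    (by
      have := Nat.le_ceil (8 * Lp / Δ ^ 2)
      rwa [div_le_iff₀ (by positivity)] at this)
    (Nat.le_ceil _)
  have hfail2 := h.measure_not_follows_le hd hf.monotone hf.bounded hθs φ hσ hσ1 hlamσ
    (by linarith) (fun _ => rfl) hPα (H := T + 1) (by omega)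
  have hfail := (add_le_add hfail1 hfail2).trans
    (failure_le hδ hT (P.numCandidates_le_initLength hplays) hTn)
  set good := {ω | ∀ t ≤ T, K * L ^ 3 * (d ^ 2 * (I + 1)) ≤ t →
    1 - γ₀ ≤ ⟪θs, θ t ω⟫ ∧ (1 - ⟪θs, θ t ω⟫) * t ≤ K * L * d ^ 2} with hgood
  have hbad : μ goodᶜ ≤ ENNReal.ofReal δ := by
    refine le_trans (le_trans (measure_mono ?_) (measure_union_le _ _)) hfail
    intro ω hω
    by_contra hcon
    rw [Set.mem_union, not_or] at hcon
    obtain ⟨hc1, hc2⟩ := hcon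
    have hstart : 7 / 10 / √(d : ℝ) ≤ ⟪θs, θ P.initLength ω⟫ := not_lt.1 hc1
    have hfollow : ∀ i k, k < N i → P.initLength + phaseStart N i + k < T + 1 →
        B i - (φ i).dev ≤ ⟪θs, θ (P.initLength + phaseStart N i + k) ω⟫ := by
      by_contra hc3
      exact hc2 ⟨hB0.trans hstart, hc3⟩
    refine hω fun t ht htT => ?_
    have hti : P.initLength ≤ t := by
      have : (P.initLength : ℝ) ≤ t := by
        have : (0 : ℝ) ≤ P.initLength := Nat.cast_nonneg _
        linarith
      exact_mod_cast this
    obtain ⟨n, rfl⟩ := Nat.exists_eq_add_of_le hti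
    obtain ⟨i, k, hk, rfl⟩ := exists_phase (N := N) (fun i => (φ i).N_pos) n
    have hm := hfollow i k hk (by omega)
    rw [add_assoc] at hm
    set m := ⟪θs, θ (P.initLength + (phaseStart N i + k)) ω⟫
    -- The time exceeds twice the initialization plus burn-in, so it is at most twice the time
    -- elapsed since.
    have hn : ((P.initLength + (phaseStart N i + k) : ℕ) : ℝ) ≤
        2 * (((phaseStart N i + k : ℕ) : ℝ) - burnInLength d σ γ₀ Lp W) := by
      rw [Nat.cast_add] at htT ⊢
      linarith
    have hn0 : (0 : ℝ) ≤ (P.initLength + (phaseStart N i + k) : ℕ) := Nat.cast_nonneg _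
    obtain ⟨h1, h2⟩ := hφ i k hk (by linarith)
    refine ⟨h1.trans hm, ?_⟩
    have hKL : 0 ≤ K * L * d ^ 2 := by positivity
    rcases le_total (1 - (B i - (φ i).dev)) 0 with hneg | hpos
    · refine le_trans (mul_nonpos_of_nonpos_of_nonneg (by linarith) hn0) hKL
    · calc (1 - m) * ((P.initLength + (phaseStart N i + k) : ℕ) : ℝ)
          ≤ (1 - (B i - (φ i).dev)) *
            (2 * (((phaseStart N i + k : ℕ) : ℝ) - burnInLength d σ γ₀ Lp W)) :=
            mul_le_mul (by linarith) hn hn0 hpos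
        _ ≤ 2 * (lateConst σ γ₀ S₁ * (d ^ 2 * Lp)) := by linarith
        _ = 6 * lateConst σ γ₀ S₁ * L * d ^ 2 := by rw [hLp_def]; ring
        _ ≤ K * L * d ^ 2 := by
          have h3 : 6 * lateConst σ γ₀ S₁ ≤ K := hKlate
          have h4 : 0 ≤ L := by linarith
          gcongr
  have h1 : (1 : ℝ≥0∞) ≤ μ good + ENNReal.ofReal δ := by
    calc (1 : ℝ≥0∞) = μ Set.univ := measure_univ.symm
      _ ≤ μ good + μ goodᶜ := measure_univ_le_add_compl _
      _ ≤ _ := by gcongr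
  have h2 := ENNReal.toReal_mono (by finiteness) h1
  rw [ENNReal.toReal_add (by finiteness) (by finiteness), ENNReal.toReal_ofReal hδ.le] at h2
  simp only [ENNReal.toReal_one] at h2
  show 1 - δ ≤ (μ good).toReal
  linarith

/-! ### Pure exploration and regret -/

/-- A procedure that does not explore. -/
def Procedure.idle : Procedure where
  numCandidates := 0
  numPlays := 0
  threshold := 0
  η _ := 1
  σ _ := 0
  η_pos _ := one_pos
  σ_mem _ := ⟨le_rfl, zero_le_one⟩

theorem burnInIntegral_mono (f : ℝ → ℝ) (d : ℕ) : Monotone (burnInIntegral f d) := fun _ _ h =>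
  lintegral_mono_set (Set.Icc_subset_Icc_right h)

theorem inv_sqrt_le_sub_sqrt (t : ℕ) : 1 / √(t : ℝ) ≤ 4 * (√((t + 1 : ℕ) : ℝ) - √(t : ℝ)) := by
  -- At t = 0 the left side is 1 / 0 = 0.
  rcases Nat.eq_zero_or_pos t with rfl | ht
  · simp
  · have ht1 : (1 : ℝ) ≤ t := by exact_mod_cast ht
    set x := √(t : ℝ)
    set y := √((t + 1 : ℕ) : ℝ)
    have hx : 1 ≤ x := Real.one_le_sqrt.2 ht1
    have hxx : x * x = t := Real.mul_self_sqrt (by linarith)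
    have hyy : y * y = t + 1 := by
      rw [Real.mul_self_sqrt (by positivity)]; push_cast; ring
    have hy0 : 0 ≤ y := Real.sqrt_nonneg _
    have hyx : y ≤ 3 * x := by nlinarith
    have e : (y - x) * (y + x) = 1 := by linarith [mul_self_sub_mul_self y x]
    have hd : 0 ≤ y - x := by nlinarith
    rw [div_le_iff₀ (by linarith)]
    nlinarith

theorem sum_inv_sqrt_le (T : ℕ) : ∑ t ∈ Finset.range T, 1 / √(t : ℝ) ≤ 4 * √(T : ℝ) := by
  calc _ ≤ ∑ t ∈ Finset.range T, 4 * (√((t + 1 : ℕ) : ℝ) - √(t : ℝ)) :=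
        Finset.sum_le_sum fun t _ => inv_sqrt_le_sub_sqrt t
    _ = _ := by
        rw [← Finset.mul_sum, Finset.sum_range_sub fun t : ℕ => √(t : ℝ)]; simp

theorem sum_le_of_decay {T : ℕ} {x : ℕ → ℝ} {T₀ A : ℝ} (hT₀ : 0 ≤ T₀) (hA : 0 ≤ A)
    (hx2 : ∀ t < T, x t ≤ 2) (hx : ∀ t < T, T₀ ≤ t → x t ≤ A / √(t : ℝ)) :
    ∑ t ∈ Finset.range T, x t ≤ 2 * (T₀ + 1) + 4 * A * √(T : ℝ) := by
  have h1 : ∀ t ∈ Finset.range T, x t ≤ (if t < ⌈T₀⌉₊ then 2 else 0) + A * (1 / √(t : ℝ)) := by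
    intro t ht
    have ht' := Finset.mem_range.1 ht
    have hA' : 0 ≤ A * (1 / √(t : ℝ)) := by positivity
    split_ifs with h
    · linarith [hx2 t ht']
    · have := hx t ht' (Nat.ceil_le.1 (not_lt.1 h))
      rwa [zero_add, mul_one_div]
  have h2 : ∑ t ∈ Finset.range T, (if t < ⌈T₀⌉₊ then (2 : ℝ) else 0) ≤ 2 * (T₀ + 1) := by
    rw [← Finset.sum_filter, Finset.sum_const, nsmul_eq_mul]
    have h3 : ((Finset.range T).filter (· < ⌈T₀⌉₊)).card ≤ ⌈T₀⌉₊ := by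
      calc _ ≤ (Finset.range ⌈T₀⌉₊).card := Finset.card_le_card fun t ht => by
            rw [Finset.mem_range]; exact (Finset.mem_filter.1 ht).2
        _ = _ := Finset.card_range _
    have h4 : (((Finset.range T).filter (· < ⌈T₀⌉₊)).card : ℝ) ≤ T₀ + 1 :=
      le_trans (by exact_mod_cast h3) (Nat.ceil_lt_add_one hT₀).le
    linarith
  calc _ ≤ ∑ t ∈ Finset.range T, ((if t < ⌈T₀⌉₊ then (2 : ℝ) else 0) + A * (1 / √(t : ℝ))) :=
        Finset.sum_le_sum h1
    _ ≤ 2 * (T₀ + 1) + A * (4 * √(T : ℝ)) := by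
        rw [Finset.sum_add_distrib, ← Finset.mul_sum]
        exact add_le_add h2 (mul_le_mul_of_nonneg_left (sum_inv_sqrt_le T) hA)
    _ = _ := by ring

section Run

variable {d : ℕ} {Ω : Type*} [mΩ : MeasurableSpace Ω] [StandardBorelSpace Ω]
  {P : Procedure} {f : ℝ → ℝ} {θs : Vec d} {μ : Measure Ω} [IsProbabilityMeasure μ]
  {ℱ : Filtration ℕ mΩ} {cand z θ a : ℕ → Ω → Vec d} {r : ℕ → Ω → ℝ}

theorem IsRun.ae_regret_le_two (h : IsRun P f θs μ ℱ cand z θ a r)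
    (hf : ∀ x ∈ Set.Icc (-1 : ℝ) 1, |f x| ≤ 1) (hθs : ‖θs‖ = 1) :
    ∀ᵐ ω ∂μ, ∀ t, f 1 - f ⟪θs, θ t ω⟫ ≤ 2 := by
  filter_upwards [h.ae_abs_le_one hθs] with ω hω t
  have h1 := abs_le.1 (hf 1 ⟨by norm_num, le_rfl⟩)
  have h2 := abs_le.1 (hf _ (abs_le.1 (hω t)))
  linarith

theorem IsRun.ae_sum_regret_le (h : IsRun P f θs μ ℱ cand z θ a r)
    (hf : ∀ x ∈ Set.Icc (-1 : ℝ) 1, |f x| ≤ 1) (hθs : ‖θs‖ = 1) {c : ℝ} (hc : 2 ≤ c) (T : ℕ) :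
    ∀ᵐ ω ∂μ, ENNReal.ofReal (∑ t ∈ Finset.range T, (f 1 - f ⟪θs, θ t ω⟫)) ≤
      ENNReal.ofReal c * T := by
  filter_upwards [h.ae_regret_le_two hf hθs] with ω hω
  rw [← ENNReal.ofReal_natCast, ← ENNReal.ofReal_mul (by linarith)]
  apply ENNReal.ofReal_le_ofReal
  calc _ ≤ ∑ t ∈ Finset.range T, (2 : ℝ) := Finset.sum_le_sum fun t _ => hω t
    _ = 2 * T := by rw [Finset.sum_const, Finset.card_range, nsmul_eq_mul, mul_comm]
    _ ≤ c * T := by gcongr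

end Run

theorem one_sub_le_of_ae {Ω : Type*} [MeasurableSpace Ω] {μ : Measure Ω} [IsProbabilityMeasure μ]
    {p : Ω → Prop} (h : ∀ᵐ ω ∂μ, p ω) {x : ℝ} (hx : 0 ≤ x) : 1 - x ≤ μ.real {ω | p ω} := by
  have : μ.real {ω | p ω} = 1 := by
    rw [Measure.real, measure_congr (Filter.eventuallyEq_univ.2 h), measure_univ, ENNReal.toReal_one]
  linarith

section

variable {γ₀ γ₁ γ₂ K : ℝ} {d : ℕ} {f : ℝ → ℝ} {δ : ℝ}

/-- The sample complexity of pure exploration. -/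
theorem rounds_le {I : ℝ≥0∞} {I' : ℝ≥0∞} (hI : I ≤ I') (hI' : I' ≠ ∞) {ε L L' C : ℝ} (hd : 2 ≤ d)
    (hε : 0 < ε) (hε2 : ε < 2) (hK : 1 ≤ K) (hL : 1 ≤ L) (hLL : L ≤ L') (hC : 6 * K ≤ C) :
    ((⌈K * L ^ 3 * (d ^ 2 * (I.toReal + 1)) + K * L * d ^ 2 / ε⌉₊ : ℕ) : ℝ≥0∞) ≤
      ENNReal.ofReal (C * L' ^ 3) * ((d : ℝ≥0∞) ^ 2 * I' + ENNReal.ofReal ((d : ℝ) ^ 2 / ε)) := by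
  have hd2 : (2 : ℝ) ≤ d := by exact_mod_cast hd
  have hII : I.toReal ≤ I'.toReal := ENNReal.toReal_mono hI' hI
  have hI0 : 0 ≤ I.toReal := ENNReal.toReal_nonneg
  set R := K * L ^ 3 * (d ^ 2 * (I.toReal + 1)) + K * L * d ^ 2 / ε with hR
  have e1 : (d : ℝ≥0∞) ^ 2 * I' + ENNReal.ofReal ((d : ℝ) ^ 2 / ε)
      = ENNReal.ofReal ((d : ℝ) ^ 2 * I'.toReal + (d : ℝ) ^ 2 / ε) := by
    rw [ENNReal.ofReal_add (by positivity) (by positivity), ENNReal.ofReal_mul (by positivity),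
      ENNReal.ofReal_toReal hI', ENNReal.ofReal_pow (by positivity), ENNReal.ofReal_natCast]
  rw [e1, ← ENNReal.ofReal_mul (by have : 0 ≤ C := by linarith
                                   have : 0 ≤ L' := by linarith
                                   positivity), ← ENNReal.ofReal_natCast]
  apply ENNReal.ofReal_le_ofReal
  have hR1 : 1 ≤ R := by
    have h1 : (1 : ℝ) * 1 ^ 3 * (1 ^ 2 * (0 + 1)) ≤ K * L ^ 3 * (d ^ 2 * (I.toReal + 1)) := by
      gcongr; linarith
    have h2 : 0 ≤ K * L * d ^ 2 / ε := by positivity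
    linarith
  -- As ε < 2, the additive d² of the burn-in time is absorbed by d² / ε.
  have h3 : (d : ℝ) ^ 2 ≤ 2 * (d ^ 2 / ε) := by
    rw [mul_div_assoc', le_div_iff₀ hε]
    nlinarith [sq_nonneg (d : ℝ)]
  have h4 : K * L * d ^ 2 / ε ≤ K * L ^ 3 * (d ^ 2 / ε) := by
    rw [mul_div_assoc]
    gcongr
    exact le_self_pow₀ hL (by norm_num)
  have h5 : d ^ 2 * (I.toReal + 1) ≤ d ^ 2 * I'.toReal + 2 * (d ^ 2 / ε) := by
    have : (d : ℝ) ^ 2 * I.toReal ≤ d ^ 2 * I'.toReal := by gcongr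
    linarith
  have hpos : 0 ≤ (d : ℝ) ^ 2 * I'.toReal := by positivity
  calc (⌈R⌉₊ : ℝ) ≤ 2 * R := by linarith [(Nat.ceil_lt_add_one (by linarith : 0 ≤ R))]
    _ ≤ 2 * (K * L ^ 3 * (d ^ 2 * I'.toReal + 2 * (d ^ 2 / ε)) + K * L ^ 3 * (d ^ 2 / ε)) := by
      rw [hR]; gcongr
    _ = K * L ^ 3 * (2 * (d ^ 2 * I'.toReal) + 6 * (d ^ 2 / ε)) := by ring
    _ ≤ K * L ^ 3 * (6 * (d ^ 2 * I'.toReal + d ^ 2 / ε)) := by gcongr; linarith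
    _ = 6 * K * L ^ 3 * (d ^ 2 * I'.toReal + d ^ 2 / ε) := by ring
    _ ≤ C * L' ^ 3 * (d ^ 2 * I'.toReal + d ^ 2 / ε) := by
      have : 0 ≤ C := by linarith
      gcongr

/-- From the convergence rate to the regret. -/
theorem sum_regret_le (hγ₀ : γ₀ < 2) (hγ₂ : 0 < γ₂) (hf : IsLink f γ₀ γ₁ γ₂) (hd : 2 ≤ d)
    (hK : 1 ≤ K) {L I : ℝ} (hL : 1 ≤ L) (hI : 0 ≤ I) {T : ℕ} (hT : d ^ 2 ≤ T) {m : ℕ → ℝ}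
    (hm : ∀ t, |m t| ≤ 1) (hreg : ∀ t, f 1 - f (m t) ≤ 2)
    (hrate : ∀ t ≤ T, K * L ^ 3 * (d ^ 2 * (I + 1)) ≤ t →
      1 - γ₀ ≤ m t ∧ (1 - m t) * t ≤ K * L * d ^ 2) :
    ∑ t ∈ Finset.range T, (f 1 - f (m t)) ≤
      6 * K * (1 + γ₂) * L ^ 3 * (d ^ 2 * I + d * √(T : ℝ)) := by
  have hd2 : (2 : ℝ) ≤ d := by exact_mod_cast hd
  set T₀ := K * L ^ 3 * (d ^ 2 * (I + 1)) with hT₀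
  have hT₀d : (d : ℝ) ^ 2 ≤ T₀ := by
    calc (d : ℝ) ^ 2 = 1 * 1 ^ 3 * (d ^ 2 * (0 + 1)) := by ring
      _ ≤ T₀ := by rw [hT₀]; gcongr
  have hT₀1 : 1 ≤ T₀ := le_trans (by nlinarith) hT₀d
  have h1 := sum_le_of_decay (T := T) (x := fun t => f 1 - f (m t)) (T₀ := T₀)
    (A := γ₂ * (K * L * d)) (by linarith) (by positivity) (fun t _ => hreg t) (by
      intro t ht hT₀t
      obtain ⟨h2, h3⟩ := hrate t ht.le hT₀t
      have ht0 : (0 : ℝ) < t := by linarith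
      have hst : 0 < √(t : ℝ) := Real.sqrt_pos.2 ht0
      have hss : √(t : ℝ) * √(t : ℝ) = t := Real.mul_self_sqrt ht0.le
      -- After the burn-in t ≥ d², which weakens the rate d² / t to the summable form d / √t.
      have hds : (d : ℝ) ≤ √(t : ℝ) := Real.le_sqrt_of_sq_le (hT₀d.trans hT₀t)
      have h4 : (1 - m t) * √(t : ℝ) ≤ K * L * d := by
        have h5 : (1 - m t) * √(t : ℝ) * √(t : ℝ) ≤ K * L * d * √(t : ℝ) := by
          rw [mul_assoc, hss]
          refine h3.trans ?_
          rw [sq, ← mul_assoc]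
          gcongr
        exact le_of_mul_le_mul_right h5 hst
      rw [le_div_iff₀ hst]
      calc (f 1 - f (m t)) * √(t : ℝ) ≤ γ₂ * (1 - m t) * √(t : ℝ) := by
            gcongr
            exact hf.sub_le hγ₀ h2 (abs_le.1 (hm t)).2
        _ = γ₂ * ((1 - m t) * √(t : ℝ)) := by ring
        _ ≤ _ := by gcongr)
  have hdT : (d : ℝ) ≤ √(T : ℝ) := Real.le_sqrt_of_sq_le (by exact_mod_cast hT)
  -- For T ≥ d² the additive d² of the burn-in time is absorbed by d √T.
  have hdd : (d : ℝ) ^ 2 ≤ d * √(T : ℝ) := by rw [sq]; gcongr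
  have hLL : L ≤ L ^ 3 := le_self_pow₀ hL (by norm_num)
  set Q := d * √(T : ℝ) with hQ
  have hQ0 : 0 ≤ Q := by positivity
  have hI' : 0 ≤ (d : ℝ) ^ 2 * I := by positivity
  have h6 : T₀ ≤ K * L ^ 3 * (d ^ 2 * I + Q) := by
    rw [hT₀]; gcongr; linarith
  have h7 : γ₂ * (K * L * d) * √(T : ℝ) ≤ K * γ₂ * L ^ 3 * (d ^ 2 * I + Q) := by
    calc γ₂ * (K * L * d) * √(T : ℝ) = K * γ₂ * L * Q := by rw [hQ]; ring
      _ ≤ K * γ₂ * L ^ 3 * (d ^ 2 * I + Q) := by gcongr; linarith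
  have h8 : 0 ≤ K * γ₂ * L ^ 3 * (d ^ 2 * I + Q) := by positivity
  have h9 : 0 ≤ K * L ^ 3 * (d ^ 2 * I + Q) := by positivity
  have e : 6 * K * (1 + γ₂) * L ^ 3 * (d ^ 2 * I + Q) = 6 * (K * L ^ 3 * (d ^ 2 * I + Q)) +
    6 * (K * γ₂ * L ^ 3 * (d ^ 2 * I + Q)) := by ring
  linarith

end

end RidgeSGD

end

/-! ### The main theorem -/

theorem corollary1 (γ₀ γ₁ γ₂ c₀ : ℝ) (hγ₀ : 0 < γ₀) (hγ₀' : γ₀ ≤ 1 / 10) (hγ₁ : 0 < γ₁)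
    (hγ₂ : 0 < γ₂) (hc₀ : 0 < c₀) :
    ∃ C : ℝ, 0 < C ∧ ∃ k : ℕ, ∀ d : ℕ, 2 ≤ d → ∀ f : ℝ → ℝ,
      RidgeSGD.IsLink f γ₀ γ₁ γ₂ →
      (RidgeSGD.HasDerivLowerBound f c₀ ∨ ConvexOn ℝ (Set.Icc 0 1) f) →
      ∀ δ : ℝ, 0 < δ →
        -- pure exploration
        (∀ ε : ℝ, 0 < ε → ∃ (P : RidgeSGD.Procedure) (T : ℕ),
          (T : ℝ≥0∞) ≤ ENNReal.ofReal (C * Real.log (3 + d + 1 / ε + 1 / δ) ^ k) *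
            ((d : ℝ≥0∞) ^ 2 * RidgeSGD.burnInIntegral f d (1 - γ₀ / 4) +
              ENNReal.ofReal ((d : ℝ) ^ 2 / ε)) ∧
          ∀ θs : RidgeSGD.Vec d, ‖θs‖ = 1 →
          ∀ (Ω : Type*) [mΩ : MeasurableSpace Ω] [StandardBorelSpace Ω]
            (μ : Measure Ω) [IsProbabilityMeasure μ] (ℱ : Filtration ℕ mΩ)
            (cand z θ a : ℕ → Ω → RidgeSGD.Vec d) (r : ℕ → Ω → ℝ),
            RidgeSGD.IsRun P f θs μ ℱ cand z θ a r →
            1 - δ * T ≤ μ.real {ω | 1 - ε ≤ ⟪θs, θ T ω⟫}) ∧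
        -- regret minimization
        (∃ P : RidgeSGD.Procedure, ∀ T : ℕ,
          ∀ θs : RidgeSGD.Vec d, ‖θs‖ = 1 →
          ∀ (Ω : Type*) [mΩ : MeasurableSpace Ω] [StandardBorelSpace Ω]
            (μ : Measure Ω) [IsProbabilityMeasure μ] (ℱ : Filtration ℕ mΩ)
            (cand z θ a : ℕ → Ω → RidgeSGD.Vec d) (r : ℕ → Ω → ℝ),
            RidgeSGD.IsRun P f θs μ ℱ cand z θ a r →
            1 - δ * T ≤ μ.real {ω |
              ENNReal.ofReal (∑ t ∈ Finset.range T, (f 1 - f ⟪θs, θ t ω⟫)) ≤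
                ENNReal.ofReal (C * Real.log (3 + d + 1 / δ) ^ k) *
                  min (T : ℝ≥0∞)
                    ((d : ℝ≥0∞) ^ 2 * RidgeSGD.burnInIntegral f d (1 - γ₀ / 2) +
                      ENNReal.ofReal (d * √(T : ℝ)))}) := by

  -- The two occurrences of `Type*` in the statement are different universe levels, so the
  -- convergence result is instantiated once for each.
  obtain ⟨K₁, hK₁, H₁⟩ := RidgeSGD.exists_procedure (γ₂ := γ₂) hγ₀ hγ₀' hγ₁ hc₀
  obtain ⟨K₂, hK₂, H₂⟩ := RidgeSGD.exists_procedure (γ₂ := γ₂) hγ₀ hγ₀' hγ₁ hc₀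
  have hC₁ : 6 * K₁ ≤ 6 * K₁ + 6 * K₂ * (1 + γ₂) := by
    have : 0 ≤ 6 * K₂ * (1 + γ₂) := by positivity
    linarith
  have hC₂ : 6 * K₂ * (1 + γ₂) ≤ 6 * K₁ + 6 * K₂ * (1 + γ₂) := by linarith
  refine ⟨6 * K₁ + 6 * K₂ * (1 + γ₂), by positivity, 3, fun d hd f hf hA δ hδ => ⟨fun ε hε => ?_, ?_⟩⟩
  · have hδ' : 0 < 1 / δ := by positivity
    have hε' : 0 < 1 / ε := by positivity
    have hd0 : (0 : ℝ) ≤ d := Nat.cast_nonneg _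
    have hL := RidgeSGD.one_le_log_of_three_le (by linarith : 3 ≤ 3 + (d : ℝ) + 1 / δ)
    have hLL : Real.log (3 + d + 1 / δ) ≤ Real.log (3 + d + 1 / ε + 1 / δ) :=
      Real.log_le_log (by linarith) (by linarith)
    by_cases hε2 : 2 ≤ ε
    -- For ε ≥ 2 any unit vector is good enough, and no rounds are needed.
    · refine ⟨RidgeSGD.Procedure.idle, 0, by simp, fun θs hθs Ω _ _ μ _ ℱ cand z θ a r h => ?_⟩
      refine RidgeSGD.one_sub_le_of_ae ?_ (by simp)
      filter_upwards [h.ae_abs_le_one hθs] with ω hω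
      linarith [(abs_le.1 (hω 0)).1]
    · by_cases hI' : RidgeSGD.burnInIntegral f d (1 - γ₀ / 4) = ∞
      -- With an infinite integral any number of rounds is allowed, and T ≥ 1 / δ makes the
      -- probability bound void.
      · refine ⟨RidgeSGD.Procedure.idle, ⌈1 / δ⌉₊, ?_, fun θs hθs Ω _ _ μ _ ℱ cand z θ a r h => ?_⟩
        · have h1 : (d : ℝ≥0∞) ^ 2 ≠ 0 := pow_ne_zero _ (by simp; omega)
          have h2 : 0 < (6 * K₁ + 6 * K₂ * (1 + γ₂)) * Real.log (3 + d + 1 / ε + 1 / δ) ^ 3 := by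
            have : 0 < Real.log (3 + d + 1 / ε + 1 / δ) := by linarith
            positivity
          rw [hI', ENNReal.mul_top h1, top_add, ENNReal.mul_top (ENNReal.ofReal_pos.2 h2).ne']
          exact le_top
        · have h1 := Nat.le_ceil (1 / δ)
          rw [div_le_iff₀ hδ] at h1
          exact le_trans (by linarith) measureReal_nonneg
      · have hII : RidgeSGD.burnInIntegral f d (1 - γ₀ / 2) ≤ RidgeSGD.burnInIntegral f d (1 - γ₀ / 4) :=
          RidgeSGD.burnInIntegral_mono f d (by linarith)
        obtain ⟨P, hP⟩ := H₁ d hd f hf hA (ne_top_of_le_ne_top hI' hII) δ hδ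
        set L := Real.log (3 + d + 1 / δ)
        set T := ⌈K₁ * L ^ 3 * (d ^ 2 * ((RidgeSGD.burnInIntegral f d (1 - γ₀ / 2)).toReal + 1)) +
          K₁ * L * d ^ 2 / ε⌉₊ with hT_def
        refine ⟨P, T, RidgeSGD.rounds_le hII hI' hd hε (not_le.1 hε2) hK₁ hL hLL hC₁,
          fun θs hθs Ω _ _ μ _ ℱ cand z θ a r h => ?_⟩
        by_cases hT : T * δ ≤ 1
        · have hTle := Nat.le_ceil (K₁ * L ^ 3 *
            (d ^ 2 * ((RidgeSGD.burnInIntegral f d (1 - γ₀ / 2)).toReal + 1)) + K₁ * L * d ^ 2 / ε)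
          rw [← hT_def] at hTle
          have hpos : 0 < K₁ * L ^ 3 *
              (d ^ 2 * ((RidgeSGD.burnInIntegral f d (1 - γ₀ / 2)).toReal + 1)) := by
            have : (0 : ℝ) < d := by exact_mod_cast (by omega : 0 < d)
            have : 0 ≤ (RidgeSGD.burnInIntegral f d (1 - γ₀ / 2)).toReal := ENNReal.toReal_nonneg
            positivity
          have hpos' : 0 ≤ K₁ * L * d ^ 2 / ε := by positivity
          have hT0 : (0 : ℝ) < T := by linarith
          have hT1 : (1 : ℝ) ≤ T := by exact_mod_cast (Nat.cast_pos.1 hT0 : 0 < T)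
          refine le_trans ?_ ((hP T hT θs hθs Ω μ ℱ cand z θ a r h).trans
            (measureReal_mono fun ω hω => ?_))
          · nlinarith
          · have h1 := (hω T le_rfl (by linarith)).2
            have h2 : K₁ * L * d ^ 2 ≤ ε * T := by
              rw [← div_le_iff₀' hε]; linarith
            have h3 := le_of_mul_le_mul_right (h1.trans h2) hT0
            show 1 - ε ≤ _
            linarith
        · exact le_trans (by linarith) measureReal_nonneg
  · have hδ' : 0 < 1 / δ := by positivity
    have hd2 : (2 : ℝ) ≤ d := by exact_mod_cast hd
    have hL := RidgeSGD.one_le_log_of_three_le (by linarith : 3 ≤ 3 + (d : ℝ) + 1 / δ)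
    set L := Real.log (3 + d + 1 / δ)
    have hc : 2 ≤ (6 * K₁ + 6 * K₂ * (1 + γ₂)) * L ^ 3 := by
      have h1 : (6 : ℝ) * 1 ≤ 6 * K₁ + 6 * K₂ * (1 + γ₂) := by linarith
      calc (2 : ℝ) ≤ 6 * 1 * 1 ^ 3 := by norm_num
        _ ≤ _ := by gcongr
    by_cases hI : RidgeSGD.burnInIntegral f d (1 - γ₀ / 2) = ∞
    · refine ⟨RidgeSGD.Procedure.idle, fun T θs hθs Ω _ _ μ _ ℱ cand z θ a r h => ?_⟩
      have h1 : (d : ℝ≥0∞) ^ 2 ≠ 0 := pow_ne_zero _ (by simp; omega)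
      rw [hI, ENNReal.mul_top h1, top_add, min_eq_left le_top]
      exact RidgeSGD.one_sub_le_of_ae (h.ae_sum_regret_le hf.bounded hθs hc T) (by positivity)
    · obtain ⟨P, hP⟩ := H₂ d hd f hf hA hI δ hδ
      refine ⟨P, fun T θs hθs Ω _ _ μ _ ℱ cand z θ a r h => ?_⟩
      set I := RidgeSGD.burnInIntegral f d (1 - γ₀ / 2)
      have hae := h.ae_sum_regret_le hf.bounded hθs hc T
      -- For T ≤ d² the minimum is T because T ≤ d √T, and each round costs at most 2.
      by_cases hTd : T ≤ d ^ 2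
      · have h1 : (T : ℝ≥0∞) ≤ (d : ℝ≥0∞) ^ 2 * I + ENNReal.ofReal (d * √(T : ℝ)) := by
          refine le_trans ?_ le_add_self
          rw [← ENNReal.ofReal_natCast]
          apply ENNReal.ofReal_le_ofReal
          calc (T : ℝ) = √(T : ℝ) * √(T : ℝ) := (Real.mul_self_sqrt (Nat.cast_nonneg _)).symm
            _ ≤ d * √(T : ℝ) := by
              gcongr
              exact Real.sqrt_le_iff.2 ⟨by linarith, by exact_mod_cast hTd⟩
        rw [min_eq_left h1]
        exact RidgeSGD.one_sub_le_of_ae hae (by positivity)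
      by_cases hT : T * δ ≤ 1
      · have hT1 : (1 : ℝ) ≤ T := by exact_mod_cast (by omega : 1 ≤ T)
        refine le_trans (by nlinarith) ((hP T hT θs hθs Ω μ ℱ cand z θ a r h).trans
          (ENNReal.toReal_mono (measure_ne_top _ _) (measure_mono_ae ?_)))
        filter_upwards [hae, h.ae_regret_le_two hf.bounded hθs, h.ae_abs_le_one hθs]
          with ω h1 h2 h3 h4
        have h5 := RidgeSGD.sum_regret_le (by linarith) hγ₂ hf hd hK₂ hL ENNReal.toReal_nonneg
          (by omega) h3 h2 h4
        show _ ≤ _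
        rcases min_choice (T : ℝ≥0∞) ((d : ℝ≥0∞) ^ 2 * I + ENNReal.ofReal (d * √(T : ℝ)))
          with h6 | h6
        · rw [h6]; exact h1
        · have e : (d : ℝ≥0∞) ^ 2 * I + ENNReal.ofReal (d * √(T : ℝ))
              = ENNReal.ofReal ((d : ℝ) ^ 2 * I.toReal + d * √(T : ℝ)) := by
            rw [ENNReal.ofReal_add (by positivity) (by positivity),
              ENNReal.ofReal_mul (p := (d : ℝ) ^ 2) (by positivity), ENNReal.ofReal_toReal hI,
              ENNReal.ofReal_pow (by positivity), ENNReal.ofReal_natCast]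
          rw [h6, e, ← ENNReal.ofReal_mul (by linarith)]
          apply ENNReal.ofReal_le_ofReal
          refine h5.trans ?_
          gcongr
      · exact le_trans (by linarith) measureReal_nonneg
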